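/- **Setting.** Let $d,n\in\mathbb N$ and consider $\partial_t U+\sum_{j=1}^d A_j(U)\partial_{x_j}U=0$ for $2\pi$-periodic $U$ with values in $\mathbb R^n$, where the $A_j(\cdot)$ are real $n\times n$ matrices with polynomial entries. Let $S(\cdot)$ be an $n\times n$ matrix with real polynomial entries and $\mathcal U\subset\mathbb R^n$ an open set with $0\in\mathcal U$ such that, for all $v\in\mathcal U$, $S(v)$ is symmetric positive definite and every $S(v)A_j(v)$ is symmetric. Write $A_j^0=A_j(0)$, $A_j^1=A_j-A_j^0$, $S^0=S(0)$, $S^1=S-S^0$. For $s\ge0$, $H^s=H^s((2\pi\mathbb T)^d)^n$ is the space of real-valued periodic $L^2$ fields with $|U|_{H^s}^2=\sum_{k\in\mathbb Z^d}(1+|k|^2)^{s}|\widehat U_k|^2<\infty$. Let $\sigma\in C^1(\mathbb R^d;[0,1])$ be even, with $\sigma(k)=1$ if $\max_j|k_j|\le 1/2$, $\sigma(k)=0$ if $\max_j|k_j|\ge1$, and $|\cdot|\,\nabla\sigma^{1/2}\in L^\infty(\mathbb R^d)$. For an integer $N\ge1$ let $\mathsf S_N$ be the Fourier multiplier with symbol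 $\sigma(\cdot/N)$ and $\mathsf P_N$ the Fourier multiplier whose symbol is the indicator function of $\{-N,\dots,N\}^d$. Consider the problems $$\text{(a)}\quad \partial_tU_N+\mathsf S_N\Big(\sum_{j=1}^dA_j(U_N)\partial_{x_j}U_N\Big)=0,\qquad U_N|_{t=0}=\mathsf P_NU^0,$$ $$\text{(b)}\quad \partial_tU_N+\sum_{j=1}^d\Big(A_j^0\partial_{x_j}U_N+\mathsf S_N\big(A_j^1(U_N)\partial_{x_j}U_N\big)\Big)=0,\qquad U_N|_{t=0}=\mathsf P_NU^0.$$ **Proposition 3.2 (Uniform estimates).** Let $s>d/2+1$. The following two statements hold for problem (a). They also hold for problem (b) if, in addition, $S^0A_j^0$, $S^0A_j^1(v)+S^1(v)A_j^0$ and $S^1(v)A_j^1(v)$ are symmetric for all $j$ and all $v\in\mathcal U$. The constants below may depend on $d,n,A_j,S,\mathcal U,\sigma$, and otherwise only on the indicated quantities; in particular they never depend on $N$. 1. Let $M>0$ and let $\mathcal K\subset\mathcal U$ be compact. There are $C>0$ and $T>0$, depending only on $s,M,\mathcal K$, such that for every integer $N\ge1$ and every $U^0\in H^s$ with $|U^0|_{H^s}\le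 M$ and with values in $\mathcal K$ (almost everywhere), there is a unique maximal-in-time classical solution $U_N\in C(I_N;H^s)$, where $I_N\ni 0$ is an open interval. Moreover $I_N\supset[0,T/|U^0|_{H^s}]$ (read as $[0,\infty)$ if $U^0=0$), and for all $t$ in this interval $$|U_N(t)|_{H^s}\le C|U^0|_{H^s}\exp(C|U^0|_{H^s}t)\le 2C|U^0|_{H^s}.$$ Furthermore $U_N\in C^1(I_N;H^{s'})$ for every $s'\ge s$. 2. Let $s'\ge s$, $M^*>0$ and let $\mathcal K^*\subset\mathcal U$ be compact. There is $C^*>0$, depending only on $s,s',M^*,\mathcal K^*$, such that for every integer $N\ge1$, every $U^0\in H^{s'}$ and every $0<T^*\in I_N$, where $U_N\in C(I_N;H^s)$ is the unique maximal-in-time classical solution with data $\mathsf P_NU^0$: if $\sup_{t\in[0,T^*]}|U_N(t)|_{H^s}\le M^*$ and $U_N([0,T^*]\times\mathbb R^d)\subset\mathcal K^*$, then for all $0\le t\le T^*$ $$|U_N(t)|_{H^{s'}}\le C^*|U^0|_{H^{s'}}\exp(C^*M^*t).$$ -/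

import Mathlib

noncomputable section

namespace SpectralScheme

/-- Real vector fields `ℝ^d → ℝ^n`; those of interest are `2π`-periodic in each variable, that is,
they are functions on the torus `(2πT)^d`. -/
abbrev Field (d n : ℕ) : Type := (Fin d → ℝ) → (Fin n → ℝ)

/-- `2π`-periodicity in every variable. -/
def IsPeriodic {d n : ℕ} (u : Field d n) : Prop :=
  ∀ (j : Fin d) (x : Fin d → ℝ), u (x + Pi.single j (2 * Real.pi)) = u x

/-- The period cell `(0, 2π]^d`. -/
def cell (d : ℕ) : Set (Fin d → ℝ) := Set.univ.pi fun _ => Set.Ioc 0 (2 * Real.pi)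

/-- The phase `k · x`, for a frequency `k ∈ ℤ^d`. -/
def phase {d : ℕ} (k : Fin d → ℤ) (x : Fin d → ℝ) : ℝ := ∑ j, (k j : ℝ) * x j

/-- The `k`-th Fourier coefficient `(2π)^{-d} ∫ e^{-i k·x} u(x) dx ∈ ℂ^n`. -/
def fourierCoef {d n : ℕ} (u : Field d n) (k : Fin d → ℤ) : Fin n → ℂ := fun i =>
  (((2 * Real.pi) ^ d : ℝ) : ℂ)⁻¹ *
    ∫ x in cell d, Complex.exp (-(Complex.I * (phase k x : ℂ))) * (u x i : ℂ)

/-- The summand `⟨k⟩^{2s} |û_k|²` of the squared `H^s` norm, where `⟨k⟩² = 1 + |k|²`. -/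
def hsTerm {d n : ℕ} (s : ℝ) (u : Field d n) (k : Fin d → ℤ) : ℝ :=
  (1 + ∑ j, (k j : ℝ) ^ 2) ^ s * ∑ i, ‖fourierCoef u k i‖ ^ 2

/-- `u ∈ H^s((2πT)^d)^n`: `u` is periodic, square integrable on a period, and
`∑ ⟨k⟩^{2s} |û_k|² < ∞`. -/
def MemHs {d n : ℕ} (s : ℝ) (u : Field d n) : Prop :=
  IsPeriodic u ∧ MeasureTheory.MemLp u 2 (MeasureTheory.volume.restrict (cell d)) ∧
    Summable (hsTerm s u)

/-- The norm `|u|_{H^s} = (∑ ⟨k⟩^{2s} |û_k|²)^{1/2}` (only used for `u ∈ H^s`). -/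
def hsNorm {d n : ℕ} (s : ℝ) (u : Field d n) : ℝ := Real.sqrt (∑' k, hsTerm s u k)

/-- `U ∈ C(I; H^s)`. -/
def ContinuousIntoHs {d n : ℕ} (s : ℝ) (I : Set ℝ) (U : ℝ → Field d n) : Prop :=
  (∀ t ∈ I, MemHs s (U t)) ∧
    ∀ t ∈ I, Filter.Tendsto (fun τ => hsNorm s (U τ - U t)) (nhdsWithin t I) (nhds 0)

/-- `U ∈ C¹(I; H^s)`: `U` is continuous into `H^s` and has, in the `H^s` norm, a time derivative
that is continuous into `H^s`. -/
def ContDiffOneIntoHs {d n : ℕ} (s : ℝ) (I : Set ℝ) (U : ℝ → Field d n) : Prop :=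
  ContinuousIntoHs s I U ∧
    ∃ V : ℝ → Field d n, ContinuousIntoHs s I V ∧
      ∀ t ∈ I, Filter.Tendsto (fun τ => hsNorm s ((τ - t)⁻¹ • (U τ - U t) - V t))
        (nhdsWithin t (I \ {t})) (nhds 0)

/-- The Fourier multiplier `m(D)`, `u ↦ ∑_k m(k) û_k e^{i k·x}`. It is only used with even real `m`
of finite support, for which the sum is finite and, `u` being real, equal to its real part. -/
def multiplier {d n : ℕ} (m : (Fin d → ℤ) → ℝ) (u : Field d n) : Field d n := fun x i =>
  (∑' k, (m k : ℂ) * fourierCoef u k i * Complex.exp (Complex.I * (phase k x : ℂ))).re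

open Classical in
/-- The sharp low-pass filter `P_N`, with symbol the indicator of `{-N, …, N}^d`. -/
def sharpFilter {d n : ℕ} (N : ℕ) : Field d n → Field d n :=
  multiplier fun k => if ∀ j, |k j| ≤ (N : ℤ) then 1 else 0

/-- Admissible profiles `σ` of smooth low-pass filters. In the last condition `√σ` is
differentiable wherever `σ > 0`; at a zero of `σ` (a minimum of `√σ`) the derivative vanishes if it
exists, and `fderiv` is `0` by convention if it does not. For `σ` of class `C¹` the condition is
therefore exactly that the weak gradient of `√σ` satisfies `|·| ∇√σ ∈ L^∞`. -/
structure IsLowPassProfile {d : ℕ} (σ : EuclideanSpace ℝ (Fin d) → ℝ) : Prop where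
  contDiff : ContDiff ℝ 1 σ
  even : ∀ ξ, σ (-ξ) = σ ξ
  eq_one : ∀ ξ, (∀ j, |ξ j| ≤ 1 / 2) → σ ξ = 1
  eq_zero : ∀ ξ, (∃ j, 1 ≤ |ξ j|) → σ ξ = 0
  mem_Icc : ∀ ξ, σ ξ ∈ Set.Icc (0 : ℝ) 1
  gradient_sqrt : ∃ B : ℝ, ∀ ξ, ‖ξ‖ * ‖fderiv ℝ (fun η => Real.sqrt (σ η)) ξ‖ ≤ B

/-- The smooth low-pass filter with symbol `k ↦ σ(k / N)`, for `N ≥ 1`. -/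
def smoothFilter {d n : ℕ} (σ : EuclideanSpace ℝ (Fin d) → ℝ) (N : ℕ) : Field d n → Field d n :=
  multiplier fun k => σ (WithLp.toLp 2 fun j => (k j : ℝ) / (N : ℝ))

/-- `n × n` matrices whose entries are real polynomials in the `n` entries of the unknown. -/
abbrev PolyMatrix (n : ℕ) : Type := Matrix (Fin n) (Fin n) (MvPolynomial (Fin n) ℝ)

/-- The value `B(v)` of a polynomial matrix at `v ∈ ℝ^n`. -/
def PolyMatrix.evalAt {n : ℕ} (B : PolyMatrix n) (v : Fin n → ℝ) : Matrix (Fin n) (Fin n) ℝ :=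
  Matrix.of fun i j => MvPolynomial.eval v (B i j)

/-- `S` is a Friedrichs symmetrizer of `∂_t U + ∑_j A_j(U) ∂_j U = 0` on the domain `𝒰`, which is
an open set containing the origin. -/
structure IsSymmetrizer {d n : ℕ} (A : Fin d → PolyMatrix n) (S : PolyMatrix n)
    (𝒰 : Set (Fin n → ℝ)) : Prop where
  isOpen : IsOpen 𝒰
  zero_mem : (0 : Fin n → ℝ) ∈ 𝒰
  posDef : ∀ v ∈ 𝒰, (S.evalAt v).PosDef
  symm : ∀ v ∈ 𝒰, ∀ j, (S.evalAt v * (A j).evalAt v).IsSymm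

/-- Compatibility of the symmetrizer: with `A_j = A_j(0) + A_j¹` and `S = S(0) + S¹`, the matrices
`S(0) A_j(0)`, `S(0) A_j¹(v) + S¹(v) A_j(0)` and `S¹(v) A_j¹(v)` are symmetric for `v ∈ 𝒰`. -/
def IsCompatible {d n : ℕ} (A : Fin d → PolyMatrix n) (S : PolyMatrix n)
    (𝒰 : Set (Fin n → ℝ)) : Prop :=
  ∀ j, ∀ v ∈ 𝒰,
    (S.evalAt 0 * (A j).evalAt 0).IsSymm ∧
    (S.evalAt 0 * ((A j).evalAt v - (A j).evalAt 0) + (S.evalAt v - S.evalAt 0) * (A j).evalAt 0).IsSymm ∧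
    ((S.evalAt v - S.evalAt 0) * ((A j).evalAt v - (A j).evalAt 0)).IsSymm

/-- The partial derivative `∂_{x_j} u`. -/
def partialDeriv {d n : ℕ} (j : Fin d) (u : Field d n) : Field d n := fun x =>
  fderiv ℝ u x (Pi.single j 1)

/-- `S_N(∑_j A_j(u) ∂_j u)`: the spatial operator of the fully filtered scheme. -/
def filteredOp {d n : ℕ} (A : Fin d → PolyMatrix n) (σ : EuclideanSpace ℝ (Fin d) → ℝ) (N : ℕ)
    (u : Field d n) : Field d n :=
  smoothFilter σ N fun x => ∑ j, ((A j).evalAt (u x)).mulVec (partialDeriv j u x)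

/-- `∑_j (A_j(0) ∂_j u + S_N((A_j(u) - A_j(0)) ∂_j u))`: the spatial operator of the scheme in which
the linear part is left unfiltered. -/
def linearUnfilteredOp {d n : ℕ} (A : Fin d → PolyMatrix n) (σ : EuclideanSpace ℝ (Fin d) → ℝ)
    (N : ℕ) (u : Field d n) : Field d n := fun x =>
  ∑ j, (((A j).evalAt 0).mulVec (partialDeriv j u x) +
    smoothFilter σ N (fun y => ((A j).evalAt (u y) - (A j).evalAt 0).mulVec (partialDeriv j u y)) x)

/-- `U ∈ C(I; H^s)` is a classical solution of `∂_t U + F(U) = 0`, `U|_{t=0} = v`, on the open time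
interval `I ∋ 0`: it is of class `C¹` in `(t, x)` and the equation holds pointwise. -/
structure IsSolution {d n : ℕ} (s : ℝ) (F : Field d n → Field d n) (v : Field d n) (I : Set ℝ)
    (U : ℝ → Field d n) : Prop where
  isOpen : IsOpen I
  ordConnected : I.OrdConnected
  zero_mem : (0 : ℝ) ∈ I
  continuousIntoHs : ContinuousIntoHs s I U
  contDiffOn : ContDiffOn ℝ 1 (fun p : ℝ × (Fin d → ℝ) => U p.1 p.2) (I ×ˢ Set.univ)
  initial : U 0 = v
  equation : ∀ t ∈ I, ∀ x, HasDerivAt (fun τ => U τ x) (-(F (U t) x)) t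

/-- `(I, U)` is the unique maximal-in-time solution: it is a solution, and every other solution is
a restriction of it. -/
def IsUniqueMaximalSolution {d n : ℕ} (s : ℝ) (F : Field d n → Field d n) (v : Field d n)
    (I : Set ℝ) (U : ℝ → Field d n) : Prop :=
  IsSolution s F v I U ∧
    ∀ (J : Set ℝ) (V : ℝ → Field d n), IsSolution s F v J V → J ⊆ I ∧ ∀ t ∈ J, V t = U t

end SpectralScheme

end

/-!
# Uniform estimates for Fourier truncations of symmetrizable hyperbolic systems

Let `L = √S_N`. Both schemes have the form `∂_t U = -∑_b ∑_j L^{2b} (A_{b,j}(U) ∂_j U)` with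
`b ∈ {0, 1}`: the first has `A_0 = 0` and `A_1 = A`, the second has `A_0 = A(0)` and
`A_1 = A - A(0)`. The energy is `∑_a ⟨G_a(U) L^a Λ^r U, L^a Λ^r U⟩`, with `Λ^r` the multiplier of
symbol `⟨k⟩^r` and `G_0 = S, G_1 = 0` for the first scheme, `G_0 = S(0), G_1 = S - S(0)` for the
second. If all multipliers commuted with the coefficients, its derivative along solutions would be a
sum over `c ∈ {0, 1, 2}` of first-order forms in `L^c Λ^r U` with matrix `∑_{a + b = c} G_a A_b`
(`IsSymmetrizedBy`). The symmetry hypotheses say that these matrices are symmetric, so each form loses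
its derivative upon integration by parts (`sum_mean_symm`).

The commutators of `L` and `Λ^r` with the coefficients gain one derivative uniformly in `N`. For `L`
this uses that the gradient of `σ^{1/2}` is bounded by `B / |ξ|`, which is scale invariant
(`exists_lam_increment_le`); for `Λ^r` it is `jap_commutator_le`. The estimates take place in the group
algebra `TrigPoly d` of `ℤ^d`, that is, for trigonometric polynomials with the norms `ℓ¹` (the Wiener
algebra) and `ℓ²` of the coefficients. The energy flux is a sum of quadrilinear forms whose symbols are
bounded pointwise, and Young's inequality with two factors in `ℓ¹` and two in `ℓ²` suffices
(`norm_quad_le`, `exists_norm_flux_sub_le`, `exists_norm_flux_le`). The Wiener norm of the gradient is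
controlled by the `H^s` norm because `s > d/2 + 1`, and polynomial nonlinearities are handled by
`exists_moser_le`.

The energy is equivalent to the square of the `H^r` norm as long as `U` has values in a compact part of
`𝒰`: for the first scheme because `S` is positive definite there (`IsSymmetrizer.exists_isCoerciveOn`),
and for the second because `Λ^r U` splits into `L Λ^r U` and `(1 - L²)^{1/2} Λ^r U`, on which `S(U)` and
`S(0)` act (`IsSymmetrizer.exists_isCoerciveOn'`). Grönwall's inequality gives the a priori estimate
`IsLowPassProfile.exists_hsN_le`, which contains the propagation of higher norms.

Classical solutions are trigonometric polynomials with frequencies in `{-N, …, N}^d`: outside this box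
the filter vanishes, so that the Fourier coefficients of a solution obey a linear equation with zero
data (`IsSolution.exists_isODESolution`). The schemes are thus ordinary differential equations with a
smooth vector field on the finite-dimensional `boxSpace`, which gives a unique maximal solution
(`exists_maximal_isODESolution`) that is smooth in space.

The uniform time of existence is obtained by a bootstrap that keeps the values of `U` in a compact
neighbourhood of `K` (`exists_isODESolution_of_bootstrap`, `IsSymmetrizableScheme.exists_time_of_mem`).
The truncation `P_N U⁰` need not have values in `𝒰` even if `U⁰` does. It does so when `N` is large,
as it is then uniformly close to `U⁰` (`exists_synth_proj_mem_cthickening`), and when `U⁰` is small,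
as `0 ∈ 𝒰`. What remains are finitely many `N` with data bounded from above and below, for which the
compactness of the set of data gives a time and a bound (`exists_time_of_lt`).
-/


noncomputable section

namespace SpectralScheme

open Finset

/-! ### Frequencies and weights -/

/-- The frequency `k ∈ ℤ^d` as a point of Euclidean space. -/
def freqVec {d : ℕ} (k : Fin d → ℤ) : EuclideanSpace ℝ (Fin d) :=
  WithLp.toLp 2 fun j => (k j : ℝ)

/-- The Euclidean length `|k|` of a frequency. -/
def nrm {d : ℕ} (k : Fin d → ℤ) : ℝ := ‖freqVec k‖

/-- The Japanese bracket `⟨k⟩ = (1 + |k|²)^{1/2}`. -/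
def jap {d : ℕ} (k : Fin d → ℤ) : ℝ := Real.sqrt (1 + nrm k ^ 2)

/-- The weight `|k| ⟨k⟩^{r-1}`: it is comparable to `⟨k⟩^r` away from `k = 0`, where it vanishes, so
the seminorms built from it do not see constants. -/
def hweight {d : ℕ} (r : ℝ) (k : Fin d → ℤ) : ℝ := nrm k * jap k ^ (r - 1)

variable {d : ℕ}

lemma freqVec_add (k l : Fin d → ℤ) : freqVec (k + l) = freqVec k + freqVec l := by
  ext j; simp [freqVec]

lemma freqVec_neg (k : Fin d → ℤ) : freqVec (-k) = -freqVec k := by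
  ext j; simp [freqVec]

lemma nrm_nonneg (k : Fin d → ℤ) : 0 ≤ nrm k := norm_nonneg _

lemma nrm_neg (k : Fin d → ℤ) : nrm (-k) = nrm k := by
  simp [nrm, freqVec_neg]

lemma nrm_zero : nrm (0 : Fin d → ℤ) = 0 := by
  simpa [nrm] using (by ext j; simp [freqVec] : freqVec (0 : Fin d → ℤ) = 0)

lemma nrm_add_le (k l : Fin d → ℤ) : nrm (k + l) ≤ nrm k + nrm l := by
  simpa [nrm, freqVec_add] using norm_add_le _ _

lemma nrm_sq (k : Fin d → ℤ) : nrm k ^ 2 = ∑ j, (k j : ℝ) ^ 2 := by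
  simp [nrm, EuclideanSpace.norm_sq_eq, freqVec]

lemma abs_apply_le_nrm (k : Fin d → ℤ) (j : Fin d) : |(k j : ℝ)| ≤ nrm k := by
  have := PiLp.norm_apply_le (freqVec k) j
  simpa [freqVec, nrm] using this

lemma one_le_jap (k : Fin d → ℤ) : 1 ≤ jap k := by
  rw [jap, Real.one_le_sqrt]; nlinarith [sq_nonneg (nrm k)]

lemma jap_pos (k : Fin d → ℤ) : 0 < jap k := zero_lt_one.trans_le (one_le_jap k)

lemma jap_sq (k : Fin d → ℤ) : jap k ^ 2 = 1 + nrm k ^ 2 := Real.sq_sqrt (by positivity)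

lemma jap_neg (k : Fin d → ℤ) : jap (-k) = jap k := by simp [jap, nrm_neg]

lemma nrm_le_jap (k : Fin d → ℤ) : nrm k ≤ jap k :=
  Real.le_sqrt_of_sq_le (by linarith)

lemma jap_add_le (k l : Fin d → ℤ) : jap (k + l) ≤ nrm k + jap l := by
  refine Real.sqrt_le_iff.2 ⟨by have := nrm_nonneg k; have := jap_pos l; positivity, ?_⟩
  have h1 := jap_sq l
  have h2 := mul_le_mul_of_nonneg_left (nrm_le_jap l) (nrm_nonneg k)
  have h3 := pow_le_pow_left₀ (nrm_nonneg _) (nrm_add_le k l) 2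
  nlinarith

lemma jap_mono {k l : Fin d → ℤ} (h : nrm k ≤ nrm l) : jap k ≤ jap l :=
  Real.sqrt_le_sqrt (by have := nrm_nonneg k; gcongr)

lemma hweight_nonneg (r : ℝ) (k : Fin d → ℤ) : 0 ≤ hweight r k :=
  mul_nonneg (nrm_nonneg k) (Real.rpow_nonneg (jap_pos k).le _)

lemma hweight_le (r : ℝ) (k : Fin d → ℤ) : hweight r k ≤ jap k ^ r := by
  have : jap k ^ r = jap k * jap k ^ (r - 1) := by
    rw [Real.rpow_sub_one (jap_pos k).ne']; field_simp [(jap_pos k).ne']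
  rw [this, hweight]
  have := Real.rpow_nonneg (jap_pos k).le (r - 1)
  gcongr
  exact nrm_le_jap k

lemma hweight_add_le {r : ℝ} (hr : 1 ≤ r) (k l : Fin d → ℤ) :
    hweight r (k + l) ≤ 2 ^ r * (hweight r k + hweight r l) := by
  have key : ∀ k l : Fin d → ℤ, nrm l ≤ nrm k → hweight r (k + l) ≤ 2 ^ r * hweight r k := by
    intro k l h
    have h1 : nrm (k + l) ≤ 2 * nrm k := by linarith [nrm_add_le k l]
    have h2 : jap (k + l) ≤ 2 * jap k := by
      linarith [jap_add_le k l, jap_mono h, nrm_le_jap k]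
    have h3 : jap (k + l) ^ (r - 1) ≤ 2 ^ (r - 1) * jap k ^ (r - 1) := by
      rw [← Real.mul_rpow (by norm_num) (jap_pos k).le]
      exact Real.rpow_le_rpow (jap_pos _).le h2 (by linarith)
    have h4 : (2 : ℝ) ^ r = 2 * 2 ^ (r - 1) := by
      rw [Real.rpow_sub_one (by norm_num)]; ring
    calc hweight r (k + l) ≤ (2 * nrm k) * (2 ^ (r - 1) * jap k ^ (r - 1)) :=
          mul_le_mul h1 h3 (Real.rpow_nonneg (jap_pos _).le _) (by linarith [nrm_nonneg k])
      _ = 2 ^ r * hweight r k := by rw [h4, hweight]; ring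
  have h2 : (0 : ℝ) < 2 ^ r := by positivity
  rcases le_total (nrm l) (nrm k) with h | h
  · have := key k l h
    nlinarith [mul_nonneg h2.le (hweight_nonneg r l)]
  · have := key l k h
    rw [add_comm k l]
    nlinarith [mul_nonneg h2.le (hweight_nonneg r k)]

lemma rpow_sub_rpow_le {r x y : ℝ} (hr : 1 ≤ r) (hx : 0 < x) (hy : 0 < y) :
    x ^ r - y ^ r ≤ r * x ^ (r - 1) * (x - y) := by
  have h := one_add_mul_self_le_rpow_one_add (s := (y - x) / x)
    (by rw [le_div_iff₀ hx]; linarith) hr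
  have h1 : 1 + (y - x) / x = y / x := by field_simp; ring
  rw [h1, Real.div_rpow hy.le hx.le, le_div_iff₀ (by positivity)] at h
  have h2 : x ^ r = x ^ (r - 1) * x := by
    rw [Real.rpow_sub_one hx.ne']; field_simp
  have h3 : (1 + r * ((y - x) / x)) * x ^ r = x ^ r + r * x ^ (r - 1) * (y - x) := by
    rw [h2]; field_simp
  linarith

lemma abs_rpow_sub_rpow_le {r x y : ℝ} (hr : 1 ≤ r) (hx : 0 < x) (hy : 0 < y) :
    |x ^ r - y ^ r| ≤ r * max x y ^ (r - 1) * |x - y| := by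
  rcases le_total y x with h | h
  · rw [max_eq_left h, abs_of_nonneg (by linarith : 0 ≤ x - y),
      abs_of_nonneg (by linarith [Real.rpow_le_rpow hy.le h (by linarith : (0:ℝ) ≤ r)])]
    exact rpow_sub_rpow_le hr hx hy
  · rw [max_eq_right h, abs_sub_comm, abs_sub_comm x y, abs_of_nonneg (by linarith : 0 ≤ y - x),
      abs_of_nonneg (by linarith [Real.rpow_le_rpow hx.le h (by linarith : (0:ℝ) ≤ r)])]
    exact rpow_sub_rpow_le hr hy hx

/-- The symbol estimate behind the Kato–Ponce commutator `[Λ^r, a] ∂u`: the derivative that falls on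
`u` is traded for one on `a`. -/
lemma jap_commutator_le {r : ℝ} (hr : 1 ≤ r) (k l : Fin d → ℤ) :
    |jap (k + l) ^ r - jap l ^ r| * nrm l ≤
      r * 2 ^ (r - 1) * (nrm k * jap l ^ r + hweight r k * jap l) := by
  have hk := nrm_nonneg k
  have hl := nrm_nonneg l
  have hjk := jap_pos k
  have hjl := jap_pos l
  have h1 : |jap (k + l) - jap l| ≤ nrm k := by
    rw [abs_le]
    constructor
    · have := jap_add_le (-k) (k + l)
      rw [neg_add_cancel_left, nrm_neg] at this
      linarith
    · linarith [jap_add_le k l]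
  have h2 : max (jap (k + l)) (jap l) ≤ 2 * max (jap k) (jap l) := by
    have h3 := le_max_left (jap k) (jap l)
    have h4 := le_max_right (jap k) (jap l)
    refine max_le ?_ (by linarith)
    linarith [jap_add_le k l, nrm_le_jap k]
  have h3 : max (jap (k + l)) (jap l) ^ (r - 1) ≤
      2 ^ (r - 1) * (jap k ^ (r - 1) + jap l ^ (r - 1)) := by
    refine (Real.rpow_le_rpow (le_max_of_le_right hjl.le) h2 (by linarith)).trans ?_
    rw [Real.mul_rpow (by norm_num) (le_max_of_le_right hjl.le)]
    gcongr
    rcases le_total (jap k) (jap l) with h | h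
    · rw [max_eq_right h]; linarith [Real.rpow_nonneg hjk.le (r - 1)]
    · rw [max_eq_left h]; linarith [Real.rpow_nonneg hjl.le (r - 1)]
  have h4 : jap l ^ r = jap l ^ (r - 1) * jap l := by
    rw [Real.rpow_sub_one hjl.ne']; field_simp
  calc |jap (k + l) ^ r - jap l ^ r| * nrm l
      ≤ (r * (2 ^ (r - 1) * (jap k ^ (r - 1) + jap l ^ (r - 1))) * nrm k) * jap l := by
        refine mul_le_mul ?_ (nrm_le_jap l) hl ?_
        · refine (abs_rpow_sub_rpow_le hr (jap_pos _) hjl).trans ?_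
          have : 0 ≤ r := by linarith
          gcongr
        · have : 0 ≤ r := by linarith
          positivity
    _ = _ := by rw [h4, hweight]; ring

/-- A `d`-dimensional lattice sum of `⟨k⟩^{-p}` converges for `p > d`. -/
lemma summable_jap_rpow {p : ℝ} (hp : (d : ℝ) < p) :
    Summable fun k : Fin d → ℤ => jap k ^ (-p) := by
  classical
  let b := (Pi.basisFun ℝ (Fin d))
  let L : Submodule ℤ (Fin d → ℝ) := Submodule.span ℤ (Set.range b)
  have hfr : Module.finrank ℤ L = d := by
    rw [ZLattice.rank ℝ L]; simp
  have h := ZLattice.summable_norm_rpow L (-p) (by rw [hfr]; linarith)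
  let f : (Fin d → ℤ) → L := fun k => ⟨fun j => (k j : ℝ), by
    have : (fun j => (k j : ℝ)) = ∑ j, k j • b j := by
      ext i; simp [b, Finset.sum_apply, Pi.single_apply]
    rw [this]
    exact Submodule.sum_mem _ fun j _ => Submodule.smul_mem _ _
      (Submodule.subset_span ⟨j, rfl⟩)⟩
  have hf : Function.Injective f := by
    intro k l hkl
    ext j
    have h1 : (fun j => (k j : ℝ)) = fun j => (l j : ℝ) := congrArg Subtype.val hkl
    exact_mod_cast congrFun h1 j
  refine Summable.of_norm_bounded_eventually (g := fun k => ‖f k‖ ^ (-p)) (h.comp_injective hf) ?_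
  refine (Set.finite_singleton (0 : Fin d → ℤ)).subset fun k hk => ?_
  by_contra hne
  refine hk ?_
  have hpos : 0 < ‖f k‖ := by
    rw [norm_pos_iff]
    intro h0
    exact hne (hf (by rw [h0]; ext j; simp [f]))
  have hle : ‖f k‖ ≤ jap k := by
    refine le_trans ?_ (nrm_le_jap k)
    change ‖(fun j => (k j : ℝ))‖ ≤ nrm k
    rw [pi_norm_le_iff_of_nonneg (nrm_nonneg k)]
    exact fun j => abs_apply_le_nrm k j
  change ‖jap k ^ (-p)‖ ≤ ‖f k‖ ^ (-p)
  rw [Real.norm_of_nonneg (Real.rpow_nonneg (jap_pos k).le _)]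
  exact Real.rpow_le_rpow_of_nonpos hpos hle (by have : (0:ℝ) ≤ d := d.cast_nonneg; linarith)

end SpectralScheme
end

noncomputable section

namespace SpectralScheme

open Finset

/-! ### The square root of the filter -/

variable {d : ℕ}

/-- Increments of `√σ` away from the origin: `|√σ(ξ + η) - √σ(ξ)| |ξ| ≤ B |η|`. The square root need
not be differentiable, so the mean value theorem is applied to `√(σ + ε)`, whose gradient vanishes at
the zeros of `σ` and is elsewhere at most that of `√σ`. -/
lemma IsLowPassProfile.exists_sqrt_increment_le {σ : EuclideanSpace ℝ (Fin d) → ℝ}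
    (hσ : IsLowPassProfile σ) :
    ∃ B : ℝ, 0 ≤ B ∧ ∀ ξ η, |Real.sqrt (σ (ξ + η)) - Real.sqrt (σ ξ)| * ‖ξ‖ ≤ B * ‖η‖ := by
  obtain ⟨B₀, hB₀⟩ := hσ.gradient_sqrt
  have hB₀' : 0 ≤ B₀ := le_trans (by positivity) (hB₀ 0)
  refine ⟨2 + 2 * B₀, by linarith, fun ξ η => ?_⟩
  have hnn : ∀ ζ, 0 ≤ σ ζ := fun ζ => (hσ.mem_Icc ζ).1
  have hs1 : ∀ ζ, Real.sqrt (σ ζ) ≤ 1 := fun ζ => Real.sqrt_le_one.2 (hσ.mem_Icc ζ).2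
  rcases le_or_gt ‖ξ‖ (2 * ‖η‖) with h | h
  · have h1 : |Real.sqrt (σ (ξ + η)) - Real.sqrt (σ ξ)| ≤ 1 := by
      rw [abs_le]
      constructor <;>
        linarith [hs1 (ξ + η), hs1 ξ, Real.sqrt_nonneg (σ (ξ + η)), Real.sqrt_nonneg (σ ξ)]
    nlinarith [norm_nonneg ξ, norm_nonneg η, mul_le_mul_of_nonneg_right h1 (norm_nonneg ξ),
      mul_nonneg hB₀' (norm_nonneg η)]
  have hξ : 0 < ‖ξ‖ := by linarith [norm_nonneg η]
  have hdiff : Differentiable ℝ σ := hσ.contDiff.differentiable one_ne_zero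
  -- the gradient bound for `√(σ + ε)` on the segment from `ξ` to `ξ + η`
  have hgrad : ∀ ε : ℝ, 0 < ε → ∀ t ∈ Set.Icc (0 : ℝ) 1,
      |fderiv ℝ σ (ξ + t • η) η / (2 * Real.sqrt (σ (ξ + t • η) + ε))| ≤
        2 * B₀ * ‖η‖ / ‖ξ‖ := by
    intro ε hε t ht
    set p := ξ + t • η with hp
    have hpn : ‖ξ‖ / 2 ≤ ‖p‖ := by
      have h1 : ‖ξ‖ ≤ ‖p‖ + ‖t • η‖ := by
        have : ξ = p - t • η := by simp [hp]
        calc ‖ξ‖ = ‖p - t • η‖ := by rw [← this]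
          _ ≤ _ := norm_sub_le _ _
      have h2 : ‖t • η‖ ≤ ‖η‖ := by
        rw [norm_smul, Real.norm_of_nonneg ht.1]
        nlinarith [ht.2, norm_nonneg η]
      linarith
    have hpp : 0 < ‖p‖ := by linarith
    rcases (hnn p).eq_or_lt with h0 | h0
    · have hmin : IsLocalMin σ p := Filter.Eventually.of_forall fun ζ => by
        rw [← h0]; exact hnn ζ
      rw [hmin.fderiv_eq_zero]
      simp; positivity
    · have hsq : fderiv ℝ (fun ζ => Real.sqrt (σ ζ)) p =
          (1 / (2 * Real.sqrt (σ p))) • fderiv ℝ σ p :=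
        ((hdiff p).hasFDerivAt.sqrt h0.ne').fderiv
      have h1 : ‖p‖ * ‖fderiv ℝ (fun ζ => Real.sqrt (σ ζ)) p‖ ≤ B₀ := hB₀ p
      have h2 : |fderiv ℝ σ p η| / (2 * Real.sqrt (σ p)) ≤ B₀ / ‖p‖ * ‖η‖ := by
        have h3 : |fderiv ℝ σ p η| / (2 * Real.sqrt (σ p)) =
            ‖fderiv ℝ (fun ζ => Real.sqrt (σ ζ)) p η‖ := by
          have h4 : 0 < 1 / (2 * Real.sqrt (σ p)) :=
            one_div_pos.2 (mul_pos two_pos (Real.sqrt_pos.2 h0))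
          rw [hsq, smul_apply, smul_eq_mul, norm_mul, Real.norm_eq_abs,
            Real.norm_eq_abs, abs_of_pos h4]
          ring
        rw [h3]
        refine (ContinuousLinearMap.le_opNorm _ _).trans ?_
        gcongr
        rw [le_div_iff₀ hpp]; linarith
      have hpos : 0 < Real.sqrt (σ p) := Real.sqrt_pos.2 h0
      rw [abs_div, abs_of_pos (by positivity : 0 < 2 * Real.sqrt (σ p + ε))]
      calc |fderiv ℝ σ p η| / (2 * Real.sqrt (σ p + ε))
          ≤ |fderiv ℝ σ p η| / (2 * Real.sqrt (σ p)) := by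
            gcongr; linarith
        _ ≤ B₀ / ‖p‖ * ‖η‖ := h2
        _ ≤ B₀ / (‖ξ‖ / 2) * ‖η‖ := by gcongr
        _ = 2 * B₀ * ‖η‖ / ‖ξ‖ := by field_simp
  have hmv : ∀ ε : ℝ, 0 < ε →
      |Real.sqrt (σ (ξ + η) + ε) - Real.sqrt (σ ξ + ε)| ≤ 2 * B₀ * ‖η‖ / ‖ξ‖ := by
    intro ε hε
    have hd : ∀ t ∈ Set.Icc (0 : ℝ) 1, HasDerivWithinAt
        (fun t : ℝ => Real.sqrt (σ (ξ + t • η) + ε))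
        (fderiv ℝ σ (ξ + t • η) η / (2 * Real.sqrt (σ (ξ + t • η) + ε))) (Set.Icc 0 1) t := by
      intro t _
      have h1 : HasDerivAt (fun t : ℝ => ξ + t • η) η t := by
        simpa using ((hasDerivAt_id t).smul_const η).const_add ξ
      have h2 : HasDerivAt (fun t : ℝ => σ (ξ + t • η) + ε) (fderiv ℝ σ (ξ + t • η) η) t :=
        ((hdiff _).hasFDerivAt.comp_hasDerivAt t h1).add_const ε
      exact (h2.sqrt (by linarith [hnn (ξ + t • η)])).hasDerivWithinAt
    have := (convex_Icc (0 : ℝ) 1).norm_image_sub_le_of_norm_hasDerivWithin_le hd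
      (fun t ht => by rw [Real.norm_eq_abs]; exact hgrad ε hε t ht)
      (Set.left_mem_Icc.2 zero_le_one) (Set.right_mem_Icc.2 zero_le_one)
    simpa [Real.norm_eq_abs] using this
  have hlim : |Real.sqrt (σ (ξ + η)) - Real.sqrt (σ ξ)| ≤ 2 * B₀ * ‖η‖ / ‖ξ‖ := by
    have hc : Continuous fun ε : ℝ => |Real.sqrt (σ (ξ + η) + ε) - Real.sqrt (σ ξ + ε)| := by
      fun_prop
    have ht := (hc.tendsto 0).mono_left (nhdsWithin_le_nhds (s := Set.Ioi 0))
    simp only [add_zero] at ht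
    exact le_of_tendsto ht (by filter_upwards [self_mem_nhdsWithin] with ε hε using hmv ε hε)
  rw [le_div_iff₀ hξ] at hlim
  nlinarith [norm_nonneg η]

/-- The symbol `√σ(k/N)` of the square root of the smooth filter. -/
def lam (σ : EuclideanSpace ℝ (Fin d) → ℝ) (N : ℕ) (k : Fin d → ℤ) : ℝ :=
  Real.sqrt (σ (WithLp.toLp 2 fun j => (k j : ℝ) / (N : ℝ)))

variable {σ : EuclideanSpace ℝ (Fin d) → ℝ}

lemma lam_nonneg (N : ℕ) (k : Fin d → ℤ) : 0 ≤ lam σ N k := Real.sqrt_nonneg _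

lemma lam_le_one (hσ : IsLowPassProfile σ) (N : ℕ) (k : Fin d → ℤ) : lam σ N k ≤ 1 :=
  Real.sqrt_le_one.2 (hσ.mem_Icc _).2

lemma lam_sq (hσ : IsLowPassProfile σ) (N : ℕ) (k : Fin d → ℤ) :
    lam σ N k ^ 2 = σ (WithLp.toLp 2 fun j => (k j : ℝ) / (N : ℝ)) :=
  Real.sq_sqrt (hσ.mem_Icc _).1

lemma lam_neg (hσ : IsLowPassProfile σ) (N : ℕ) (k : Fin d → ℤ) : lam σ N (-k) = lam σ N k := by
  rw [lam, lam, ← hσ.even]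
  congr 2
  ext j; simp [neg_div]

lemma lam_eq_zero (hσ : IsLowPassProfile σ) {N : ℕ} (hN : 1 ≤ N) {k : Fin d → ℤ} {j : Fin d}
    (hk : (N : ℤ) ≤ |k j|) : lam σ N k = 0 := by
  rw [lam, hσ.eq_zero, Real.sqrt_zero]
  refine ⟨j, ?_⟩
  have hN' : (0 : ℝ) < N := by exact_mod_cast hN
  have : (N : ℝ) ≤ |(k j : ℝ)| := by exact_mod_cast hk
  simp only [abs_div, Nat.abs_cast]
  rwa [le_div_iff₀ hN', one_mul]

/-- Uniformly in `N`, the symbol of the square root of the filter varies slowly. -/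
lemma IsLowPassProfile.exists_lam_increment_le (hσ : IsLowPassProfile σ) :
    ∃ B : ℝ, 0 ≤ B ∧ ∀ N : ℕ, 1 ≤ N → ∀ k l : Fin d → ℤ,
      |lam σ N (k + l) - lam σ N l| * nrm l ≤ B * nrm k := by
  obtain ⟨B, hB, h⟩ := hσ.exists_sqrt_increment_le
  refine ⟨B, hB, fun N hN k l => ?_⟩
  have hN' : (0 : ℝ) < N := by exact_mod_cast hN
  have e : ∀ k : Fin d → ℤ, (WithLp.toLp 2 fun j => (k j : ℝ) / (N : ℝ) :
      EuclideanSpace ℝ (Fin d)) = (N : ℝ)⁻¹ • freqVec k := by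
    intro k; ext j; simp [freqVec, div_eq_inv_mul]
  have hn : ∀ k : Fin d → ℤ, ‖(N : ℝ)⁻¹ • freqVec k‖ = (N : ℝ)⁻¹ * nrm k := by
    intro k; rw [norm_smul, Real.norm_of_nonneg (by positivity), nrm]
  have := h ((N : ℝ)⁻¹ • freqVec l) ((N : ℝ)⁻¹ • freqVec k)
  rw [← smul_add, ← freqVec_add, add_comm l k, hn, hn] at this
  rw [lam, lam, e, e]
  refine le_of_mul_le_mul_left (a := (N : ℝ)⁻¹) ?_ (inv_pos.2 hN')
  linarith

lemma abs_pow_sub_pow_le_mul {x z : ℝ} (hx : 0 ≤ x) (hx1 : x ≤ 1) (hz : 0 ≤ z) (hz1 : z ≤ 1)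
    (n : ℕ) : |x ^ n - z ^ n| ≤ n * |x - z| := by
  refine (abs_pow_sub_pow_le (a := x) (b := z) (n := n)).trans ?_
  have : max |x| |z| ^ (n - 1) ≤ 1 :=
    pow_le_one₀ (by positivity) (max_le (by rwa [abs_of_nonneg hx]) (by rwa [abs_of_nonneg hz]))
  have h0 : 0 ≤ |x - z| * n := by positivity
  nlinarith

end SpectralScheme
end

noncomputable section

namespace SpectralScheme

open Finset

/-! ### The algebra of trigonometric polynomials -/

/-- Trigonometric polynomials `∑ a_k e^{i k·x}`, with pointwise multiplication, encoded through their
coefficients as the group algebra of `ℤ^d`. -/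
abbrev TrigPoly (d : ℕ) : Type := AddMonoidAlgebra ℂ (Fin d → ℤ)

variable {d n : ℕ}

/-- The Wiener norm `∑ |a_k|`. -/
instance : Norm (TrigPoly d) := ⟨fun a => ∑' k, ‖a.coeff k‖⟩

lemma norm_eq_tsum (a : TrigPoly d) : ‖a‖ = ∑' k, ‖a.coeff k‖ := rfl

lemma hasFiniteSupport_comp_coeff {f : (Fin d → ℤ) → ℂ → ℝ} (hf : ∀ k, f k 0 = 0)
    (a : TrigPoly d) : Summable fun k => f k (a.coeff k) :=
  summable_of_ne_finset_zero (s := a.coeff.support) fun k hk => by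
    rw [Finsupp.notMem_support_iff.1 hk, hf]

lemma summable_norm_coeff (a : TrigPoly d) : Summable fun k => ‖a.coeff k‖ :=
  hasFiniteSupport_comp_coeff (f := fun _ z => ‖z‖) (by simp) a

lemma summable_norm_coeff_sq (a : TrigPoly d) : Summable fun k => ‖a.coeff k‖ ^ 2 :=
  hasFiniteSupport_comp_coeff (f := fun _ z => ‖z‖ ^ 2) (by simp) a

lemma norm_coeff_le (a : TrigPoly d) (k : Fin d → ℤ) : ‖a.coeff k‖ ≤ ‖a‖ :=
  (summable_norm_coeff a).le_tsum k fun _ _ => norm_nonneg _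

lemma sum_norm_coeff_le (a : TrigPoly d) (s : Finset (Fin d → ℤ)) :
    ∑ k ∈ s, ‖a.coeff k‖ ≤ ‖a‖ :=
  (summable_norm_coeff a).sum_le_tsum s fun _ _ => norm_nonneg _

lemma norm_eq_sum {a : TrigPoly d} {s : Finset (Fin d → ℤ)} (hs : a.coeff.support ⊆ s) :
    ‖a‖ = ∑ k ∈ s, ‖a.coeff k‖ :=
  tsum_eq_sum fun k hk => by
    rw [Finsupp.notMem_support_iff.1 fun h => hk (hs h), norm_zero]

lemma norm_le_norm_of_coeff {a b : TrigPoly d} (h : ∀ k, ‖a.coeff k‖ ≤ ‖b.coeff k‖) :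
    ‖a‖ ≤ ‖b‖ :=
  (summable_norm_coeff a).tsum_le_tsum h (summable_norm_coeff b)

lemma norm_trigPoly_add_le (a b : TrigPoly d) : ‖a + b‖ ≤ ‖a‖ + ‖b‖ := by
  rw [norm_eq_tsum a, norm_eq_tsum b, ← (summable_norm_coeff a).tsum_add (summable_norm_coeff b)]
  exact (summable_norm_coeff _).tsum_le_tsum (fun k => norm_add_le _ _)
    ((summable_norm_coeff a).add (summable_norm_coeff b))

lemma norm_trigPoly_sum_le {ι : Type*} (s : Finset ι) (f : ι → TrigPoly d) :
    ‖∑ i ∈ s, f i‖ ≤ ∑ i ∈ s, ‖f i‖ :=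
  Finset.le_sum_of_subadditive _ (by simp [norm_eq_tsum]) norm_trigPoly_add_le s f

lemma norm_single (k : Fin d → ℤ) (z : ℂ) : ‖(AddMonoidAlgebra.single k z : TrigPoly d)‖ = ‖z‖ := by
  rw [norm_eq_tsum, tsum_eq_single k]
  · simp
  · intro l hl; simp [hl.symm]

lemma mul_eq_sum {x y : TrigPoly d} {s t : Finset (Fin d → ℤ)} (hs : x.coeff.support ⊆ s)
    (ht : y.coeff.support ⊆ t) :
    x * y = ∑ k ∈ s, ∑ l ∈ t, AddMonoidAlgebra.single (k + l) (x.coeff k * y.coeff l) := by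
  rw [AddMonoidAlgebra.mul_def, Finsupp.sum_of_support_subset _ hs _ (by simp)]
  refine Finset.sum_congr rfl fun k _ => ?_
  rw [Finsupp.sum_of_support_subset _ ht _ (by simp)]

lemma coeff_mul_eq_sum {x : TrigPoly d} {s : Finset (Fin d → ℤ)} (hs : x.coeff.support ⊆ s)
    (y : TrigPoly d) (m : Fin d → ℤ) :
    (x * y).coeff m = ∑ k ∈ s, x.coeff k * y.coeff (m - k) := by
  classical
  rw [AddMonoidAlgebra.coeff_mul, Finsupp.sum_of_support_subset _ hs _ (by simp)]
  refine Finset.sum_congr rfl fun k _ => ?_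
  rw [Finsupp.sum, Finset.sum_eq_single (m - k)]
  · simp
  · intro l _ hl
    rw [if_neg]
    rintro rfl
    exact hl (by abel)
  · intro h
    rw [Finsupp.notMem_support_iff.1 h]; simp

/-- The Fourier multiplier with symbol `m`. -/
def mult (m : (Fin d → ℤ) → ℂ) : TrigPoly d →ₗ[ℂ] TrigPoly d where
  toFun a := .ofCoeff (Finsupp.onFinset a.coeff.support (fun k => m k * a.coeff k) fun k hk => by
    rw [Finsupp.mem_support_iff]; exact right_ne_zero_of_mul hk)
  map_add' a b := by ext k; simp [mul_add]
  map_smul' z a := by ext k; simp [mul_left_comm]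

@[simp] lemma coeff_mult (m : (Fin d → ℤ) → ℂ) (a : TrigPoly d) (k : Fin d → ℤ) :
    (mult m a).coeff k = m k * a.coeff k := rfl

lemma mult_mult (m p : (Fin d → ℤ) → ℂ) (a : TrigPoly d) :
    mult m (mult p a) = mult (fun k => m k * p k) a := by
  ext k; simp [mul_assoc]

lemma mult_single (m : (Fin d → ℤ) → ℂ) (k : Fin d → ℤ) (z : ℂ) :
    mult m (AddMonoidAlgebra.single k z) = AddMonoidAlgebra.single k (m k * z) := by
  ext l
  by_cases h : k = l
  · subst h; simp
  · simp [h]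

lemma support_mult_subset (m : (Fin d → ℤ) → ℂ) (a : TrigPoly d) :
    (mult m a).coeff.support ⊆ a.coeff.support := by
  intro k hk
  rw [Finsupp.mem_support_iff] at hk ⊢
  exact right_ne_zero_of_mul hk

/-- The Fourier multiplier with a real symbol. -/
abbrev wmul (w : (Fin d → ℤ) → ℝ) : TrigPoly d →ₗ[ℂ] TrigPoly d := mult fun k => (w k : ℂ)

lemma norm_coeff_wmul {w : (Fin d → ℤ) → ℝ} (hw : ∀ k, 0 ≤ w k) (a : TrigPoly d)
    (k : Fin d → ℤ) : ‖(wmul w a).coeff k‖ = w k * ‖a.coeff k‖ := by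
  simp [abs_of_nonneg (hw k)]

lemma norm_wmul_mul_le_sum {w : (Fin d → ℤ) → ℝ} (hw : ∀ k, 0 ≤ w k) (a b : TrigPoly d) :
    ‖wmul w (a * b)‖ ≤ ∑ k ∈ a.coeff.support, ∑ l ∈ b.coeff.support,
      w (k + l) * (‖a.coeff k‖ * ‖b.coeff l‖) := by
  rw [mul_eq_sum subset_rfl subset_rfl, map_sum]
  refine (norm_trigPoly_sum_le _ _).trans (Finset.sum_le_sum fun k _ => ?_)
  rw [map_sum]
  refine (norm_trigPoly_sum_le _ _).trans (Finset.sum_le_sum fun l _ => ?_)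
  rw [mult_single, norm_single, norm_mul, norm_mul, Complex.norm_real,
    Real.norm_of_nonneg (hw _)]

lemma norm_trigPoly_mul_le (a b : TrigPoly d) : ‖a * b‖ ≤ ‖a‖ * ‖b‖ := by
  have h := norm_wmul_mul_le_sum (w := fun _ => 1) (fun _ => zero_le_one) a b
  have e : wmul (fun _ => 1) (a * b) = a * b := by ext k; simp
  rw [e] at h
  simp only [one_mul] at h
  rwa [← Finset.sum_mul_sum, ← norm_eq_sum subset_rfl, ← norm_eq_sum subset_rfl] at h

lemma norm_trigPoly_neg (a : TrigPoly d) : ‖-a‖ = ‖a‖ := by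
  simp [norm_eq_tsum]

instance : NormedAddCommGroup (TrigPoly d) :=
  AddGroupNorm.toNormedAddCommGroup
    { toFun := fun a => ‖a‖
      map_zero' := by simp [norm_eq_tsum]
      add_le' := norm_trigPoly_add_le
      neg' := norm_trigPoly_neg
      eq_zero_of_map_eq_zero' := fun a ha => by
        ext k
        have := norm_coeff_le a k
        rw [ha] at this
        simpa using this }

instance : NormedCommRing (TrigPoly d) :=
  { (inferInstance : NormedAddCommGroup (TrigPoly d)),
    (inferInstance : CommRing (TrigPoly d)) with
    norm_mul_le := norm_trigPoly_mul_le }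

instance : NormedAlgebra ℂ (TrigPoly d) where
  norm_smul_le z a := by
    rw [norm_eq_tsum, norm_eq_tsum, ← tsum_mul_left]
    simp

instance : NormedAlgebra ℝ (TrigPoly d) where
  norm_smul_le z a := by
    rw [norm_eq_tsum, norm_eq_tsum, ← tsum_mul_left]
    simp

/-- The real structure, by restriction of the coefficients; it takes precedence over the restriction
of scalars from `ℂ`, which is only propositionally equal to it. -/
instance : NormedSpace ℝ (TrigPoly d) := NormedAlgebra.toNormedSpace (TrigPoly d)

lemma norm_wmul_mul_le {w : (Fin d → ℤ) → ℝ} (hw : ∀ k, 0 ≤ w k)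
    (hadd : ∀ k l, w (k + l) ≤ w k + w l) (a b : TrigPoly d) :
    ‖wmul w (a * b)‖ ≤ ‖wmul w a‖ * ‖b‖ + ‖a‖ * ‖wmul w b‖ := by
  refine (norm_wmul_mul_le_sum hw a b).trans ?_
  rw [norm_eq_sum (support_mult_subset _ a), norm_eq_sum (support_mult_subset _ b),
    norm_eq_sum (a := a) subset_rfl, norm_eq_sum (a := b) subset_rfl, Finset.sum_mul_sum,
    Finset.sum_mul_sum, ← Finset.sum_add_distrib]
  refine Finset.sum_le_sum fun k _ => ?_
  rw [← Finset.sum_add_distrib]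
  refine Finset.sum_le_sum fun l _ => ?_
  rw [norm_coeff_wmul hw, norm_coeff_wmul hw]
  have := mul_le_mul_of_nonneg_right (hadd k l) (by positivity : 0 ≤ ‖a.coeff k‖ * ‖b.coeff l‖)
  linarith

/-! ### The `ℓ²` norm of the coefficients -/

/-- The `L²` norm of a trigonometric polynomial, as the `ℓ²` norm of its coefficients. -/
def n2 (a : TrigPoly d) : ℝ := Real.sqrt (∑' k, ‖a.coeff k‖ ^ 2)

lemma n2_nonneg (a : TrigPoly d) : 0 ≤ n2 a := Real.sqrt_nonneg _

lemma n2_sq (a : TrigPoly d) : n2 a ^ 2 = ∑' k, ‖a.coeff k‖ ^ 2 :=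
  Real.sq_sqrt (tsum_nonneg fun _ => by positivity)

lemma sum_norm_coeff_sq_le (a : TrigPoly d) (s : Finset (Fin d → ℤ)) :
    ∑ k ∈ s, ‖a.coeff k‖ ^ 2 ≤ n2 a ^ 2 := by
  rw [n2_sq]
  exact (summable_norm_coeff_sq a).sum_le_tsum s fun _ _ => by positivity

lemma n2_sq_eq_sum {a : TrigPoly d} {s : Finset (Fin d → ℤ)} (hs : a.coeff.support ⊆ s) :
    n2 a ^ 2 = ∑ k ∈ s, ‖a.coeff k‖ ^ 2 := by
  rw [n2_sq]
  exact tsum_eq_sum fun k hk => by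
    rw [Finsupp.notMem_support_iff.1 fun h => hk (hs h)]; simp

lemma n2_le_of_coeff {a b : TrigPoly d} (h : ∀ k, ‖a.coeff k‖ ≤ ‖b.coeff k‖) : n2 a ≤ n2 b :=
  Real.sqrt_le_sqrt ((summable_norm_coeff_sq a).tsum_le_tsum
    (fun k => pow_le_pow_left₀ (norm_nonneg _) (h k) 2) (summable_norm_coeff_sq b))

lemma n2_smul (z : ℂ) (a : TrigPoly d) : n2 (z • a) = ‖z‖ * n2 a := by
  rw [n2, n2, ← Real.sqrt_sq (norm_nonneg z), ← Real.sqrt_mul (by positivity), ← tsum_mul_left]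
  simp [mul_pow]

lemma n2_le_mul_of_coeff {a b : TrigPoly d} {C : ℝ} (hC : 0 ≤ C)
    (h : ∀ k, ‖a.coeff k‖ ≤ C * ‖b.coeff k‖) : n2 a ≤ C * n2 b := by
  have : n2 a ≤ n2 ((C : ℂ) • b) := n2_le_of_coeff fun k => by
    simpa [abs_of_nonneg hC] using h k
  rwa [n2_smul, Complex.norm_real, Real.norm_of_nonneg hC] at this

lemma sum_norm_mul_le (u w : TrigPoly d) (s : Finset (Fin d → ℤ)) {e : (Fin d → ℤ) → (Fin d → ℤ)}
    (he : Function.Injective e) :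
    ∑ k ∈ s, ‖u.coeff k‖ * ‖w.coeff (e k)‖ ≤ n2 u * n2 w := by
  classical
  refine abs_le_of_sq_le_sq' ?_ (mul_nonneg (n2_nonneg u) (n2_nonneg w)) |>.2
  refine (Finset.sum_mul_sq_le_sq_mul_sq s _ _).trans ?_
  rw [mul_pow]
  refine mul_le_mul (sum_norm_coeff_sq_le u s) ?_ (Finset.sum_nonneg fun _ _ => by positivity)
    (by positivity)
  have := sum_norm_coeff_sq_le w (s.image e)
  rwa [Finset.sum_image fun _ _ _ _ h => he h] at this

lemma n2_add_le (a b : TrigPoly d) : n2 (a + b) ≤ n2 a + n2 b := by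
  classical
  refine abs_le_of_sq_le_sq' ?_ (add_nonneg (n2_nonneg a) (n2_nonneg b)) |>.2
  set s := a.coeff.support ∪ b.coeff.support
  have hs : (a + b).coeff.support ⊆ s := Finsupp.support_add
  rw [n2_sq_eq_sum hs, add_sq, n2_sq_eq_sum (a := a) (s := s) Finset.subset_union_left,
    n2_sq_eq_sum (a := b) (s := s) Finset.subset_union_right]
  have h := sum_norm_mul_le a b s Function.injective_id
  calc ∑ k ∈ s, ‖(a + b).coeff k‖ ^ 2
      ≤ ∑ k ∈ s, (‖a.coeff k‖ ^ 2 + 2 * (‖a.coeff k‖ * ‖b.coeff k‖) + ‖b.coeff k‖ ^ 2) := by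
        refine Finset.sum_le_sum fun k _ => ?_
        have : ‖(a + b).coeff k‖ ≤ ‖a.coeff k‖ + ‖b.coeff k‖ := norm_add_le _ _
        nlinarith [norm_nonneg ((a + b).coeff k)]
    _ = ∑ k ∈ s, ‖a.coeff k‖ ^ 2 + 2 * ∑ k ∈ s, ‖a.coeff k‖ * ‖b.coeff k‖ +
        ∑ k ∈ s, ‖b.coeff k‖ ^ 2 := by
        rw [Finset.sum_add_distrib, Finset.sum_add_distrib, Finset.mul_sum]
    _ ≤ _ := by simp only [id] at h; linarith

lemma n2_zero : n2 (0 : TrigPoly d) = 0 := by simp [n2]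

lemma n2_sum_le {ι : Type*} (s : Finset ι) (f : ι → TrigPoly d) :
    n2 (∑ i ∈ s, f i) ≤ ∑ i ∈ s, n2 (f i) :=
  Finset.le_sum_of_subadditive _ n2_zero.le n2_add_le s f

lemma coeff_single_mul (k : Fin d → ℤ) (z : ℂ) (b : TrigPoly d) (m : Fin d → ℤ) :
    (AddMonoidAlgebra.single k z * b : TrigPoly d).coeff m = z * b.coeff (m - k) := by
  rw [coeff_mul_eq_sum (s := {k}) (by simpa using Finsupp.support_single_subset)]
  simp

lemma n2_single_mul (k : Fin d → ℤ) (z : ℂ) (b : TrigPoly d) :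
    n2 (AddMonoidAlgebra.single k z * b) = ‖z‖ * n2 b := by
  rw [n2, n2]
  simp_rw [coeff_single_mul, norm_mul, mul_pow]
  rw [tsum_mul_left, Real.sqrt_mul (by positivity), Real.sqrt_sq (norm_nonneg z)]
  congr 2
  exact (Equiv.subRight k).tsum_eq fun m => ‖b.coeff m‖ ^ 2

/-- Young's inequality `ℓ¹ * ℓ² ⊆ ℓ²`. -/
lemma n2_mul_le (a b : TrigPoly d) : n2 (a * b) ≤ ‖a‖ * n2 b := by
  have e : a * b = ∑ k ∈ a.coeff.support, AddMonoidAlgebra.single k (a.coeff k) * b := by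
    rw [← Finset.sum_mul]
    congr 1
    exact (AddMonoidAlgebra.sum_coeff_single a).symm
  rw [e]
  refine (n2_sum_le _ _).trans ?_
  simp_rw [n2_single_mul]
  rw [← Finset.sum_mul, norm_eq_sum subset_rfl]

/-- The trigonometric polynomial whose coefficients are the moduli of those of `a`. -/
def modulus (a : TrigPoly d) : TrigPoly d :=
  .ofCoeff (a.coeff.mapRange (fun z => (‖z‖ : ℂ)) (by simp))

@[simp] lemma coeff_modulus (a : TrigPoly d) (k : Fin d → ℤ) :
    (modulus a).coeff k = (‖a.coeff k‖ : ℂ) := rfl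

lemma norm_modulus (a : TrigPoly d) : ‖modulus a‖ = ‖a‖ := by simp [norm_eq_tsum]

lemma n2_modulus (a : TrigPoly d) : n2 (modulus a) = n2 a := by simp [n2]

lemma support_modulus_subset (a : TrigPoly d) : (modulus a).coeff.support ⊆ a.coeff.support :=
  fun k hk => by
    rw [Finsupp.mem_support_iff] at hk ⊢
    intro h
    exact hk (by change ((‖a.coeff k‖ : ℝ) : ℂ) = 0; simp [h])

/-- Tame product estimate in `ℓ²` for almost subadditive weights. -/
lemma n2_wmul_mul_le {w : (Fin d → ℤ) → ℝ} (hw : ∀ k, 0 ≤ w k) {C : ℝ} (hC : 0 ≤ C)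
    (hadd : ∀ k l, w (k + l) ≤ C * (w k + w l)) (a b : TrigPoly d) :
    n2 (wmul w (a * b)) ≤ C * (n2 (wmul w a) * ‖b‖ + ‖a‖ * n2 (wmul w b)) := by
  set g := modulus b * modulus (wmul w a) + modulus a * modulus (wmul w b)
  have hg : n2 g ≤ n2 (wmul w a) * ‖b‖ + ‖a‖ * n2 (wmul w b) := by
    refine (n2_add_le _ _).trans ?_
    have h1 := n2_mul_le (modulus b) (modulus (wmul w a))
    have h2 := n2_mul_le (modulus a) (modulus (wmul w b))
    rw [norm_modulus, n2_modulus] at h1 h2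
    linarith
  refine (n2_le_mul_of_coeff hC fun m => ?_).trans (mul_le_mul_of_nonneg_left hg hC)
  have e : g.coeff m = ((∑ k ∈ a.coeff.support,
      (w k + w (m - k)) * (‖a.coeff k‖ * ‖b.coeff (m - k)‖) : ℝ) : ℂ) := by
    have hg' : g = modulus (wmul w a) * modulus b + modulus a * modulus (wmul w b) := by
      rw [mul_comm (modulus (wmul w a))]
    rw [hg']
    have h1 : (modulus (wmul w a)).coeff.support ⊆ a.coeff.support :=
      (support_modulus_subset _).trans (support_mult_subset _ a)
    change (modulus (wmul w a) * modulus b).coeff m + (modulus a * modulus (wmul w b)).coeff m = _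
    rw [coeff_mul_eq_sum h1, coeff_mul_eq_sum (support_modulus_subset a), ← Finset.sum_add_distrib]
    push_cast
    refine Finset.sum_congr rfl fun k _ => ?_
    simp only [coeff_modulus]
    rw [norm_coeff_wmul hw, norm_coeff_wmul hw]
    push_cast; ring
  have hnn : 0 ≤ ∑ k ∈ a.coeff.support,
      (w k + w (m - k)) * (‖a.coeff k‖ * ‖b.coeff (m - k)‖) :=
    Finset.sum_nonneg fun k _ => mul_nonneg (add_nonneg (hw _) (hw _)) (by positivity)
  rw [e, Complex.norm_real, Real.norm_of_nonneg hnn, norm_coeff_wmul hw,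
    coeff_mul_eq_sum subset_rfl, Finset.mul_sum]
  refine (mul_le_mul_of_nonneg_left (norm_sum_le _ _) (hw m)).trans ?_
  rw [Finset.mul_sum]
  refine Finset.sum_le_sum fun k _ => ?_
  rw [norm_mul]
  have := mul_le_mul_of_nonneg_right (hadd k (m - k))
    (by positivity : 0 ≤ ‖a.coeff k‖ * ‖b.coeff (m - k)‖)
  rw [add_sub_cancel] at this
  linarith

end SpectralScheme
end

noncomputable section

namespace SpectralScheme

open Finset

variable {d n : ℕ}

/-! ### Quadrilinear forms -/

/-- The mean value of a trigonometric polynomial, its coefficient at frequency `0`. -/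
def mean : TrigPoly d →ₗ[ℂ] ℂ where
  toFun a := a.coeff 0
  map_add' _ _ := rfl
  map_smul' _ _ := rfl

lemma mean_apply (a : TrigPoly d) : mean a = a.coeff 0 := rfl

lemma mean_mul {x : TrigPoly d} {s : Finset (Fin d → ℤ)} (hs : x.coeff.support ⊆ s)
    (y : TrigPoly d) : mean (x * y) = ∑ k ∈ s, x.coeff k * y.coeff (-k) := by
  rw [mean_apply, coeff_mul_eq_sum hs]; simp

lemma norm_mean_mul_le (x y : TrigPoly d) : ‖mean (x * y)‖ ≤ n2 x * n2 y := by
  rw [mean_mul subset_rfl]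
  refine (norm_sum_le _ _).trans ?_
  simp_rw [norm_mul]
  exact sum_norm_mul_le x y _ neg_injective

lemma norm_mean_mul_mul_le (g x y : TrigPoly d) : ‖mean (g * x * y)‖ ≤ ‖g‖ * n2 x * n2 y :=
  (norm_mean_mul_le _ _).trans (mul_le_mul_of_nonneg_right (n2_mul_le g x) (n2_nonneg y))

/-- The quadrilinear form with symbol `μ`: the sum of `μ(k₁, k₂, k₃) g_{k₁} a_{k₂} u_{k₃} w_{k₄}`
over all frequencies with `k₁ + k₂ + k₃ + k₄ = 0`. -/
def quad (μ : (Fin d → ℤ) → (Fin d → ℤ) → (Fin d → ℤ) → ℂ) (g a u w : TrigPoly d) : ℂ :=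
  ∑ k₁ ∈ g.coeff.support, ∑ k₂ ∈ a.coeff.support, ∑ k₃ ∈ u.coeff.support,
    μ k₁ k₂ k₃ * (g.coeff k₁ * a.coeff k₂ * u.coeff k₃ * w.coeff (-(k₁ + k₂ + k₃)))

lemma mean_mul_mult_eq_quad (m p q : (Fin d → ℤ) → ℂ) (g a u w : TrigPoly d) :
    mean (g * mult m (a * mult p u) * mult q w) =
      quad (fun k₁ k₂ k₃ => m (k₂ + k₃) * p k₃ * q (-(k₁ + k₂ + k₃))) g a u w := by
  rw [mul_assoc, mean_mul subset_rfl, quad]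
  refine Finset.sum_congr rfl fun k₁ _ => ?_
  rw [mul_eq_sum (x := a) subset_rfl (support_mult_subset p u)]
  simp only [map_sum, mult_single, Finset.sum_mul, AddMonoidAlgebra.coeff_sum,
    Finsupp.finsetSum_apply, Finset.mul_sum]
  refine Finset.sum_congr rfl fun k₂ _ => Finset.sum_congr rfl fun k₃ _ => ?_
  rw [coeff_single_mul]
  have e : -k₁ - (k₂ + k₃) = -(k₁ + k₂ + k₃) := by abel
  simp only [e, coeff_mult]
  ring

lemma quad_sub (μ ν : (Fin d → ℤ) → (Fin d → ℤ) → (Fin d → ℤ) → ℂ) (g a u w : TrigPoly d) :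
    quad μ g a u w - quad ν g a u w = quad (fun k₁ k₂ k₃ => μ k₁ k₂ k₃ - ν k₁ k₂ k₃) g a u w := by
  simp only [quad, ← Finset.sum_sub_distrib, sub_mul]

/-- The absolute quadrilinear sum is controlled by putting two factors in `ℓ¹` and two in `ℓ²`. -/
lemma sum_quad_le (g a u w : TrigPoly d) (s₁ s₂ s₃ : Finset (Fin d → ℤ)) :
    ∑ k₁ ∈ s₁, ∑ k₂ ∈ s₂, ∑ k₃ ∈ s₃,
      ‖g.coeff k₁‖ * ‖a.coeff k₂‖ * (‖u.coeff k₃‖ * ‖w.coeff (-(k₁ + k₂ + k₃))‖) ≤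
      ‖g‖ * ‖a‖ * (n2 u * n2 w) := by
  have hn : 0 ≤ n2 u * n2 w := mul_nonneg (n2_nonneg u) (n2_nonneg w)
  calc _ ≤ ∑ k₁ ∈ s₁, ∑ k₂ ∈ s₂, ‖g.coeff k₁‖ * ‖a.coeff k₂‖ * (n2 u * n2 w) := by
        refine Finset.sum_le_sum fun k₁ _ => Finset.sum_le_sum fun k₂ _ => ?_
        rw [← Finset.mul_sum]
        refine mul_le_mul_of_nonneg_left ?_ (by positivity)
        exact sum_norm_mul_le u w s₃ fun k l h => by simpa using h
    _ = (∑ k₁ ∈ s₁, ‖g.coeff k₁‖) * (∑ k₂ ∈ s₂, ‖a.coeff k₂‖) * (n2 u * n2 w) := by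
        rw [Finset.sum_mul_sum, Finset.sum_mul]
        simp_rw [Finset.sum_mul]
    _ ≤ _ := by
        gcongr
        · exact sum_norm_coeff_le g s₁
        · exact sum_norm_coeff_le a s₂

/-- A quadrilinear form whose symbol carries one derivative, on any of the first two factors, and
`r` derivatives on the second or third factor. -/
lemma norm_quad_le {r C : ℝ} (hC : 0 ≤ C)
    {μ : (Fin d → ℤ) → (Fin d → ℤ) → (Fin d → ℤ) → ℂ}
    (hμ : ∀ k₁ k₂ k₃, ‖μ k₁ k₂ k₃‖ ≤ C * (nrm k₁ * jap k₃ ^ r + nrm k₂ * jap k₃ ^ r +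
      hweight r k₂ * jap k₃)) (g a u w : TrigPoly d) :
    ‖quad μ g a u w‖ ≤ C * (‖wmul nrm g‖ * ‖a‖ * n2 (wmul (fun k => jap k ^ r) u) +
      ‖g‖ * ‖wmul nrm a‖ * n2 (wmul (fun k => jap k ^ r) u) +
      ‖g‖ * n2 (wmul (hweight r) a) * ‖wmul jap u‖) * n2 w := by
  have hJ : ∀ k : Fin d → ℤ, 0 ≤ jap k ^ r := fun k => Real.rpow_nonneg (jap_pos k).le r
  have hJ1 : ∀ k : Fin d → ℤ, 0 ≤ jap k := fun k => (jap_pos k).le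
  set s₁ := g.coeff.support
  set s₂ := a.coeff.support
  set s₃ := u.coeff.support
  have h1 := sum_quad_le (wmul nrm g) a (wmul (fun k => jap k ^ r) u) w s₁ s₂ s₃
  have h2 := sum_quad_le g (wmul nrm a) (wmul (fun k => jap k ^ r) u) w s₁ s₂ s₃
  have h3 := sum_quad_le g (wmul jap u) (wmul (hweight r) a) w s₁ s₃ s₂
  rw [quad]
  calc _ ≤ ∑ k₁ ∈ s₁, ∑ k₂ ∈ s₂, ∑ k₃ ∈ s₃, C * (
        ‖(wmul nrm g).coeff k₁‖ * ‖a.coeff k₂‖ *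
          (‖(wmul (fun k => jap k ^ r) u).coeff k₃‖ * ‖w.coeff (-(k₁ + k₂ + k₃))‖) +
        ‖g.coeff k₁‖ * ‖(wmul nrm a).coeff k₂‖ *
          (‖(wmul (fun k => jap k ^ r) u).coeff k₃‖ * ‖w.coeff (-(k₁ + k₂ + k₃))‖) +
        ‖g.coeff k₁‖ * ‖(wmul jap u).coeff k₃‖ *
          (‖(wmul (hweight r) a).coeff k₂‖ * ‖w.coeff (-(k₁ + k₃ + k₂))‖)) := by
        refine (norm_sum_le _ _).trans (Finset.sum_le_sum fun k₁ _ => ?_)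
        refine (norm_sum_le _ _).trans (Finset.sum_le_sum fun k₂ _ => ?_)
        refine (norm_sum_le _ _).trans (Finset.sum_le_sum fun k₃ _ => ?_)
        rw [norm_coeff_wmul nrm_nonneg, norm_coeff_wmul nrm_nonneg, norm_coeff_wmul hJ,
          norm_coeff_wmul hJ1, norm_coeff_wmul (hweight_nonneg r), add_right_comm k₁ k₃ k₂]
        rw [norm_mul, norm_mul, norm_mul, norm_mul]
        refine (mul_le_mul_of_nonneg_right (hμ k₁ k₂ k₃) (by positivity)).trans (le_of_eq ?_)
        ring
    _ = C * ((∑ k₁ ∈ s₁, ∑ k₂ ∈ s₂, ∑ k₃ ∈ s₃, ‖(wmul nrm g).coeff k₁‖ * ‖a.coeff k₂‖ *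
          (‖(wmul (fun k => jap k ^ r) u).coeff k₃‖ * ‖w.coeff (-(k₁ + k₂ + k₃))‖)) +
        (∑ k₁ ∈ s₁, ∑ k₂ ∈ s₂, ∑ k₃ ∈ s₃, ‖g.coeff k₁‖ * ‖(wmul nrm a).coeff k₂‖ *
          (‖(wmul (fun k => jap k ^ r) u).coeff k₃‖ * ‖w.coeff (-(k₁ + k₂ + k₃))‖)) +
        (∑ k₁ ∈ s₁, ∑ k₃ ∈ s₃, ∑ k₂ ∈ s₂, ‖g.coeff k₁‖ * ‖(wmul jap u).coeff k₃‖ *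
          (‖(wmul (hweight r) a).coeff k₂‖ * ‖w.coeff (-(k₁ + k₃ + k₂))‖))) := by
        have hswap : ∀ f : (Fin d → ℤ) → (Fin d → ℤ) → (Fin d → ℤ) → ℝ,
            ∑ k₁ ∈ s₁, ∑ k₃ ∈ s₃, ∑ k₂ ∈ s₂, f k₁ k₂ k₃ =
              ∑ k₁ ∈ s₁, ∑ k₂ ∈ s₂, ∑ k₃ ∈ s₃, f k₁ k₂ k₃ := fun f =>
          Finset.sum_congr rfl fun k₁ _ => Finset.sum_comm
        rw [hswap]
        simp only [Finset.sum_add_distrib, mul_add, Finset.mul_sum]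
    _ ≤ _ := by
        rw [mul_assoc]
        refine mul_le_mul_of_nonneg_left ?_ hC
        linarith

/-! ### Moser estimates for polynomial nonlinearities -/

/-- The value `P(U)` of a real polynomial at a vector of trigonometric polynomials. -/
abbrev comp (P : MvPolynomial (Fin n) ℝ) (U : Fin n → TrigPoly d) : TrigPoly d :=
  MvPolynomial.aeval U P

lemma exists_norm_comp_le (P : MvPolynomial (Fin n) ℝ) (M : ℝ) :
    ∃ C, 0 ≤ C ∧ ∀ (d : ℕ) (U : Fin n → TrigPoly d), (∀ i, ‖U i‖ ≤ M) → ‖comp P U‖ ≤ C := by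
  induction P using MvPolynomial.induction_on with
  | C r =>
    refine ⟨|r|, abs_nonneg r, fun d U _ => ?_⟩
    have e : comp (MvPolynomial.C r) U = AddMonoidAlgebra.single 0 (r : ℂ) := by
      simp [comp]
    rw [e, norm_single]; simp
  | add P Q hP hQ =>
    obtain ⟨C, hC, h⟩ := hP
    obtain ⟨D, hD, h'⟩ := hQ
    refine ⟨C + D, by positivity, fun d U hU => ?_⟩
    simp only [comp, map_add]
    exact (norm_add_le _ _).trans (add_le_add (h d U hU) (h' d U hU))
  | mul_X P i hP =>
    obtain ⟨C, hC, h⟩ := hP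
    refine ⟨C * |M|, by positivity, fun d U hU => ?_⟩
    simp only [comp, map_mul, MvPolynomial.aeval_X]
    exact (norm_mul_le _ _).trans (mul_le_mul (h d U hU) ((hU i).trans (le_abs_self M))
      (norm_nonneg _) hC)

/-- Any functional that is subadditive, kills constants and satisfies a Leibniz-type inequality
obeys a Moser estimate. -/
lemma exists_moser_le (P : MvPolynomial (Fin n) ℝ) (M : ℝ) {D : ℝ} (hD : 0 ≤ D) :
    ∃ C, 0 ≤ C ∧ ∀ (d : ℕ) (p : TrigPoly d → ℝ), (∀ a, 0 ≤ p a) →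
      (∀ a b, p (a + b) ≤ p a + p b) → (∀ z, p (AddMonoidAlgebra.single 0 z) = 0) →
      (∀ a b, p (a * b) ≤ D * (p a * ‖b‖ + ‖a‖ * p b)) →
      ∀ U : Fin n → TrigPoly d, (∀ i, ‖U i‖ ≤ M) → p (comp P U) ≤ C * ∑ i, p (U i) := by
  induction P using MvPolynomial.induction_on with
  | C r =>
    refine ⟨0, le_rfl, fun d p _ _ h0 _ U _ => ?_⟩
    have e : comp (MvPolynomial.C r) U = AddMonoidAlgebra.single 0 (r : ℂ) := by
      simp [comp]
    rw [e, h0]; simp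
  | add P Q hP hQ =>
    obtain ⟨C, hC, h⟩ := hP
    obtain ⟨C', hC', h'⟩ := hQ
    refine ⟨C + C', by positivity, fun d p hp hadd h0 hmul U hU => ?_⟩
    simp only [comp, map_add]
    have := h d p hp hadd h0 hmul U hU
    have := h' d p hp hadd h0 hmul U hU
    refine (hadd _ _).trans ?_
    rw [add_mul]
    simp only [comp] at *
    linarith
  | mul_X P i hP =>
    obtain ⟨C, hC, h⟩ := hP
    obtain ⟨B, hB, hb⟩ := exists_norm_comp_le P M
    refine ⟨D * (C * |M| + B), by positivity, fun d p hp hadd h0 hmul U hU => ?_⟩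
    simp only [comp, map_mul, MvPolynomial.aeval_X]
    have h1 := h d p hp hadd h0 hmul U hU
    have h2 := hb d U hU
    have h3 := (hU i).trans (le_abs_self M)
    have h4 : p (U i) ≤ ∑ i, p (U i) :=
      Finset.single_le_sum (f := fun i => p (U i)) (fun i _ => hp _) (Finset.mem_univ i)
    have hs : 0 ≤ ∑ i, p (U i) := Finset.sum_nonneg fun i _ => hp _
    calc p (comp P U * U i) ≤ D * (p (comp P U) * ‖U i‖ + ‖comp P U‖ * p (U i)) := hmul _ _
      _ ≤ D * ((C * ∑ i, p (U i)) * |M| + B * ∑ i, p (U i)) := by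
          have := hp (U i)
          gcongr
      _ = _ := by ring

end SpectralScheme
end

noncomputable section

namespace SpectralScheme

open Finset

variable {d n : ℕ}

/-! ### The symmetrized energy flux -/

/-- The partial derivative `∂_j` on trigonometric polynomials. -/
def dX (j : Fin d) : TrigPoly d →ₗ[ℂ] TrigPoly d := mult fun k => Complex.I * (k j : ℂ)

lemma dX_mul (j : Fin d) (a b : TrigPoly d) : dX j (a * b) = dX j a * b + a * dX j b := by
  rw [mul_eq_sum (x := a) (y := b) subset_rfl subset_rfl,
    mul_eq_sum (x := dX j a) (y := b) (support_mult_subset _ a) subset_rfl,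
    mul_eq_sum (x := a) (y := dX j b) subset_rfl (support_mult_subset _ b), map_sum, ← Finset.sum_add_distrib]
  refine Finset.sum_congr rfl fun k _ => ?_
  rw [map_sum, ← Finset.sum_add_distrib]
  refine Finset.sum_congr rfl fun l _ => ?_
  rw [dX, mult_single, ← AddMonoidAlgebra.single_add]
  simp only [coeff_mult, Pi.add_apply, Int.cast_add]
  congr 1
  ring

lemma mean_dX (j : Fin d) (a : TrigPoly d) : mean (dX j a) = 0 := by
  simp [mean_apply, dX]

lemma norm_dX_le (j : Fin d) (a : TrigPoly d) : ‖dX j a‖ ≤ ‖wmul nrm a‖ :=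
  norm_le_norm_of_coeff fun k => by
    rw [norm_coeff_wmul nrm_nonneg, dX, coeff_mult, norm_mul, norm_mul, Complex.norm_I, one_mul]
    gcongr
    simpa using abs_apply_le_nrm k j

lemma norm_wmul_nrm_le (a : TrigPoly d) : ‖wmul nrm a‖ ≤ ‖wmul jap a‖ :=
  norm_le_norm_of_coeff fun k => by
    rw [norm_coeff_wmul nrm_nonneg, norm_coeff_wmul fun k => (jap_pos k).le]
    gcongr
    exact nrm_le_jap k

lemma norm_le_norm_wmul_jap (a : TrigPoly d) : ‖a‖ ≤ ‖wmul jap a‖ :=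
  norm_le_norm_of_coeff fun k => by
    rw [norm_coeff_wmul fun k => (jap_pos k).le]
    exact le_mul_of_one_le_left (norm_nonneg _) (one_le_jap k)

/-- `L^c` for the square root `L` of the smooth filter. -/
abbrev filt (σ : EuclideanSpace ℝ (Fin d) → ℝ) (N c : ℕ) : TrigPoly d →ₗ[ℂ] TrigPoly d :=
  wmul fun k => lam σ N k ^ c

/-- `L^c Λ^r`, with `L` the square root of the smooth filter and `Λ^r` the Fourier multiplier with
symbol `⟨k⟩^r`. -/
abbrev sob (σ : EuclideanSpace ℝ (Fin d) → ℝ) (N : ℕ) (r : ℝ) (c : ℕ) :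
    TrigPoly d →ₗ[ℂ] TrigPoly d :=
  wmul fun k => lam σ N k ^ c * jap k ^ r

variable {σ : EuclideanSpace ℝ (Fin d) → ℝ}

lemma n2_sob_le (hσ : IsLowPassProfile σ) (N : ℕ) (r : ℝ) (c : ℕ) (a : TrigPoly d) :
    n2 (sob σ N r c a) ≤ n2 (wmul (fun k => jap k ^ r) a) :=
  n2_le_of_coeff fun k => by
    have hJ : ∀ k : Fin d → ℤ, 0 ≤ jap k ^ r := fun k => Real.rpow_nonneg (jap_pos k).le r
    rw [norm_coeff_wmul hJ, norm_coeff_wmul fun k => mul_nonneg (pow_nonneg (lam_nonneg N k) c)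
      (hJ k)]
    have := pow_le_one₀ (n := c) (lam_nonneg N k) (lam_le_one hσ N k)
    have := hJ k
    have h0 : 0 ≤ ‖a.coeff k‖ := norm_nonneg _
    nlinarith [mul_nonneg this h0]

lemma norm_filt_le (hσ : IsLowPassProfile σ) (N c : ℕ) (a : TrigPoly d) : ‖filt σ N c a‖ ≤ ‖a‖ :=
  norm_le_norm_of_coeff fun k => by
    rw [norm_coeff_wmul fun k => pow_nonneg (lam_nonneg N k) c]
    exact mul_le_of_le_one_left (norm_nonneg _)
      (pow_le_one₀ (lam_nonneg N k) (lam_le_one hσ N k))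

/-- Commuting the multipliers of one term of the energy flux to symmetric position costs no
derivative of `u`: with `c = a + b`, the term `⟨G L^{a+2b} Λ^r (A ∂u), L^a w⟩` differs from
`⟨G A ∂(L^c Λ^r u), L^c w⟩` by a form in which a derivative has moved to `G` or `A`. Since the
number of factors `L` is the same, the difference of the two symbols telescopes. -/
lemma IsLowPassProfile.exists_norm_flux_sub_le (hσ : IsLowPassProfile σ) {r : ℝ} (hr : 1 ≤ r) :
    ∃ C, 0 ≤ C ∧ ∀ N : ℕ, 1 ≤ N → ∀ a b : ℕ, a ≤ 1 → b ≤ 1 → ∀ (j : Fin d) (g A u w : TrigPoly d),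
      ‖mean (g * sob σ N r (a + 2 * b) (A * dX j u) * filt σ N a w) -
        mean (g * A * dX j (sob σ N r (a + b) u) * filt σ N (a + b) w)‖ ≤
      C * (‖wmul nrm g‖ * ‖A‖ * n2 (wmul (fun k => jap k ^ r) u) +
      ‖g‖ * ‖wmul nrm A‖ * n2 (wmul (fun k => jap k ^ r) u) +
      ‖g‖ * n2 (wmul (hweight r) A) * ‖wmul jap u‖) * n2 w := by
  obtain ⟨B, hB, hlam⟩ := hσ.exists_lam_increment_le
  set R := r * 2 ^ (r - 1) with hR
  have hR0 : 0 ≤ R := by have : (0 : ℝ) ≤ r := by linarith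
                         positivity
  refine ⟨R + 4 * B, by positivity, fun N hN a b ha hb j g A u w => ?_⟩
  have e1 : g * A * dX j (sob σ N r (a + b) u) * filt σ N (a + b) w =
      g * mult (fun _ => 1) (A * mult (fun k => Complex.I * (k j : ℂ) *
        ((lam σ N k ^ (a + b) * jap k ^ r : ℝ) : ℂ)) u) * filt σ N (a + b) w := by
    have e2 : ∀ x : TrigPoly d, mult (fun _ => 1) x = x := fun x => by ext k; simp
    rw [e2, dX, mult_mult, mul_assoc g A]
  rw [e1, dX, mean_mul_mult_eq_quad, mean_mul_mult_eq_quad, quad_sub]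
  refine norm_quad_le (by positivity) (fun k₁ k₂ k₃ => ?_) g A u w
  beta_reduce
  set x := lam σ N (k₂ + k₃)
  set z := lam σ N k₃
  set J := jap k₃ ^ r
  set J' := jap (k₂ + k₃) ^ r
  have hy : lam σ N (-(k₁ + k₂ + k₃)) = lam σ N (k₁ + k₂ + k₃) := lam_neg hσ N _
  rw [hy]
  set y := lam σ N (k₁ + k₂ + k₃)
  have hx0 : 0 ≤ x := lam_nonneg _ _
  have hy0 : 0 ≤ y := lam_nonneg _ _
  have hz0 : 0 ≤ z := lam_nonneg _ _
  have hx1 : x ≤ 1 := lam_le_one hσ _ _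
  have hy1 : y ≤ 1 := lam_le_one hσ _ _
  have hz1 : z ≤ 1 := lam_le_one hσ _ _
  have hJ0 : 0 ≤ J := Real.rpow_nonneg (jap_pos _).le _
  have hJ'0 : 0 ≤ J' := Real.rpow_nonneg (jap_pos _).le _
  have hn1 := nrm_nonneg k₁
  have hn2 := nrm_nonneg k₂
  have hn3 := nrm_nonneg k₃
  have hj3 := jap_pos k₃
  have hw2 := hweight_nonneg r k₂
  have hxz : |x - z| * nrm k₃ ≤ B * nrm k₂ := hlam N hN k₂ k₃
  have hzy : |z - y| * nrm k₃ ≤ B * (nrm k₁ + nrm k₂) := by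
    rw [abs_sub_comm]
    exact (hlam N hN (k₁ + k₂) k₃).trans (mul_le_mul_of_nonneg_left (nrm_add_le _ _) hB)
  have hcomm : |J' - J| * nrm k₃ ≤ R * (nrm k₂ * J + hweight r k₂ * jap k₃) :=
    jap_commutator_le hr k₂ k₃
  have e3 : ((x ^ (a + 2 * b) * J' : ℝ) : ℂ) * (Complex.I * (k₃ j : ℂ)) * ((y ^ a : ℝ) : ℂ) -
      1 * (Complex.I * (k₃ j : ℂ) * ((z ^ (a + b) * J : ℝ) : ℂ)) * ((y ^ (a + b) : ℝ) : ℂ) =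
      Complex.I * ((k₃ j : ℝ) : ℂ) *
        ((x ^ (a + 2 * b) * y ^ a * (J' - J) + J * ((x ^ (a + 2 * b) - z ^ (a + 2 * b)) * y ^ a) +
          J * (z ^ (a + b) * y ^ a * (z ^ b - y ^ b)) : ℝ) : ℂ) := by
    push_cast; ring
  rw [e3, norm_mul, norm_mul, Complex.norm_I, one_mul, Complex.norm_real, Complex.norm_real,
    Real.norm_eq_abs, Real.norm_eq_abs]
  have hp : ∀ (m : ℕ) {t : ℝ}, 0 ≤ t → t ≤ 1 → 0 ≤ t ^ m ∧ t ^ m ≤ 1 := fun m t h0 h1 =>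
    ⟨pow_nonneg h0 m, pow_le_one₀ h0 h1⟩
  have t1 : |x ^ (a + 2 * b) * y ^ a * (J' - J)| ≤ |J' - J| := by
    rw [abs_mul, abs_of_nonneg (mul_nonneg (hp _ hx0 hx1).1 (hp _ hy0 hy1).1)]
    exact mul_le_of_le_one_left (abs_nonneg _)
      (mul_le_one₀ (hp _ hx0 hx1).2 (hp _ hy0 hy1).1 (hp _ hy0 hy1).2)
  have t2 : |(x ^ (a + 2 * b) - z ^ (a + 2 * b)) * y ^ a| ≤ 3 * |x - z| := by
    rw [abs_mul, abs_of_nonneg (hp a hy0 hy1).1]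
    refine (mul_le_of_le_one_right (abs_nonneg _) (hp a hy0 hy1).2).trans ?_
    refine (abs_pow_sub_pow_le_mul hx0 hx1 hz0 hz1 _).trans ?_
    refine mul_le_mul_of_nonneg_right ?_ (abs_nonneg _)
    exact_mod_cast (by omega : a + 2 * b ≤ 3)
  have t3 : |z ^ (a + b) * y ^ a * (z ^ b - y ^ b)| ≤ |z - y| := by
    rw [abs_mul, abs_of_nonneg (mul_nonneg (hp _ hz0 hz1).1 (hp _ hy0 hy1).1)]
    refine (mul_le_of_le_one_left (abs_nonneg _)
      (mul_le_one₀ (hp _ hz0 hz1).2 (hp _ hy0 hy1).1 (hp _ hy0 hy1).2)).trans ?_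
    refine (abs_pow_sub_pow_le_mul hz0 hz1 hy0 hy1 _).trans ?_
    refine mul_le_of_le_one_left (abs_nonneg _) ?_
    exact_mod_cast hb
  calc |(k₃ j : ℝ)| * _ ≤ nrm k₃ * (|J' - J| + J * (3 * |x - z|) + J * |z - y|) := by
        refine mul_le_mul (abs_apply_le_nrm k₃ j) ?_ (abs_nonneg _) hn3
        refine (abs_add_three _ _ _).trans ?_
        rw [abs_mul J, abs_mul J, abs_of_nonneg hJ0]
        gcongr
    _ = |J' - J| * nrm k₃ + 3 * J * (|x - z| * nrm k₃) + J * (|z - y| * nrm k₃) := by ring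
    _ ≤ R * (nrm k₂ * J + hweight r k₂ * jap k₃) + 3 * J * (B * nrm k₂) +
        J * (B * (nrm k₁ + nrm k₂)) := by gcongr
    _ ≤ _ := by
        have h1 : 0 ≤ R * (nrm k₁ * J) := by positivity
        have h2 : 0 ≤ B * (nrm k₁ * J) := by positivity
        have h3 : 0 ≤ B * (hweight r k₂ * jap k₃) := by positivity
        linarith

/-- Integration by parts in a symmetric first-order form. -/
lemma sum_mean_symm (j : Fin d) (H : Fin n → Fin n → TrigPoly d) (hH : ∀ i l, H i l = H l i)
    (X : Fin n → TrigPoly d) :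
    ∑ i, ∑ l, mean (H i l * dX j (X l) * X i) =
      -(1 / 2) * ∑ i, ∑ l, mean (dX j (H i l) * X l * X i) := by
  have h1 : ∑ i, ∑ l, mean (H i l * dX j (X i) * X l) =
      ∑ i, ∑ l, mean (H i l * dX j (X l) * X i) := by
    rw [Finset.sum_comm]
    refine Finset.sum_congr rfl fun i _ => Finset.sum_congr rfl fun l _ => ?_
    rw [hH]
  have h2 : ∑ i, ∑ l, (mean (dX j (H i l) * X l * X i) + mean (H i l * dX j (X l) * X i) +
      mean (H i l * dX j (X i) * X l)) = 0 := by
    refine Finset.sum_eq_zero fun i _ => Finset.sum_eq_zero fun l _ => ?_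
    have := mean_dX j (H i l * X l * X i)
    rw [dX_mul, dX_mul, add_mul, map_add, map_add] at this
    rw [← this]
    congr 2
    ring
  simp only [Finset.sum_add_distrib] at h2
  rw [h1] at h2
  linear_combination (1 / 2) * h2

end SpectralScheme
end

noncomputable section

namespace SpectralScheme

open Finset

variable {d n : ℕ} {σ : EuclideanSpace ℝ (Fin d) → ℝ}

/-- The spatial operator `∑_b ∑_j L^{2b} (A_{b,j} ∂_j U)` with `b ∈ {0, 1}`: the part `b = 0` is not
filtered, the part `b = 1` is. Both schemes have this form. -/
def opF (σ : EuclideanSpace ℝ (Fin d) → ℝ) (N : ℕ) (A : Fin 2 → Fin d → Fin n → Fin n → TrigPoly d)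
    (U : Fin n → TrigPoly d) (i : Fin n) : TrigPoly d :=
  ∑ b : Fin 2, ∑ j, ∑ l, filt σ N (2 * b) (A b j i l * dX j (U l))

lemma norm_sum_fin_le {E : Type*} [SeminormedAddCommGroup E] {m : ℕ} {f : Fin m → E} {κ : ℝ}
    (h : ∀ i, ‖f i‖ ≤ κ) : ‖∑ i, f i‖ ≤ m * κ := by
  refine (norm_sum_le_of_le _ fun i _ => h i).trans (by simp)

lemma sob_filt (N : ℕ) (r : ℝ) (a b : ℕ) (x : TrigPoly d) :
    sob σ N r a (filt σ N b x) = sob σ N r (a + b) x := by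
  rw [mult_mult]
  ext k; simp only [coeff_mult]; push_cast; ring

lemma filt_wmul (N : ℕ) (r : ℝ) (a : ℕ) (x : TrigPoly d) :
    filt σ N a (wmul (fun k => jap k ^ r) x) = sob σ N r a x := by
  rw [mult_mult]
  ext k; simp

lemma sum_flux_reorder (f : Fin 2 → Fin 2 → Fin n → Fin n → Fin d → Fin n → ℂ) :
    ∑ a, ∑ m, ∑ i, ∑ b, ∑ j, ∑ l, f a b m i j l =
      ∑ j, (∑ m, ∑ l, ∑ i, f 0 0 m i j l + ∑ m, ∑ l, ∑ i, (f 0 1 m i j l + f 1 0 m i j l) +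
        ∑ m, ∑ l, ∑ i, f 1 1 m i j l) := by
  have h : ∀ g : Fin n → Fin n → Fin d → Fin n → ℂ, ∑ m, ∑ i, ∑ j, ∑ l, g m i j l =
      ∑ j, ∑ m, ∑ l, ∑ i, g m i j l := fun g =>
    calc _ = ∑ m, ∑ j, ∑ i, ∑ l, g m i j l := Finset.sum_congr rfl fun m _ => Finset.sum_comm
      _ = ∑ j, ∑ m, ∑ i, ∑ l, g m i j l := Finset.sum_comm
      _ = _ := Finset.sum_congr rfl fun j _ => Finset.sum_congr rfl fun m _ => Finset.sum_comm
  simp only [Fin.sum_univ_two, Finset.sum_add_distrib]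
  rw [h, h, h, h]
  ring

/-- The bound for one power of the filter in the symmetrized flux. -/
lemma norm_sum_mean_symm_le (j : Fin d) (H : Fin n → Fin n → TrigPoly d)
    (hH : ∀ i l, H i l = H l i) (X : Fin n → TrigPoly d) {D y : ℝ} (hD : 0 ≤ D)
    (hHD : ∀ i l, ‖wmul nrm (H i l)‖ ≤ D) (hX : ∀ i, n2 (X i) ≤ y) :
    ‖∑ i, ∑ l, mean (H i l * dX j (X l) * X i)‖ ≤ n * (n * (D * y * y)) := by
  rw [sum_mean_symm j H hH X, norm_mul]
  have h1 : ‖∑ i, ∑ l, mean (dX j (H i l) * X l * X i)‖ ≤ n * (n * (D * y * y)) := by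
    refine norm_sum_fin_le fun i => norm_sum_fin_le fun l => ?_
    refine (norm_mean_mul_mul_le _ _ _).trans ?_
    have := n2_nonneg (X l)
    have hi := n2_nonneg (X i)
    have hy : 0 ≤ y := hi.trans (hX i)
    gcongr
    · exact (norm_dX_le j _).trans (hHD i l)
    · exact hX l
    · exact hX i
  have h2 : ‖(-(1 / 2) : ℂ)‖ ≤ 1 := by norm_num
  exact (mul_le_of_le_one_left (norm_nonneg _) h2).trans h1

/-- The energy flux of the symmetrized system loses no derivative, uniformly in `N`. -/
lemma IsLowPassProfile.exists_norm_flux_le (hσ : IsLowPassProfile σ) {r : ℝ} (hr : 1 ≤ r) (n : ℕ)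
    {B : ℝ} (hB : 0 ≤ B) :
    ∃ C, 0 ≤ C ∧ ∀ N : ℕ, 1 ≤ N → ∀ (G : Fin 2 → Fin n → Fin n → TrigPoly d)
      (A : Fin 2 → Fin d → Fin n → Fin n → TrigPoly d) (U : Fin n → TrigPoly d) (ε y : ℝ),
      (∀ j m l, ∑ i, G 0 m i * A 0 j i l = ∑ i, G 0 l i * A 0 j i m) →
      (∀ j m l, ∑ i, (G 0 m i * A 1 j i l + G 1 m i * A 0 j i l) =
        ∑ i, (G 0 l i * A 1 j i m + G 1 l i * A 0 j i m)) →
      (∀ j m l, ∑ i, G 1 m i * A 1 j i l = ∑ i, G 1 l i * A 1 j i m) →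
      (∀ a m i, ‖G a m i‖ ≤ B) → (∀ a m i, ‖wmul nrm (G a m i)‖ ≤ B * ε) →
      (∀ b j i l, ‖A b j i l‖ ≤ B) → (∀ b j i l, ‖wmul nrm (A b j i l)‖ ≤ B * ε) →
      (∀ b j i l, n2 (wmul (hweight r) (A b j i l)) ≤ B * y) →
      (∀ l, ‖wmul jap (U l)‖ ≤ ε) → (∀ l, n2 (wmul (fun k => jap k ^ r) (U l)) ≤ y) →
      0 ≤ ε → 0 ≤ y →
      ‖∑ a : Fin 2, ∑ m, ∑ i, mean (G a m i * sob σ N r a (opF σ N A U i) * sob σ N r a (U m))‖ ≤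
        C * ε * y ^ 2 := by
  obtain ⟨C, hC, hflux⟩ := hσ.exists_norm_flux_sub_le hr
  refine ⟨2 * n * n * 2 * d * n * (C * (3 * B ^ 2)) + d * (3 * n * n * (n * (4 * B ^ 2))),
    by positivity, ?_⟩
  intro N hN G A U ε y hS0 hS1 hS2 hG hG' hA hA' hA'' hU hV hε hy
  have hX : ∀ c m, n2 (sob σ N r c (U m)) ≤ y := fun c m => (n2_sob_le hσ N r c _).trans (hV m)
  set T : Fin 2 → Fin 2 → Fin n → Fin n → Fin d → Fin n → ℂ := fun a b m i j l =>
    mean (G a m i * sob σ N r (a + 2 * b) (A b j i l * dX j (U l)) *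
      filt σ N a (wmul (fun k => jap k ^ r) (U m))) with hT
  set T' : Fin 2 → Fin 2 → Fin n → Fin n → Fin d → Fin n → ℂ := fun a b m i j l =>
    mean (G a m i * A b j i l * dX j (sob σ N r (a + b) (U l)) *
      filt σ N (a + b) (wmul (fun k => jap k ^ r) (U m))) with hT'
  have e1 : ∑ a : Fin 2, ∑ m, ∑ i,
      mean (G a m i * sob σ N r a (opF σ N A U i) * sob σ N r a (U m)) =
      ∑ a, ∑ m, ∑ i, ∑ b, ∑ j, ∑ l, T a b m i j l := by
    refine Finset.sum_congr rfl fun a _ => Finset.sum_congr rfl fun m _ =>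
      Finset.sum_congr rfl fun i _ => ?_
    simp only [opF, map_sum, sob_filt, Finset.mul_sum, Finset.sum_mul, hT, filt_wmul]
  have hdiff : ∀ a b m i j l, ‖T a b m i j l - T' a b m i j l‖ ≤ C * (3 * B ^ 2) * (ε * y ^ 2) := by
    intro a b m i j l
    refine (hflux N hN a b (by omega) (by omega) j _ _ _ _).trans ?_
    have h1 := n2_nonneg (wmul (fun k => jap k ^ r) (U l))
    have h2 := n2_nonneg (wmul (fun k => jap k ^ r) (U m))
    have h3 := n2_nonneg (wmul (hweight r) (A b j i l))
    calc _ ≤ C * ((B * ε) * B * y + B * (B * ε) * y + B * (B * y) * ε) * y := by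
          gcongr
          · exact hG' a m i
          · exact hA b j i l
          · exact hV l
          · exact hG a m i
          · exact hA' b j i l
          · exact hV l
          · exact hG a m i
          · exact hA'' b j i l
          · exact hU l
          · exact hV m
      _ = _ := by ring
  have hsum : ‖∑ a, ∑ m, ∑ i, ∑ b, ∑ j, ∑ l, T a b m i j l -
      ∑ a, ∑ m, ∑ i, ∑ b, ∑ j, ∑ l, T' a b m i j l‖ ≤
      2 * n * n * 2 * d * n * (C * (3 * B ^ 2)) * (ε * y ^ 2) := by
    simp only [← Finset.sum_sub_distrib]
    set κ := C * (3 * B ^ 2) * (ε * y ^ 2) with hκ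
    have : 2 * n * n * 2 * d * n * (C * (3 * B ^ 2)) * (ε * y ^ 2) =
        2 * (n * (n * (2 * (d * (n * κ))))) := by rw [hκ]; ring
    rw [this]
    exact norm_sum_fin_le fun a => norm_sum_fin_le fun m => norm_sum_fin_le fun i =>
      norm_sum_fin_le fun b => norm_sum_fin_le fun j => norm_sum_fin_le fun l => hdiff a b m i j l
  have hGA : ∀ a b m i j l, ‖wmul nrm (G a m i * A b j i l)‖ ≤ 2 * B ^ 2 * ε := by
    intro a b m i j l
    refine (norm_wmul_mul_le nrm_nonneg nrm_add_le _ _).trans ?_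
    calc _ ≤ (B * ε) * B + B * (B * ε) := by
          gcongr
          · exact hG' a m i
          · exact hA b j i l
          · exact hG a m i
          · exact hA' b j i l
      _ = _ := by ring
  have hnsum : ∀ h : Fin n → TrigPoly d, (∀ i, ‖wmul nrm (h i)‖ ≤ 4 * B ^ 2 * ε) →
      ‖wmul nrm (∑ i, h i)‖ ≤ n * (4 * B ^ 2 * ε) := by
    intro h hh
    rw [map_sum]
    exact norm_sum_fin_le hh
  have hD : 0 ≤ n * (4 * B ^ 2 * ε) := by positivity
  have hBε : 0 ≤ 2 * B ^ 2 * ε := by positivity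
  have hmain : ‖∑ a, ∑ m, ∑ i, ∑ b, ∑ j, ∑ l, T' a b m i j l‖ ≤
      d * (3 * n * n * (n * (4 * B ^ 2))) * (ε * y ^ 2) := by
    rw [sum_flux_reorder]
    have hj : ∀ j, ‖∑ m, ∑ l, ∑ i, T' 0 0 m i j l + ∑ m, ∑ l, ∑ i, (T' 0 1 m i j l + T' 1 0 m i j l) +
        ∑ m, ∑ l, ∑ i, T' 1 1 m i j l‖ ≤ 3 * (n * (n * (n * (4 * B ^ 2 * ε) * y * y))) := by
      intro j
      have h0 := norm_sum_mean_symm_le j (fun m l => ∑ i, G 0 m i * A 0 j i l) (hS0 j)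
        (fun m => sob σ N r 0 (U m)) hD (fun m l => hnsum _ fun i => by
          have := hGA 0 0 m i j l; linarith) (hX 0)
      have h1 := norm_sum_mean_symm_le j
        (fun m l => ∑ i, (G 0 m i * A 1 j i l + G 1 m i * A 0 j i l)) (hS1 j)
        (fun m => sob σ N r 1 (U m)) hD (fun m l => hnsum _ fun i => by
          rw [map_add]
          refine (norm_add_le _ _).trans ?_
          linarith [hGA 0 1 m i j l, hGA 1 0 m i j l]) (hX 1)
      have h2 := norm_sum_mean_symm_le j (fun m l => ∑ i, G 1 m i * A 1 j i l) (hS2 j)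
        (fun m => sob σ N r 2 (U m)) hD (fun m l => hnsum _ fun i => by
          have := hGA 1 1 m i j l; linarith) (hX 2)
      simp only [Finset.sum_mul, map_sum, add_mul, map_add] at h0 h1 h2
      simp only [hT', filt_wmul]
      refine (norm_add₃_le).trans ?_
      simp only [Fin.val_zero, Fin.val_one, add_zero, zero_add, Nat.reduceAdd]
      linarith
    refine (norm_sum_fin_le hj).trans (le_of_eq ?_)
    ring
  rw [e1]
  calc _ ≤ _ + _ := norm_le_norm_sub_add _ _
    _ ≤ _ := add_le_add hsum hmain
    _ = _ := by ring

end SpectralScheme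
end

noncomputable section

namespace SpectralScheme

open Finset

variable {d n : ℕ} {σ : EuclideanSpace ℝ (Fin d) → ℝ}

/-! ### Sobolev norms of vectors of trigonometric polynomials -/

/-- The `H^r` norm of a vector of trigonometric polynomials. -/
def hsN (r : ℝ) (U : Fin n → TrigPoly d) : ℝ :=
  Real.sqrt (∑ i, n2 (wmul (fun k => jap k ^ r) (U i)) ^ 2)

lemma hsN_nonneg (r : ℝ) (U : Fin n → TrigPoly d) : 0 ≤ hsN r U := Real.sqrt_nonneg _

lemma hsN_sq (r : ℝ) (U : Fin n → TrigPoly d) :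
    hsN r U ^ 2 = ∑ i, n2 (wmul (fun k => jap k ^ r) (U i)) ^ 2 :=
  Real.sq_sqrt (Finset.sum_nonneg fun _ _ => by positivity)

lemma n2_le_hsN (r : ℝ) (U : Fin n → TrigPoly d) (i : Fin n) :
    n2 (wmul (fun k => jap k ^ r) (U i)) ≤ hsN r U := by
  refine Real.le_sqrt_of_sq_le ?_
  exact Finset.single_le_sum (f := fun i => n2 (wmul (fun k => jap k ^ r) (U i)) ^ 2)
    (fun _ _ => by positivity) (Finset.mem_univ i)

/-- The Sobolev embedding of `H^s`, `s > d/2 + 1`, into the functions whose gradient has an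
absolutely convergent Fourier series. -/
lemma exists_norm_wmul_jap_le {s : ℝ} (hs : (d : ℝ) / 2 + 1 < s) :
    ∃ C, 0 ≤ C ∧ ∀ u : TrigPoly d, ‖wmul jap u‖ ≤ C * n2 (wmul (fun k => jap k ^ s) u) := by
  have hsum := summable_jap_rpow (d := d) (p := 2 * (s - 1)) (by linarith)
  set S := ∑' k : Fin d → ℤ, jap k ^ (-(2 * (s - 1)))
  have hS : 0 ≤ S := tsum_nonneg fun k => Real.rpow_nonneg (jap_pos k).le _
  refine ⟨Real.sqrt S, Real.sqrt_nonneg _, fun u => ?_⟩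
  have hJ : ∀ k : Fin d → ℤ, 0 ≤ jap k ^ s := fun k => Real.rpow_nonneg (jap_pos k).le s
  rw [norm_eq_sum (support_mult_subset _ u)]
  refine abs_le_of_sq_le_sq' ?_ (mul_nonneg (Real.sqrt_nonneg _) (n2_nonneg _)) |>.2
  have e : ∀ k, ‖(wmul jap u).coeff k‖ =
      jap k ^ (1 - s) * ‖(wmul (fun k => jap k ^ s) u).coeff k‖ := by
    intro k
    rw [norm_coeff_wmul fun k => (jap_pos k).le, norm_coeff_wmul hJ, ← mul_assoc,
      ← Real.rpow_add (jap_pos k)]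
    simp
  simp_rw [e]
  refine (Finset.sum_mul_sq_le_sq_mul_sq _ _ _).trans ?_
  rw [mul_pow, Real.sq_sqrt hS]
  refine mul_le_mul ?_ (sum_norm_coeff_sq_le _ _) (Finset.sum_nonneg fun _ _ => by positivity) hS
  refine le_trans (le_of_eq ?_) (hsum.sum_le_tsum u.coeff.support fun k _ =>
    Real.rpow_nonneg (jap_pos k).le _)
  refine Finset.sum_congr rfl fun k _ => ?_
  rw [← Real.rpow_natCast, ← Real.rpow_mul (jap_pos k).le]
  congr 1
  push_cast; ring

lemma exists_uniform_const {ι : Type*} [Fintype ι] {p : ι → ℝ → Prop}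
    (hmono : ∀ i C C', C ≤ C' → p i C → p i C') (h : ∀ i, ∃ C, 0 ≤ C ∧ p i C) :
    ∃ C, 0 ≤ C ∧ ∀ i, p i C := by
  choose C hC hp using h
  exact ⟨∑ i, C i, Finset.sum_nonneg fun i _ => hC i, fun i =>
    hmono i _ _ (Finset.single_le_sum (fun i _ => hC i) (Finset.mem_univ i)) (hp i)⟩

/-- The bounds on a polynomial nonlinearity and its gradient, in `ℓ¹` and in `H^r`. -/
lemma exists_comp_bounds (d : ℕ) (P : MvPolynomial (Fin n) ℝ) (M : ℝ) {r : ℝ} (hr : 1 ≤ r) :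
    ∃ C, 0 ≤ C ∧ ∀ U : Fin n → TrigPoly d, (∀ i, ‖U i‖ ≤ M) → ∀ ε y : ℝ, 0 ≤ ε → 0 ≤ y →
      (∀ i, ‖wmul jap (U i)‖ ≤ ε) → (∀ i, n2 (wmul (fun k => jap k ^ r) (U i)) ≤ y) →
      ‖comp P U‖ ≤ C ∧ ‖wmul nrm (comp P U)‖ ≤ C * ε ∧
        n2 (wmul (hweight r) (comp P U)) ≤ C * y := by
  obtain ⟨C₁, h₁, H₁⟩ := exists_norm_comp_le P M
  obtain ⟨C₂, h₂, H₂⟩ := exists_moser_le P M zero_le_one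
  obtain ⟨C₃, h₃, H₃⟩ := exists_moser_le P M (by positivity : (0 : ℝ) ≤ 2 ^ r)
  refine ⟨C₁ + C₂ * n + C₃ * n, by positivity, fun U hU ε y hε hy hUε hUy => ?_⟩
  have hs0 : ∀ (w : (Fin d → ℤ) → ℝ), w 0 = 0 → ∀ z,
      wmul w (AddMonoidAlgebra.single 0 z) = 0 := by
    intro w hw z
    rw [mult_single, hw]; simp
  have b2 := H₂ d (fun a => ‖wmul nrm a‖) (fun _ => norm_nonneg _)
    (fun a b => by simpa only [map_add] using norm_add_le _ _)
    (fun z => by simp only [hs0 nrm nrm_zero, norm_zero])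
    (fun a b => by simpa only [one_mul] using norm_wmul_mul_le nrm_nonneg nrm_add_le a b) U hU
  have b3 := H₃ d (fun a => n2 (wmul (hweight r) a)) (fun _ => n2_nonneg _)
    (fun a b => by simpa only [map_add] using n2_add_le _ _)
    (fun z => by
      have h0 : hweight r (0 : Fin d → ℤ) = 0 := by rw [hweight, nrm_zero, zero_mul]
      simp only [hs0 (hweight r) h0, n2_zero])
    (fun a b => n2_wmul_mul_le (hweight_nonneg r) (by positivity) (hweight_add_le hr) a b) U hU
  have e2 : ∑ i, ‖wmul nrm (U i)‖ ≤ n * ε := by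
    refine (Finset.sum_le_sum fun i _ => (norm_wmul_nrm_le _).trans (hUε i)).trans (by simp)
  have e3 : ∑ i, n2 (wmul (hweight r) (U i)) ≤ n * y := by
    refine (Finset.sum_le_sum fun i _ => le_trans (n2_le_of_coeff fun k => ?_) (hUy i)).trans
      (by simp)
    rw [norm_coeff_wmul (hweight_nonneg r),
      norm_coeff_wmul fun k => Real.rpow_nonneg (jap_pos k).le r]
    exact mul_le_mul_of_nonneg_right (hweight_le r k) (norm_nonneg _)
  have m2 := mul_le_mul_of_nonneg_left e2 h₂
  have m3 := mul_le_mul_of_nonneg_left e3 h₃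
  have p1 : 0 ≤ C₁ * ε := by positivity
  have p2 : 0 ≤ C₁ * y := by positivity
  have p3 : 0 ≤ C₂ * n * y := by positivity
  have p4 : 0 ≤ C₃ * n * ε := by positivity
  refine ⟨(H₁ d U hU).trans ?_, b2.trans ?_, b3.trans ?_⟩
  · have : 0 ≤ C₂ * n + C₃ * n := by positivity
    linarith
  · linarith
  · linarith

/-! ### The energy inequality -/

lemma norm_mean_le (a : TrigPoly d) : ‖mean a‖ ≤ ‖a‖ := norm_coeff_le a 0

/-- The real part of the mean, as a continuous linear functional. -/
def reMean : TrigPoly d →L[ℝ] ℝ :=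
  Complex.reCLM.comp (LinearMap.mkContinuous (mean.restrictScalars ℝ) 1
    (fun a => by simpa using norm_mean_le a))

lemma reMean_apply (a : TrigPoly d) : reMean a = (mean a).re := rfl

lemma hasDerivAt_comp (P : MvPolynomial (Fin n) ℝ) {U : ℝ → Fin n → TrigPoly d}
    {U' : Fin n → TrigPoly d} {t : ℝ} (hU : ∀ i, HasDerivAt (fun τ => U τ i) (U' i) t) :
    HasDerivAt (fun τ => comp P (U τ)) (∑ i, comp (MvPolynomial.pderiv i P) (U t) * U' i) t := by
  induction P using MvPolynomial.induction_on with
  | C r => simpa [comp] using hasDerivAt_const t (algebraMap ℝ (TrigPoly d) r)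
  | add P Q hP hQ =>
    have h := hP.fun_add hQ
    rw [← Finset.sum_add_distrib] at h
    refine (h.congr_deriv ?_).congr_of_eventuallyEq ?_
    · refine Finset.sum_congr rfl fun i _ => ?_
      rw [map_add, comp, comp, comp, map_add, add_mul]
    · exact Filter.Eventually.of_forall fun τ => map_add (MvPolynomial.aeval (U τ)) P Q
  | mul_X P i hP =>
    refine ((hP.fun_mul (hU i)).congr_deriv ?_).congr_of_eventuallyEq ?_
    · have e : ∀ j, comp (MvPolynomial.pderiv j (P * MvPolynomial.X i)) (U t) * U' j =
          comp (MvPolynomial.pderiv j P) (U t) * U' j * U t i +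
            if j = i then comp P (U t) * U' j else 0 := by
        intro j
        rw [MvPolynomial.pderiv_mul, MvPolynomial.pderiv_X, comp, map_add, map_mul, map_mul,
          MvPolynomial.aeval_X]
        by_cases h : j = i
        · subst h; simp; ring
        · simp [h]; ring
      rw [Finset.sum_congr rfl fun j _ => e j, Finset.sum_add_distrib, Finset.sum_mul]
      simp
    · exact Filter.Eventually.of_forall fun τ => by simp [comp]

/-- The symmetrizer energy `∑_{a ∈ {0,1}} ⟨G_a(U) L^a Λ^r U, L^a Λ^r U⟩`. -/
def energy (σ : EuclideanSpace ℝ (Fin d) → ℝ) (N : ℕ) (r : ℝ)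
    (G : Fin 2 → Fin n → Fin n → MvPolynomial (Fin n) ℝ) (U : Fin n → TrigPoly d) : ℝ :=
  ∑ a : Fin 2, ∑ m, ∑ i, reMean (comp (G a m i) U * sob σ N r a (U i) * sob σ N r a (U m))

/-- The polynomials `G_0, G_1` symmetrize the operators with coefficients `A_0, A_1`: the products
`G_a A_b`, collected according to the total power `a + b` of the filter, are symmetric. -/
structure IsSymmetrizedBy (A : Fin 2 → Fin d → Fin n → Fin n → MvPolynomial (Fin n) ℝ)
    (G : Fin 2 → Fin n → Fin n → MvPolynomial (Fin n) ℝ) : Prop where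
  symm : ∀ a m i, G a m i = G a i m
  symm_zero : ∀ j m l, ∑ i, G 0 m i * A 0 j i l = ∑ i, G 0 l i * A 0 j i m
  symm_one : ∀ j m l, ∑ i, (G 0 m i * A 1 j i l + G 1 m i * A 0 j i l) =
    ∑ i, (G 0 l i * A 1 j i m + G 1 l i * A 0 j i m)
  symm_two : ∀ j m l, ∑ i, G 1 m i * A 1 j i l = ∑ i, G 1 l i * A 1 j i m

/-- The right-hand side `∑_b ∑_j L^{2b} (A_{b,j}(U) ∂_j U)` of a scheme, on trigonometric
polynomials. -/
def polyOp (σ : EuclideanSpace ℝ (Fin d) → ℝ) (N : ℕ)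
    (A : Fin 2 → Fin d → Fin n → Fin n → MvPolynomial (Fin n) ℝ) (U : Fin n → TrigPoly d) :
    Fin n → TrigPoly d :=
  opF σ N (fun b j i l => comp (A b j i l) U) U

lemma IsLowPassProfile.exists_norm_polyOp_le (hσ : IsLowPassProfile σ) {s : ℝ}
    (hs : (d : ℝ) / 2 + 1 < s) (A : Fin 2 → Fin d → Fin n → Fin n → MvPolynomial (Fin n) ℝ)
    (M : ℝ) : ∃ C, 0 ≤ C ∧ ∀ (N : ℕ) (U : Fin n → TrigPoly d), hsN s U ≤ M →
      ∀ i, ‖polyOp σ N A U i‖ ≤ C * hsN s U := by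
  obtain ⟨Cs, hCs, hSob⟩ := exists_norm_wmul_jap_le hs
  have hA := exists_uniform_const (ι := Fin 2 × Fin d × Fin n × Fin n)
    (p := fun q C => ∀ U : Fin n → TrigPoly d, (∀ i, ‖U i‖ ≤ Cs * M) →
      ‖comp (A q.1 q.2.1 q.2.2.1 q.2.2.2) U‖ ≤ C)
    (fun q C C' h H U hU => (H U hU).trans h) (fun q => by
      obtain ⟨C, hC, h⟩ := exists_norm_comp_le (A q.1 q.2.1 q.2.2.1 q.2.2.2) (Cs * M)
      exact ⟨C, hC, h d⟩)
  obtain ⟨B, hB, hA⟩ := hA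
  refine ⟨2 * (d * (n * (B * Cs))), by positivity, fun N U hU i => ?_⟩
  have hUe : ∀ i, ‖wmul jap (U i)‖ ≤ Cs * hsN s U := fun i =>
    (hSob _).trans (mul_le_mul_of_nonneg_left (n2_le_hsN s U i) hCs)
  have hUM : ∀ i, ‖U i‖ ≤ Cs * M := fun i => (norm_le_norm_wmul_jap _).trans
    ((hUe i).trans (mul_le_mul_of_nonneg_left hU hCs))
  have : (2 * (d * (n * (B * Cs))) : ℝ) * hsN s U =
      (2 : ℕ) * (d * (n * (B * (Cs * hsN s U)))) := by push_cast; ring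
  rw [this]
  refine norm_sum_fin_le fun b => norm_sum_fin_le fun j => norm_sum_fin_le fun l => ?_
  refine (norm_filt_le hσ _ _ _).trans ((norm_mul_le _ _).trans ?_)
  exact mul_le_mul (hA (b, j, i, l) U hUM) ((norm_dX_le _ _).trans
    ((norm_wmul_nrm_le _).trans (hUe l))) (norm_nonneg _) hB

/-- Along solutions, the time derivative of the energy is controlled by `|U|_{H^s} |U|_{H^r}²`. -/
lemma IsLowPassProfile.exists_energy_deriv_le (hσ : IsLowPassProfile σ) {s r : ℝ}
    (hs : (d : ℝ) / 2 + 1 < s) (hr : 1 ≤ r)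
    {A : Fin 2 → Fin d → Fin n → Fin n → MvPolynomial (Fin n) ℝ}
    {G : Fin 2 → Fin n → Fin n → MvPolynomial (Fin n) ℝ} (hAG : IsSymmetrizedBy A G) (M : ℝ) :
    ∃ κ, 0 ≤ κ ∧ ∀ N : ℕ, 1 ≤ N → ∀ (U : ℝ → Fin n → TrigPoly d) (t : ℝ),
      (∀ (ℓ : TrigPoly d →ₗ[ℂ] TrigPoly d) i,
        HasDerivAt (fun τ => ℓ (U τ i)) (ℓ (-polyOp σ N A (U t) i)) t) →
      hsN s (U t) ≤ M →
      ∃ e, HasDerivAt (fun τ => energy σ N r G (U τ)) e t ∧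
        e ≤ κ * hsN s (U t) * hsN r (U t) ^ 2 := by
  obtain ⟨Cs, hCs, hSob⟩ := exists_norm_wmul_jap_le hs
  obtain ⟨D, hD, hop⟩ := hσ.exists_norm_polyOp_le hs A M
  have bd : ∀ P : MvPolynomial (Fin n) ℝ, ∃ C, 0 ≤ C ∧ ∀ U : Fin n → TrigPoly d, hsN s U ≤ M →
      ‖comp P U‖ ≤ C ∧ ‖wmul nrm (comp P U)‖ ≤ C * (hsN s U) ∧
        n2 (wmul (hweight r) (comp P U)) ≤ C * hsN r U := by
    intro P
    obtain ⟨C, hC, h⟩ := exists_comp_bounds d P (Cs * M) hr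
    refine ⟨C * (1 + Cs), by positivity, fun U hU => ?_⟩
    have hUe : ∀ i, ‖wmul jap (U i)‖ ≤ Cs * hsN s U := fun i =>
      (hSob _).trans (mul_le_mul_of_nonneg_left (n2_le_hsN s U i) hCs)
    have hUM : ∀ i, ‖U i‖ ≤ Cs * M := fun i => (norm_le_norm_wmul_jap _).trans
      ((hUe i).trans (mul_le_mul_of_nonneg_left hU hCs))
    have h1 := hsN_nonneg s U
    have h2 := hsN_nonneg r U
    obtain ⟨b1, b2, b3⟩ := h U hUM (Cs * hsN s U) (hsN r U) (by positivity) h2 hUe (n2_le_hsN r U)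
    have q1 : 0 ≤ C * Cs := by positivity
    have q2 : 0 ≤ C * hsN s U := by positivity
    have q3 : 0 ≤ C * Cs * hsN r U := by positivity
    exact ⟨by linarith, by linarith, by linarith⟩
  obtain ⟨BA, hBA, hA⟩ := exists_uniform_const (ι := Fin 2 × Fin d × Fin n × Fin n)
    (p := fun q C => ∀ U : Fin n → TrigPoly d, hsN s U ≤ M →
      ‖comp (A q.1 q.2.1 q.2.2.1 q.2.2.2) U‖ ≤ C ∧
      ‖wmul nrm (comp (A q.1 q.2.1 q.2.2.1 q.2.2.2) U)‖ ≤ C * (hsN s U) ∧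
        n2 (wmul (hweight r) (comp (A q.1 q.2.1 q.2.2.1 q.2.2.2) U)) ≤ C * hsN r U)
    (fun q C C' h H U hU => by
      have h1 := hsN_nonneg s U
      have h2 := hsN_nonneg r U
      obtain ⟨b1, b2, b3⟩ := H U hU
      exact ⟨b1.trans h, b2.trans (by gcongr), b3.trans (by gcongr)⟩) (fun q => bd _)
  obtain ⟨BG, hBG, hG⟩ := exists_uniform_const (ι := Fin 2 × Fin n × Fin n)
    (p := fun q C => ∀ U : Fin n → TrigPoly d, hsN s U ≤ M →
      ‖comp (G q.1 q.2.1 q.2.2) U‖ ≤ C ∧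
      ‖wmul nrm (comp (G q.1 q.2.1 q.2.2) U)‖ ≤ C * (hsN s U) ∧
        n2 (wmul (hweight r) (comp (G q.1 q.2.1 q.2.2) U)) ≤ C * hsN r U)
    (fun q C C' h H U hU => by
      have h1 := hsN_nonneg s U
      have h2 := hsN_nonneg r U
      obtain ⟨b1, b2, b3⟩ := H U hU
      exact ⟨b1.trans h, b2.trans (by gcongr), b3.trans (by gcongr)⟩) (fun q => bd _)
  obtain ⟨BD, hBD, hDG⟩ := exists_uniform_const (ι := Fin 2 × Fin n × Fin n × Fin n)
    (p := fun q C => ∀ U : Fin n → TrigPoly d, hsN s U ≤ M →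
      ‖comp (MvPolynomial.pderiv q.2.2.2 (G q.1 q.2.1 q.2.2.1)) U‖ ≤ C)
    (fun q C C' h H U hU => (H U hU).trans h) (fun q => by
      obtain ⟨C, hC, h⟩ := bd (MvPolynomial.pderiv q.2.2.2 (G q.1 q.2.1 q.2.2.1))
      exact ⟨C, hC, fun U hU => (h U hU).1⟩)
  set B := BA + BG + Cs with hBdef
  obtain ⟨C, hC, hflux⟩ := hσ.exists_norm_flux_le hr n (B := B) (by positivity)
  refine ⟨2 * (C * (1 + Cs)) + 2 * (n * (n * (n * (BD * D)))), by positivity,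
    fun N hN U t hU hUM => ?_⟩
  set ε := hsN s (U t) with hε
  set y := hsN r (U t) with hy
  have hε0 : 0 ≤ ε := hsN_nonneg _ _
  have hy0 : 0 ≤ y := hsN_nonneg _ _
  set F := polyOp σ N A (U t) with hF
  have hU0 : ∀ i, HasDerivAt (fun τ => U τ i) (-F i) t := fun i => hU LinearMap.id i
  have hcomp := fun P => hasDerivAt_comp (d := d) (n := n) P hU0
  have hder : HasDerivAt (fun τ => energy σ N r G (U τ)) (∑ a : Fin 2, ∑ m, ∑ i, reMean
      (((∑ k, comp (MvPolynomial.pderiv k (G a m i)) (U t) * -F k) * sob σ N r a (U t i) +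
        comp (G a m i) (U t) * sob σ N r a (-F i)) * sob σ N r a (U t m) +
        comp (G a m i) (U t) * sob σ N r a (U t i) * sob σ N r a (-F m))) t := by
    refine HasDerivAt.fun_sum fun a _ => HasDerivAt.fun_sum fun m _ => HasDerivAt.fun_sum fun i _ => ?_
    exact (reMean.hasFDerivAt.comp_hasDerivAt t
      (((hcomp (G a m i)).mul (hU (sob σ N r a) i)).mul (hU (sob σ N r a) m)))
  refine ⟨_, hder, ?_⟩
  have hsplit : ∑ a : Fin 2, ∑ m, ∑ i, reMean
      (((∑ k, comp (MvPolynomial.pderiv k (G a m i)) (U t) * -F k) * sob σ N r a (U t i) +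
        comp (G a m i) (U t) * sob σ N r a (-F i)) * sob σ N r a (U t m) +
        comp (G a m i) (U t) * sob σ N r a (U t i) * sob σ N r a (-F m)) =
      (∑ a : Fin 2, ∑ m, ∑ i, mean ((∑ k, comp (MvPolynomial.pderiv k (G a m i)) (U t) * -F k) *
        sob σ N r a (U t i) * sob σ N r a (U t m))).re -
      2 * (∑ a : Fin 2, ∑ m, ∑ i, mean (comp (G a m i) (U t) * sob σ N r a (F i) *
        sob σ N r a (U t m))).re := by
    have hsw : ∀ a : Fin 2, ∑ m, ∑ i, reMean (comp (G a m i) (U t) * sob σ N r a (U t i) *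
        sob σ N r a (F m)) = ∑ m, ∑ i, reMean (comp (G a m i) (U t) * sob σ N r a (F i) *
        sob σ N r a (U t m)) := by
      intro a
      rw [Finset.sum_comm]
      refine Finset.sum_congr rfl fun m _ => Finset.sum_congr rfl fun i _ => ?_
      rw [hAG.symm a i m]
      congr 1; ring
    simp only [Complex.re_sum, Complex.neg_re, ← reMean_apply, map_neg, add_mul, mul_neg, neg_mul, map_add,
      Finset.sum_add_distrib, Finset.sum_neg_distrib, hsw]
    ring
  rw [hsplit]
  have h1 : ‖∑ a : Fin 2, ∑ m, ∑ i, mean ((∑ k, comp (MvPolynomial.pderiv k (G a m i)) (U t) *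
      -F k) * sob σ N r a (U t i) * sob σ N r a (U t m))‖ ≤
      (2 : ℕ) * (n * (n * (n * (BD * (D * ε)) * y * y))) := by
    refine norm_sum_fin_le fun a => norm_sum_fin_le fun m => norm_sum_fin_le fun i => ?_
    refine (norm_mean_mul_mul_le _ _ _).trans ?_
    have k1 : ∀ i, n2 (sob σ N r a (U t i)) ≤ y := fun i =>
      (n2_sob_le hσ N r a _).trans (n2_le_hsN r _ i)
    have := n2_nonneg (sob σ N r a (U t i))
    have := n2_nonneg (sob σ N r a (U t m))
    refine mul_le_mul (mul_le_mul (norm_sum_fin_le fun k => ?_) (k1 i) (by assumption)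
      (by positivity)) (k1 m) (by assumption) (by positivity)
    refine (norm_mul_le _ _).trans ?_
    rw [norm_neg]
    exact mul_le_mul (hDG (a, m, i, k) _ hUM) (hop N _ hUM k) (norm_nonneg _) hBD
  have h2 := hflux N hN (fun a m i => comp (G a m i) (U t)) (fun b j i l => comp (A b j i l) (U t))
    (U t) ((1 + Cs) * ε) y
    (fun j m l => by
      simpa only [comp, map_sum, map_mul] using congrArg (MvPolynomial.aeval (U t))
        (hAG.symm_zero j m l))
    (fun j m l => by
      simpa only [comp, map_sum, map_mul, map_add] using congrArg (MvPolynomial.aeval (U t))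
        (hAG.symm_one j m l))
    (fun j m l => by
      simpa only [comp, map_sum, map_mul] using congrArg (MvPolynomial.aeval (U t))
        (hAG.symm_two j m l))
    (fun a m i => (hG (a, m, i) _ hUM).1.trans (by linarith))
    (fun a m i => (hG (a, m, i) _ hUM).2.1.trans (by
      refine mul_le_mul (by linarith) ?_ hε0 (by positivity)
      exact le_mul_of_one_le_left hε0 (by linarith)))
    (fun b j i l => (hA (b, j, i, l) _ hUM).1.trans (by linarith))
    (fun b j i l => (hA (b, j, i, l) _ hUM).2.1.trans (by
      refine mul_le_mul (by linarith) ?_ hε0 (by positivity)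
      exact le_mul_of_one_le_left hε0 (by linarith)))
    (fun b j i l => (hA (b, j, i, l) _ hUM).2.2.trans (by
      exact mul_le_mul_of_nonneg_right (by linarith) hy0))
    (fun l => (hSob _).trans (mul_le_mul (by linarith) (n2_le_hsN s _ l) (n2_nonneg _)
      (by positivity)))
    (n2_le_hsN r _) (by positivity) hy0
  have r1 := (Complex.re_le_norm _).trans h1
  have r2 := (Complex.abs_re_le_norm _).trans h2
  have r3 := (abs_le.1 r2).1
  simp only [polyOp] at hF
  simp only [← hF] at r3
  push_cast at r1
  calc _ ≤ (2 * (n * (n * (n * (BD * (D * ε)) * y * y))) : ℝ) + 2 * (C * ((1 + Cs) * ε) * y ^ 2) := by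
        linarith
    _ = _ := by ring

end SpectralScheme
end

noncomputable section

namespace SpectralScheme

open Finset MeasureTheory

variable {d n : ℕ} {σ : EuclideanSpace ℝ (Fin d) → ℝ}

/-! ### Values of trigonometric polynomials -/

lemma phase_add (k l : Fin d → ℤ) (x : Fin d → ℝ) : phase (k + l) x = phase k x + phase l x := by
  simp [phase, add_mul, Finset.sum_add_distrib]

lemma phase_neg (k : Fin d → ℤ) (x : Fin d → ℝ) : phase (-k) x = -phase k x := by
  simp [phase]

/-- The character `e^{i k·x}`. -/
def wave (k : Fin d → ℤ) (x : Fin d → ℝ) : ℂ := Complex.exp (Complex.I * (phase k x : ℂ))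

lemma wave_zero (x : Fin d → ℝ) : wave (0 : Fin d → ℤ) x = 1 := by simp [wave, phase]

lemma wave_add (k l : Fin d → ℤ) (x : Fin d → ℝ) : wave (k + l) x = wave k x * wave l x := by
  rw [wave, wave, wave, ← Complex.exp_add, phase_add]; push_cast; ring_nf

lemma wave_neg (k : Fin d → ℤ) (x : Fin d → ℝ) :
    wave (-k) x = (starRingEnd ℂ) (wave k x) := by
  rw [wave, wave, ← Complex.exp_conj, phase_neg]; simp

lemma norm_wave (k : Fin d → ℤ) (x : Fin d → ℝ) : ‖wave k x‖ = 1 := by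
  rw [wave, mul_comm, Complex.norm_exp_ofReal_mul_I]

/-- Evaluation of trigonometric polynomials at a point. -/
def ev (x : Fin d → ℝ) : TrigPoly d →ₐ[ℂ] ℂ :=
  AddMonoidAlgebra.lift ℂ ℂ (Fin d → ℤ)
    { toFun := fun k => wave k.toAdd x
      map_one' := wave_zero x
      map_mul' := fun k l => wave_add k.toAdd l.toAdd x }

lemma ev_single (x : Fin d → ℝ) (k : Fin d → ℤ) (z : ℂ) :
    ev x (AddMonoidAlgebra.single k z) = z * wave k x := by
  rw [ev, AddMonoidAlgebra.lift_single]; rfl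

lemma ev_eq_sum (x : Fin d → ℝ) {a : TrigPoly d} {s : Finset (Fin d → ℤ)}
    (hs : a.coeff.support ⊆ s) : ev x a = ∑ k ∈ s, a.coeff k * wave k x := by
  rw [ev, AddMonoidAlgebra.lift_apply, Finsupp.sum_of_support_subset _ hs _ (by simp)]
  rfl

lemma norm_ev_le (x : Fin d → ℝ) (a : TrigPoly d) : ‖ev x a‖ ≤ ‖a‖ := by
  rw [ev_eq_sum x subset_rfl, norm_eq_sum subset_rfl]
  refine norm_sum_le_of_le _ fun k _ => ?_
  rw [norm_mul, norm_wave, mul_one]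

/-- Complex conjugation of trigonometric polynomials. -/
def conjT : TrigPoly d →+* TrigPoly d :=
  (AddMonoidAlgebra.mapRingHom (Fin d → ℤ) (starRingEnd ℂ)).comp
    (AddMonoidAlgebra.mapDomainRingHom ℂ (negAddMonoidHom : (Fin d → ℤ) →+ (Fin d → ℤ)))

lemma conjT_single (k : Fin d → ℤ) (z : ℂ) :
    conjT (AddMonoidAlgebra.single k z) = AddMonoidAlgebra.single (-k) ((starRingEnd ℂ) z) := by
  simp [conjT]

lemma coeff_conjT (a : TrigPoly d) (k : Fin d → ℤ) :
    (conjT a).coeff k = (starRingEnd ℂ) (a.coeff (-k)) := by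
  induction a using AddMonoidAlgebra.induction_linear with
  | zero => simp
  | add a b ha hb =>
    rw [map_add, AddMonoidAlgebra.coeff_add, AddMonoidAlgebra.coeff_add, Finsupp.add_apply,
      Finsupp.add_apply, ha, hb, map_add]
  | single l z =>
    rw [conjT_single]
    by_cases h : -l = k
    · subst h; simp
    · have h' : l ≠ -k := fun e => h (by rw [e, neg_neg])
      simp [h, h']

lemma ev_conjT (x : Fin d → ℝ) (a : TrigPoly d) : ev x (conjT a) = (starRingEnd ℂ) (ev x a) := by
  induction a using AddMonoidAlgebra.induction_linear with
  | zero => simp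
  | add a b ha hb => simp only [map_add, ha, hb]
  | single l z => rw [conjT_single, ev_single, ev_single, map_mul, wave_neg]

/-- Real-valued trigonometric polynomials. -/
def IsRealPoly (a : TrigPoly d) : Prop := conjT a = a

lemma isRealPoly_iff (a : TrigPoly d) :
    IsRealPoly a ↔ ∀ k, a.coeff (-k) = (starRingEnd ℂ) (a.coeff k) := by
  constructor
  · intro h k
    have := coeff_conjT a (-k)
    rwa [h, neg_neg] at this
  · intro h
    refine AddMonoidAlgebra.ext (Finsupp.ext fun k => ?_)
    rw [coeff_conjT, h, Complex.conj_conj]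

lemma IsRealPoly.add {a b : TrigPoly d} (ha : IsRealPoly a) (hb : IsRealPoly b) :
    IsRealPoly (a + b) := by
  rw [IsRealPoly, map_add, ha, hb]

lemma IsRealPoly.mul {a b : TrigPoly d} (ha : IsRealPoly a) (hb : IsRealPoly b) :
    IsRealPoly (a * b) := by
  rw [IsRealPoly, map_mul, ha, hb]

lemma IsRealPoly.sum {ι : Type*} {s : Finset ι} {f : ι → TrigPoly d}
    (h : ∀ i ∈ s, IsRealPoly (f i)) : IsRealPoly (∑ i ∈ s, f i) := by
  rw [IsRealPoly, map_sum]
  exact Finset.sum_congr rfl h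

lemma IsRealPoly.mult {a : TrigPoly d} (ha : IsRealPoly a) {m : (Fin d → ℤ) → ℂ}
    (hm : ∀ k, m (-k) = (starRingEnd ℂ) (m k)) : IsRealPoly (mult m a) := by
  rw [isRealPoly_iff] at *
  intro k
  rw [coeff_mult, coeff_mult, map_mul, hm, ha]

lemma IsRealPoly.wmul {a : TrigPoly d} (ha : IsRealPoly a) {w : (Fin d → ℤ) → ℝ}
    (hw : ∀ k, w (-k) = w k) : IsRealPoly (wmul w a) :=
  ha.mult fun k => by rw [hw, Complex.conj_ofReal]

lemma IsRealPoly.dX {a : TrigPoly d} (ha : IsRealPoly a) (j : Fin d) : IsRealPoly (dX j a) :=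
  ha.mult fun k => by simp

lemma IsRealPoly.comp (P : MvPolynomial (Fin n) ℝ) {U : Fin n → TrigPoly d}
    (hU : ∀ i, IsRealPoly (U i)) : IsRealPoly (comp P U) := by
  induction P using MvPolynomial.induction_on with
  | C r =>
    have e : SpectralScheme.comp (MvPolynomial.C r) U = AddMonoidAlgebra.single 0 (r : ℂ) := by
      simp [SpectralScheme.comp]
    rw [e, IsRealPoly, conjT_single]; simp
  | add P Q hP hQ => simpa only [SpectralScheme.comp, map_add] using hP.add hQ
  | mul_X P i hP =>
    simpa only [SpectralScheme.comp, map_mul, MvPolynomial.aeval_X] using hP.mul (hU i)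

lemma IsRealPoly.ev_eq {a : TrigPoly d} (ha : IsRealPoly a) (x : Fin d → ℝ) :
    ev x a = ((ev x a).re : ℂ) := by
  have := ev_conjT x a
  rw [ha] at this
  exact (Complex.conj_eq_iff_re.1 this.symm).symm

lemma IsRealPoly.polyOp {A : Fin 2 → Fin d → Fin n → Fin n → MvPolynomial (Fin n) ℝ}
    (hσ : IsLowPassProfile σ) (N : ℕ) {U : Fin n → TrigPoly d} (hU : ∀ i, IsRealPoly (U i))
    (i : Fin n) : IsRealPoly (polyOp σ N A U i) :=
  .sum fun b _ => .sum fun j _ => .sum fun l _ =>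
    ((IsRealPoly.comp _ hU).mul ((hU l).dX j)).wmul fun k => by rw [lam_neg hσ]

/-- The real vector field with components `U i`. -/
def synth (U : Fin n → TrigPoly d) : Field d n := fun x i => (ev x (U i)).re

lemma ev_comp (P : MvPolynomial (Fin n) ℝ) {U : Fin n → TrigPoly d} (hU : ∀ i, IsRealPoly (U i))
    (x : Fin d → ℝ) : ev x (comp P U) = ((MvPolynomial.eval (synth U x) P : ℝ) : ℂ) := by
  induction P using MvPolynomial.induction_on with
  | C r =>
    have e : comp (MvPolynomial.C r) U = AddMonoidAlgebra.single 0 (r : ℂ) := by simp [comp]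
    rw [e, ev_single, wave_zero]; simp
  | add P Q hP hQ =>
    simp only [comp, map_add] at *
    rw [hP, hQ]; push_cast; rfl
  | mul_X P i hP =>
    simp only [comp, map_mul, MvPolynomial.aeval_X, MvPolynomial.eval_X] at *
    rw [hP, (hU i).ev_eq x]; push_cast; rfl

/-! ### Means as integrals, and positivity -/

lemma volume_cell_pos : 0 < ((2 * Real.pi) ^ d : ℝ) := by positivity

lemma continuous_wave (k : Fin d → ℤ) : Continuous (wave k) := by
  unfold wave phase
  fun_prop

lemma continuous_ev (a : TrigPoly d) : Continuous fun x => ev x a := by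
  simp_rw [fun x => ev_eq_sum x (a := a) subset_rfl]
  exact continuous_finsetSum _ fun k _ => continuous_const.mul (continuous_wave k)

lemma _root_.Continuous.integrableOn_cell {E : Type*} [NormedAddCommGroup E]
    {f : (Fin d → ℝ) → E} (hf : Continuous f) : IntegrableOn f (cell d) := by
  have hsub : cell d ⊆ Set.Icc 0 (fun _ => 2 * Real.pi) := fun x hx =>
    ⟨fun j => (hx j trivial).1.le, fun j => (hx j trivial).2⟩
  exact (hf.continuousOn.integrableOn_compact isCompact_Icc).mono_set hsub

lemma integral_wave (k : Fin d → ℤ) :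
    ∫ x in cell d, wave k x = if k = 0 then (((2 * Real.pi) ^ d : ℝ) : ℂ) else 0 := by
  have hw : ∀ x : Fin d → ℝ, wave k x = ∏ j, Complex.exp (Complex.I * ((k j : ℂ)) * (x j : ℂ)) := by
    intro x
    rw [wave, phase, ← Complex.exp_sum]
    congr 1
    push_cast
    rw [Finset.mul_sum]
    exact Finset.sum_congr rfl fun j _ => by ring
  have h1 : ∫ x in cell d, wave k x =
      ∏ j : Fin d, ∫ y in Set.Ioc 0 (2 * Real.pi), Complex.exp (Complex.I * (k j : ℂ) * (y : ℂ)) := by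
    simp_rw [hw]
    rw [cell, volume_pi, Measure.restrict_pi_pi]
    exact integral_fintype_prod_eq_prod
      (fun j (y : ℝ) => Complex.exp (Complex.I * (k j : ℂ) * (y : ℂ)))
  rw [h1]
  split_ifs with h
  · subst h
    simp [Real.pi_pos.le]
  · obtain ⟨j, hj⟩ := Function.ne_iff.1 h
    refine Finset.prod_eq_zero (Finset.mem_univ j) ?_
    have hj' : (k j : ℂ) ≠ 0 := by exact_mod_cast hj
    rw [← intervalIntegral.integral_of_le (by positivity),
      integral_exp_mul_complex (mul_ne_zero Complex.I_ne_zero hj')]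
    have e : Complex.exp (Complex.I * (k j : ℂ) * ((2 * Real.pi : ℝ) : ℂ)) = 1 := by
      rw [Complex.exp_eq_one_iff]
      exact ⟨k j, by push_cast; ring⟩
    rw [e]; simp

lemma mean_eq_integral (a : TrigPoly d) :
    mean a = (((2 * Real.pi) ^ d : ℝ) : ℂ)⁻¹ * ∫ x in cell d, ev x a := by
  have h : ∫ x in cell d, ev x a = (((2 * Real.pi) ^ d : ℝ) : ℂ) * mean a := by
    simp_rw [fun x => ev_eq_sum x (a := a) subset_rfl]
    have hi : ∀ k ∈ a.coeff.support, Integrable (fun x => a.coeff k * wave k x)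
        (volume.restrict (cell d)) := fun k _ =>
      (continuous_const.mul (continuous_wave k)).integrableOn_cell
    rw [integral_finsetSum _ hi]
    simp_rw [integral_const_mul, integral_wave]
    rw [Finset.sum_eq_single 0]
    · rw [if_pos rfl, mul_comm, mean_apply]
    · intro k _ hk; rw [if_neg hk, mul_zero]
    · intro h; rw [Finsupp.notMem_support_iff.1 h, zero_mul]
  rw [h, ← mul_assoc, inv_mul_cancel₀, one_mul]
  exact_mod_cast (volume_cell_pos (d := d)).ne'

lemma reMean_mono {a b : TrigPoly d} (h : ∀ x, (ev x a).re ≤ (ev x b).re) :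
    reMean a ≤ reMean b := by
  have e : ∀ a : TrigPoly d, reMean a =
      ((2 * Real.pi) ^ d)⁻¹ * ∫ x in cell d, (ev x a).re := by
    intro a
    rw [reMean_apply, mean_eq_integral, ← Complex.ofReal_inv, Complex.re_ofReal_mul]
    congr 1
    exact (integral_re (𝕜 := ℂ) (continuous_ev a).integrableOn_cell).symm
  rw [e, e]
  refine mul_le_mul_of_nonneg_left ?_ (by positivity)
  exact setIntegral_mono (Complex.continuous_re.comp (continuous_ev a)).integrableOn_cell
    (Complex.continuous_re.comp (continuous_ev b)).integrableOn_cell h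

lemma reMean_mul_self {a : TrigPoly d} (ha : IsRealPoly a) : reMean (a * a) = n2 a ^ 2 := by
  rw [reMean_apply, mean_mul subset_rfl, n2_sq_eq_sum subset_rfl, Complex.re_sum]
  refine Finset.sum_congr rfl fun k _ => ?_
  rw [(isRealPoly_iff a).1 ha, Complex.mul_conj, Complex.ofReal_re, Complex.normSq_eq_norm_sq]

/-- Parseval: a pointwise bound on a quadratic form integrates to a bound on the form in `L²`. -/
lemma sum_reMean_bounds {Q : Fin n → Fin n → TrigPoly d} {X : Fin n → TrigPoly d}
    (hQ : ∀ m i, IsRealPoly (Q m i)) (hX : ∀ i, IsRealPoly (X i)) {c C : ℝ}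
    (h : ∀ (x : Fin d → ℝ) (ξ : Fin n → ℝ),
      c * ∑ i, ξ i ^ 2 ≤ ∑ m, ∑ i, (ev x (Q m i)).re * ξ i * ξ m ∧
        ∑ m, ∑ i, (ev x (Q m i)).re * ξ i * ξ m ≤ C * ∑ i, ξ i ^ 2) :
    c * ∑ i, n2 (X i) ^ 2 ≤ ∑ m, ∑ i, reMean (Q m i * X i * X m) ∧
      ∑ m, ∑ i, reMean (Q m i * X i * X m) ≤ C * ∑ i, n2 (X i) ^ 2 := by
  have e1 : ∀ x, (ev x (∑ m, ∑ i, Q m i * X i * X m)).re =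
      ∑ m, ∑ i, (ev x (Q m i)).re * (ev x (X i)).re * (ev x (X m)).re := by
    intro x
    simp only [map_sum, map_mul, Complex.re_sum]
    refine Finset.sum_congr rfl fun m _ => Finset.sum_congr rfl fun i _ => ?_
    rw [(hQ m i).ev_eq x, (hX i).ev_eq x, (hX m).ev_eq x]
    norm_cast
  have e2 : ∀ (c : ℝ) x, (ev x ((c : ℂ) • ∑ i, X i * X i)).re = c * ∑ i, (ev x (X i)).re ^ 2 := by
    intro c x
    rw [map_smul, smul_eq_mul, Complex.re_ofReal_mul]
    simp only [map_sum, map_mul, Complex.re_sum]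
    congr 1
    refine Finset.sum_congr rfl fun i _ => ?_
    rw [(hX i).ev_eq x, ← Complex.ofReal_mul, Complex.ofReal_re, Complex.ofReal_re, sq]
  have e3 : ∀ c : ℝ, reMean ((c : ℂ) • ∑ i, X i * X i) = c * ∑ i, n2 (X i) ^ 2 := by
    intro c
    rw [reMean_apply, map_smul, smul_eq_mul, Complex.re_ofReal_mul, ← reMean_apply, map_sum]
    simp_rw [reMean_mul_self (hX _)]
  have e4 : reMean (∑ m, ∑ i, Q m i * X i * X m) = ∑ m, ∑ i, reMean (Q m i * X i * X m) := by
    simp only [map_sum]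
  rw [← e3, ← e3, ← e4]
  constructor
  · refine reMean_mono fun x => ?_
    rw [e1, e2]
    exact (h x _).1
  · refine reMean_mono fun x => ?_
    rw [e1, e2]
    exact (h x _).2

end SpectralScheme
end

noncomputable section

namespace SpectralScheme

open Finset MeasureTheory

variable {d n : ℕ} {σ : EuclideanSpace ℝ (Fin d) → ℝ}

/-! ### Symmetrizers of the two schemes -/

lemma eq_of_eval_eq_on_open {𝒰 : Set (Fin n → ℝ)} (ho : IsOpen 𝒰) (h0 : 0 ∈ 𝒰)
    {P Q : MvPolynomial (Fin n) ℝ}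
    (h : ∀ v ∈ 𝒰, MvPolynomial.eval v P = MvPolynomial.eval v Q) : P = Q := by
  obtain ⟨ε, hε, hb⟩ := Metric.isOpen_iff.1 ho 0 h0
  refine MvPolynomial.funext_set (fun _ => Set.Ioo (-ε) ε)
    (fun _ => Set.Ioo_infinite (by linarith)) fun v hv => h v (hb ?_)
  rw [mem_ball_zero_iff, pi_norm_lt_iff hε]
  exact fun i => by rw [Real.norm_eq_abs, abs_lt]; exact hv i trivial

/-- A symmetrizer is uniformly definite on compact sets. -/
lemma IsSymmetrizer.exists_form_bounds {A : Fin d → PolyMatrix n} {S : PolyMatrix n}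
    {𝒰 : Set (Fin n → ℝ)} (hS : IsSymmetrizer A S 𝒰) {K : Set (Fin n → ℝ)} (hK : IsCompact K)
    (hKU : K ⊆ 𝒰) :
    ∃ c C : ℝ, 0 < c ∧ 0 < C ∧ ∀ v ∈ K, ∀ ξ : Fin n → ℝ,
      c * ∑ i, ξ i ^ 2 ≤ ∑ m, ∑ i, MvPolynomial.eval v (S m i) * ξ i * ξ m ∧
        ∑ m, ∑ i, MvPolynomial.eval v (S m i) * ξ i * ξ m ≤ C * ∑ i, ξ i ^ 2 := by
  set f : (Fin n → ℝ) × EuclideanSpace ℝ (Fin n) → ℝ := fun p =>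
    ∑ m, ∑ i, MvPolynomial.eval p.1 (S m i) * p.2 i * p.2 m with hf
  have hfc : Continuous f := by
    refine continuous_finsetSum _ fun m _ => continuous_finsetSum _ fun i _ => ?_
    have h1 : Continuous fun p : (Fin n → ℝ) × EuclideanSpace ℝ (Fin n) =>
      MvPolynomial.eval p.1 (S m i) := (MvPolynomial.continuous_eval _).comp continuous_fst
    have h2 : ∀ i, Continuous fun p : (Fin n → ℝ) × EuclideanSpace ℝ (Fin n) => p.2 i :=
      fun i => by fun_prop
    exact (h1.mul (h2 i)).mul (h2 m)
  have hpos : ∀ v ∈ K, ∀ ξ : EuclideanSpace ℝ (Fin n), ξ ≠ 0 → 0 < f (v, ξ) := by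
    intro v hv ξ hξ
    have hξ' : (fun i => ξ i) ≠ 0 := fun h => hξ (by ext i; exact congrFun h i)
    have h := (hS.posDef v (hKU hv)).dotProduct_mulVec_pos hξ'
    refine h.trans_le (le_of_eq ?_)
    simp only [dotProduct, Matrix.mulVec, hf, Finset.mul_sum, PolyMatrix.evalAt, Matrix.of_apply,
      Pi.star_apply, star_trivial]
    exact Finset.sum_congr rfl fun m _ => Finset.sum_congr rfl fun i _ => by ring
  have hcomp : IsCompact (K ×ˢ Metric.sphere (0 : EuclideanSpace ℝ (Fin n)) 1) :=
    hK.prod (isCompact_sphere _ _)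
  have hunit : ∀ c C : ℝ, (∀ v ∈ K, ∀ u ∈ Metric.sphere (0 : EuclideanSpace ℝ (Fin n)) 1,
      c ≤ f (v, u) ∧ f (v, u) ≤ C) → ∀ v ∈ K, ∀ ξ : Fin n → ℝ,
      c * ∑ i, ξ i ^ 2 ≤ ∑ m, ∑ i, MvPolynomial.eval v (S m i) * ξ i * ξ m ∧
        ∑ m, ∑ i, MvPolynomial.eval v (S m i) * ξ i * ξ m ≤ C * ∑ i, ξ i ^ 2 := by
    intro c C h v hv ξ
    by_cases hξ : ξ = 0
    · subst hξ; simp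
    set η : EuclideanSpace ℝ (Fin n) := WithLp.toLp 2 ξ with hη
    have hη0 : η ≠ 0 := fun h => hξ (by
      ext i; have := congrArg (fun z : EuclideanSpace ℝ (Fin n) => z i) h; simpa [hη] using this)
    have hn : 0 < ‖η‖ := norm_pos_iff.2 hη0
    have hsq : ∑ i, ξ i ^ 2 = ‖η‖ ^ 2 := by simp [EuclideanSpace.norm_sq_eq, hη]
    have hu : ‖η‖⁻¹ • η ∈ Metric.sphere (0 : EuclideanSpace ℝ (Fin n)) 1 := by
      simp [norm_smul, hn.ne']
    have hfu : f (v, ‖η‖⁻¹ • η) * ‖η‖ ^ 2 =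
        ∑ m, ∑ i, MvPolynomial.eval v (S m i) * ξ i * ξ m := by
      simp only [hf, Finset.sum_mul, PiLp.smul_apply, smul_eq_mul, hη]
      refine Finset.sum_congr rfl fun m _ => Finset.sum_congr rfl fun i _ => ?_
      rw [← hη]; field_simp
    obtain ⟨h1, h2⟩ := h v hv _ hu
    rw [← hfu, hsq]
    constructor <;> gcongr
  rcases (K ×ˢ Metric.sphere (0 : EuclideanSpace ℝ (Fin n)) 1).eq_empty_or_nonempty with he | hne
  · refine ⟨1, 1, one_pos, one_pos, hunit 1 1 fun v hv u hu => ?_⟩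
    have : (v, u) ∈ K ×ˢ Metric.sphere (0 : EuclideanSpace ℝ (Fin n)) 1 := ⟨hv, hu⟩
    rw [he] at this
    exact absurd this (Set.notMem_empty _)
  · obtain ⟨p, hp, hmin⟩ := hcomp.exists_isMinOn hne hfc.continuousOn
    obtain ⟨q, hq, hmax⟩ := hcomp.exists_isMaxOn hne hfc.continuousOn
    have hsph : ∀ u ∈ Metric.sphere (0 : EuclideanSpace ℝ (Fin n)) 1, u ≠ 0 := by
      rintro u hu rfl
      simp at hu
    refine ⟨f p, f q, hpos p.1 hp.1 p.2 (hsph _ hp.2), hpos q.1 hq.1 q.2 (hsph _ hq.2),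
      hunit _ _ fun v hv u hu => ⟨hmin ⟨hv, hu⟩, hmax ⟨hv, hu⟩⟩⟩

/-- The energy built from `G` is, for fields with values in `K`, equivalent to the square of the
`H^r` norm, uniformly in `N` and `r`. -/
def IsCoerciveOn (σ : EuclideanSpace ℝ (Fin d) → ℝ)
    (G : Fin 2 → Fin n → Fin n → MvPolynomial (Fin n) ℝ) (K : Set (Fin n → ℝ)) (c C : ℝ) : Prop :=
  ∀ (N : ℕ) (r : ℝ) (U : Fin n → TrigPoly d), (∀ i, IsRealPoly (U i)) → (∀ x, synth U x ∈ K) →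
    c * hsN r U ^ 2 ≤ energy σ N r G U ∧ energy σ N r G U ≤ C * hsN r U ^ 2

lemma IsRealPoly.sob {a : TrigPoly d} (hσ : IsLowPassProfile σ) (ha : IsRealPoly a) (N : ℕ) (r : ℝ)
    (c : ℕ) : IsRealPoly (sob σ N r c a) :=
  ha.wmul fun k => by rw [lam_neg hσ, jap_neg]

lemma IsSymmetrizer.isSymm {A : Fin d → PolyMatrix n} {S : PolyMatrix n}
    {𝒰 : Set (Fin n → ℝ)} (hS : IsSymmetrizer A S 𝒰) (m i : Fin n) : S m i = S i m := by
  refine eq_of_eval_eq_on_open hS.isOpen hS.zero_mem fun v hv => ?_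
  have := (hS.posDef v hv).isHermitian.apply i m
  simpa [PolyMatrix.evalAt] using this

/-- The coefficients of the fully filtered scheme. -/
def coefA (A : Fin d → PolyMatrix n) : Fin 2 → Fin d → Fin n → Fin n → MvPolynomial (Fin n) ℝ :=
  fun b j i l => if b = 0 then 0 else A j i l

/-- The symmetrizer of the fully filtered scheme. -/
def coefS (S : PolyMatrix n) : Fin 2 → Fin n → Fin n → MvPolynomial (Fin n) ℝ :=
  fun a m i => if a = 0 then S m i else 0

/-- The coefficients of the scheme whose linear part is unfiltered. -/
def coefA' (A : Fin d → PolyMatrix n) : Fin 2 → Fin d → Fin n → Fin n → MvPolynomial (Fin n) ℝ :=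
  fun b j i l => if b = 0 then MvPolynomial.C (MvPolynomial.eval 0 (A j i l)) else
    A j i l - MvPolynomial.C (MvPolynomial.eval 0 (A j i l))

/-- The symmetrizer of the scheme whose linear part is unfiltered. -/
def coefS' (S : PolyMatrix n) : Fin 2 → Fin n → Fin n → MvPolynomial (Fin n) ℝ :=
  fun a m i => if a = 0 then MvPolynomial.C (MvPolynomial.eval 0 (S m i)) else
    S m i - MvPolynomial.C (MvPolynomial.eval 0 (S m i))

lemma IsSymmetrizer.isSymmetrizedBy {A : Fin d → PolyMatrix n} {S : PolyMatrix n}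
    {𝒰 : Set (Fin n → ℝ)} (hS : IsSymmetrizer A S 𝒰) :
    IsSymmetrizedBy (coefA A) (coefS S) where
  symm a m i := by simp only [coefS, hS.isSymm m i]
  symm_zero j m l := by simp [coefA, coefS]
  symm_one j m l := by
    simp only [coefA, coefS]
    refine eq_of_eval_eq_on_open hS.isOpen hS.zero_mem fun v hv => ?_
    have := (hS.symm v hv j).apply l m
    simpa [PolyMatrix.evalAt, Matrix.mul_apply] using this
  symm_two j m l := by simp [coefS]

lemma IsSymmetrizer.isSymmetrizedBy' {A : Fin d → PolyMatrix n} {S : PolyMatrix n}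
    {𝒰 : Set (Fin n → ℝ)} (hS : IsSymmetrizer A S 𝒰) (hc : IsCompatible A S 𝒰) :
    IsSymmetrizedBy (coefA' A) (coefS' S) where
  symm a m i := by simp only [coefS', hS.isSymm m i]
  symm_zero j m l := by
    simp only [coefA', coefS']
    refine eq_of_eval_eq_on_open hS.isOpen hS.zero_mem fun v hv => ?_
    have := (hc j v hv).1.apply l m
    simpa [PolyMatrix.evalAt, Matrix.mul_apply] using this
  symm_one j m l := by
    simp only [coefA', coefS']
    refine eq_of_eval_eq_on_open hS.isOpen hS.zero_mem fun v hv => ?_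
    have := (hc j v hv).2.1.apply l m
    simpa [PolyMatrix.evalAt, Matrix.mul_apply, Finset.sum_add_distrib] using this
  symm_two j m l := by
    simp only [coefA', coefS']
    refine eq_of_eval_eq_on_open hS.isOpen hS.zero_mem fun v hv => ?_
    have := (hc j v hv).2.2.apply l m
    simpa [PolyMatrix.evalAt, Matrix.mul_apply] using this

lemma IsSymmetrizer.exists_isCoerciveOn {A : Fin d → PolyMatrix n} {S : PolyMatrix n}
    {𝒰 : Set (Fin n → ℝ)} (hS : IsSymmetrizer A S 𝒰) (hσ : IsLowPassProfile σ)
    {K : Set (Fin n → ℝ)} (hK : IsCompact K) (hKU : K ⊆ 𝒰) :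
    ∃ c C : ℝ, 0 < c ∧ 0 < C ∧ IsCoerciveOn σ (coefS S) K c C := by
  obtain ⟨c, C, hc, hC, h⟩ := hS.exists_form_bounds hK hKU
  refine ⟨c, C, hc, hC, fun N r U hU hUK => ?_⟩
  have hb := sum_reMean_bounds (Q := fun m i => comp (S m i) U) (X := fun i => sob σ N r 0 (U i))
    (fun m i => .comp _ hU) (fun i => (hU i).sob hσ N r 0) (c := c) (C := C) fun x ξ => by
      simp only [ev_comp _ hU, Complex.ofReal_re]
      exact h _ (hUK x) ξ
  have e : ∀ i, sob σ N r 0 (U i) = wmul (fun k => jap k ^ r) (U i) := fun i => by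
    ext k; simp
  rw [hsN_sq]
  simp only [e] at hb
  simpa [energy, coefS, e] using hb

/-- For the scheme with unfiltered linear part the energy is
`⟨S(U) LΛU, LΛU⟩ + ⟨S(0) L'ΛU, L'ΛU⟩` with `L' = (1 - L²)^{1/2}`, hence coercive. -/
lemma IsSymmetrizer.exists_isCoerciveOn' {A : Fin d → PolyMatrix n} {S : PolyMatrix n}
    {𝒰 : Set (Fin n → ℝ)} (hS : IsSymmetrizer A S 𝒰) (hσ : IsLowPassProfile σ)
    {K : Set (Fin n → ℝ)} (hK : IsCompact K) (hKU : K ⊆ 𝒰) :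
    ∃ c C : ℝ, 0 < c ∧ 0 < C ∧ IsCoerciveOn σ (coefS' S) K c C := by
  obtain ⟨c, C, hc, hC, h⟩ := hS.exists_form_bounds (hK.insert 0)
    (Set.insert_subset hS.zero_mem hKU)
  refine ⟨c, C, hc, hC, fun N r U hU hUK => ?_⟩
  set w : (Fin d → ℤ) → ℝ := fun k => Real.sqrt (1 - lam σ N k ^ 2) * jap k ^ r with hw
  have hwsq : ∀ k, Real.sqrt (1 - lam σ N k ^ 2) ^ 2 = 1 - lam σ N k ^ 2 := fun k =>
    Real.sq_sqrt (by
      have := pow_le_one₀ (n := 2) (lam_nonneg N k) (lam_le_one hσ N k)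
      linarith)
  set X := fun i => sob σ N r 1 (U i) with hX
  set Y := fun i => wmul w (U i) with hY
  set V := fun i => wmul (fun k => jap k ^ r) (U i) with hV
  have hb := sum_reMean_bounds (Q := fun m i => comp (S m i) U) (X := X)
    (fun m i => .comp _ hU) (fun i => (hU i).sob hσ N r 1) (c := c) (C := C) fun x ξ => by
      simp only [ev_comp _ hU, Complex.ofReal_re]
      exact h _ (Set.mem_insert_of_mem _ (hUK x)) ξ
  have hb' := sum_reMean_bounds (X := Y)
    (Q := fun m i => comp (MvPolynomial.C (MvPolynomial.eval 0 (S m i))) U)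
    (fun m i => .comp _ hU) (fun i => (hU i).wmul fun k => by
      simp only [hw]; rw [lam_neg hσ, jap_neg]) (c := c) (C := C) fun x ξ => by
      simp only [ev_comp _ hU, Complex.ofReal_re, MvPolynomial.eval_C]
      exact h _ (Set.mem_insert _ _) ξ
  have hn : ∀ i, n2 (V i) ^ 2 = n2 (X i) ^ 2 + n2 (Y i) ^ 2 := by
    intro i
    rw [n2_sq_eq_sum (support_mult_subset _ (U i)), n2_sq_eq_sum (support_mult_subset _ (U i)),
      n2_sq_eq_sum (support_mult_subset _ (U i)), ← Finset.sum_add_distrib]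
    refine Finset.sum_congr rfl fun k _ => ?_
    simp only [coeff_mult, norm_mul, Complex.norm_real, mul_pow, hw, Real.norm_eq_abs, sq_abs, hwsq,
      pow_one]
    ring
  have hm : ∀ i m, reMean (V i * V m) = reMean (X i * X m) + reMean (Y i * Y m) := by
    intro i m
    simp only [reMean_apply]
    rw [mean_mul (support_mult_subset _ (U i)), mean_mul (support_mult_subset _ (U i)),
      mean_mul (support_mult_subset _ (U i)), ← Complex.add_re, ← Finset.sum_add_distrib]
    congr 1
    refine Finset.sum_congr rfl fun k _ => ?_
    have e : ((lam σ N k : ℝ) : ℂ) * lam σ N k +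
        (Real.sqrt (1 - lam σ N k ^ 2) : ℝ) * (Real.sqrt (1 - lam σ N k ^ 2) : ℝ) = 1 := by
      rw [← sq, ← sq]; norm_cast; rw [hwsq]; ring
    simp only [hV, hX, hY, coeff_mult, hw, lam_neg hσ, jap_neg, pow_one]
    push_cast
    linear_combination (-((jap k ^ r : ℝ) : ℂ) * ((jap k ^ r : ℝ) : ℂ) * (U i).coeff k *
      (U m).coeff (-k)) * e
  have hconst : ∀ (z : ℝ) (a b : TrigPoly d),
      reMean (comp (MvPolynomial.C z) U * a * b) = z * reMean (a * b) := by
    intro z a b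
    have e : comp (MvPolynomial.C z) U * a * b = z • (a * b) := by
      rw [comp, MvPolynomial.aeval_C, mul_assoc, Algebra.algebraMap_eq_smul_one, smul_mul_assoc,
        one_mul]
    rw [e, map_smul, smul_eq_mul]
  have he : energy σ N r (coefS' S) U = ∑ m, ∑ i, reMean (comp (S m i) U * X i * X m) +
      ∑ m, ∑ i, reMean (comp (MvPolynomial.C (MvPolynomial.eval 0 (S m i))) U * Y i * Y m) := by
    have e : ∀ i, sob σ N r 0 (U i) = V i := fun i => by ext k; simp [hV]
    have e1 : ∀ i, sob σ N r 1 (U i) = X i := fun i => rfl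
    simp only [energy, Fin.sum_univ_two, ← Finset.sum_add_distrib, Fin.val_zero, Fin.val_one, e, e1]
    refine Finset.sum_congr rfl fun m _ => Finset.sum_congr rfl fun i _ => ?_
    have e2 : comp (coefS' S 1 m i) U = comp (S m i) U -
        comp (MvPolynomial.C (MvPolynomial.eval 0 (S m i))) U := by
      simp only [coefS', comp]; rw [if_neg one_ne_zero, map_sub]
    have e3 : coefS' S 0 m i = MvPolynomial.C (MvPolynomial.eval 0 (S m i)) := if_pos rfl
    rw [e2, e3, sub_mul, sub_mul, map_sub, hconst, hconst, hconst, hm]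
    ring
  rw [hsN_sq, he]
  have hs : ∑ i, n2 (V i) ^ 2 = ∑ i, n2 (X i) ^ 2 + ∑ i, n2 (Y i) ^ 2 := by
    rw [← Finset.sum_add_distrib]; exact Finset.sum_congr rfl fun i _ => hn i
  change c * ∑ i, n2 (V i) ^ 2 ≤ _ ∧ _ ≤ C * ∑ i, n2 (V i) ^ 2
  rw [hs, mul_add, mul_add]
  exact ⟨add_le_add hb.1 hb'.1, add_le_add hb.2 hb'.2⟩

/-- A differential inequality `E' ≤ κ E` integrates to exponential growth. -/
lemma le_mul_exp_of_deriv_le {E E' : ℝ → ℝ} {κ T : ℝ}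
    (hE : ∀ t ∈ Set.Icc 0 T, HasDerivAt E (E' t) t) (h : ∀ t ∈ Set.Icc 0 T, E' t ≤ κ * E t) :
    ∀ t ∈ Set.Icc 0 T, E t ≤ E 0 * Real.exp (κ * t) := by
  intro t ht
  have hd : ∀ τ ∈ Set.Icc 0 T, HasDerivAt (fun τ => E τ * Real.exp (-κ * τ))
      (E' τ * Real.exp (-κ * τ) + E τ * (Real.exp (-κ * τ) * -κ)) τ := by
    intro τ hτ
    have h1 : HasDerivAt (fun τ : ℝ => -κ * τ) (-κ) τ := by
      simpa using (hasDerivAt_id τ).const_mul (-κ)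
    exact (hE τ hτ).mul h1.exp
  have hanti : AntitoneOn (fun τ => E τ * Real.exp (-κ * τ)) (Set.Icc 0 T) := by
    refine antitoneOn_of_deriv_nonpos (convex_Icc 0 T)
      (fun τ hτ => (hd τ hτ).continuousAt.continuousWithinAt)
      (fun τ hτ => (hd τ (interior_subset hτ)).differentiableAt.differentiableWithinAt)
      fun τ hτ => ?_
    rw [(hd τ (interior_subset hτ)).deriv]
    have := h τ (interior_subset hτ)
    have hp := Real.exp_pos (-κ * τ)
    nlinarith
  have := hanti (Set.left_mem_Icc.2 (ht.1.trans ht.2)) ht ht.1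
  simp only [mul_zero, Real.exp_zero, mul_one] at this
  have hp := Real.exp_pos (κ * t)
  calc E t = E t * Real.exp (-κ * t) * Real.exp (κ * t) := by
        rw [mul_assoc, ← Real.exp_add]; simp
    _ ≤ _ := mul_le_mul_of_nonneg_right this hp.le

/-- The a priori estimate: growth of the `H^r` norm is governed by the size of the `H^s` norm. -/
lemma IsLowPassProfile.exists_hsN_le (hσ : IsLowPassProfile σ) {s r : ℝ}
    (hs : (d : ℝ) / 2 + 1 < s) (hr : 1 ≤ r)
    {A : Fin 2 → Fin d → Fin n → Fin n → MvPolynomial (Fin n) ℝ}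
    {G : Fin 2 → Fin n → Fin n → MvPolynomial (Fin n) ℝ} (hAG : IsSymmetrizedBy A G)
    {K : Set (Fin n → ℝ)} {c C : ℝ} (hc : 0 < c) (hC : 0 < C) (hG : IsCoerciveOn σ G K c C)
    (M : ℝ) :
    ∃ κ, 0 ≤ κ ∧ ∀ N : ℕ, 1 ≤ N → ∀ (U : ℝ → Fin n → TrigPoly d) (T m : ℝ), m ≤ M →
      (∀ t ∈ Set.Icc 0 T, ∀ (ℓ : TrigPoly d →ₗ[ℂ] TrigPoly d) i,
        HasDerivAt (fun τ => ℓ (U τ i)) (ℓ (-polyOp σ N A (U t) i)) t) →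
      (∀ t ∈ Set.Icc 0 T, ∀ i, IsRealPoly (U t i)) →
      (∀ t ∈ Set.Icc 0 T, ∀ x, synth (U t) x ∈ K) →
      (∀ t ∈ Set.Icc 0 T, hsN s (U t) ≤ m) →
      ∀ t ∈ Set.Icc 0 T,
        hsN r (U t) ≤ Real.sqrt (C / c) * hsN r (U 0) * Real.exp (κ * m * t) := by
  obtain ⟨κ, hκ, h⟩ := hσ.exists_energy_deriv_le hs hr hAG M
  refine ⟨κ / c / 2, by positivity, fun N hN U T m hm hU hreal hK hsm t ht => ?_⟩
  choose! E' hE' hE'le using fun t ht => h N hN U t (hU t ht) ((hsm t ht).trans hm)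
  have hm0 : 0 ≤ m := (hsN_nonneg s _).trans (hsm t ht)
  have hgr := le_mul_exp_of_deriv_le (κ := κ / c * m) hE' (fun τ hτ => by
    have h1 := (hG N r (U τ) (hreal τ hτ) (hK τ hτ)).1
    have h2 : hsN r (U τ) ^ 2 ≤ energy σ N r G (U τ) / c := by
      rw [le_div_iff₀ hc]; linarith
    calc E' τ ≤ κ * hsN s (U τ) * hsN r (U τ) ^ 2 := hE'le τ hτ
      _ ≤ κ * m * (energy σ N r G (U τ) / c) := by
          have := hsN_nonneg s (U τ)
          gcongr
          exact hsm τ hτ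
      _ = _ := by ring) t ht
  have h0 : (0 : ℝ) ∈ Set.Icc 0 T := Set.left_mem_Icc.2 (ht.1.trans ht.2)
  have h1 := (hG N r (U t) (hreal t ht) (hK t ht)).1
  have h2 := (hG N r (U 0) (hreal 0 h0) (hK 0 h0)).2
  have hr0 := hsN_nonneg r (U 0)
  refine abs_le_of_sq_le_sq' ?_ (by positivity) |>.2
  have e : Real.exp (κ / c / 2 * m * t) ^ 2 = Real.exp (κ / c * m * t) := by
    rw [← Real.exp_nat_mul]; congr 1; push_cast; ring
  rw [mul_pow, mul_pow, Real.sq_sqrt (by positivity), e]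
  have h3 : c * hsN r (U t) ^ 2 ≤ C * hsN r (U 0) ^ 2 * Real.exp (κ / c * m * t) :=
    h1.trans (hgr.trans (mul_le_mul_of_nonneg_right h2 (Real.exp_pos _).le))
  have h4 : C / c * hsN r (U 0) ^ 2 * Real.exp (κ / c * m * t) =
      (C * hsN r (U 0) ^ 2 * Real.exp (κ / c * m * t)) / c := by ring
  rw [h4, le_div_iff₀ hc]
  linarith

end SpectralScheme
end

noncomputable section

namespace SpectralScheme

open Set

/-! ### Maximal solutions of autonomous ordinary differential equations -/

section ODE

variable {E : Type*} [NormedAddCommGroup E] [NormedSpace ℝ E]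

/-- A solution of `c' = f(c)`, `c(0) = c₀`, on an open interval containing `0`. -/
structure IsODESolution (f : E → E) (c₀ : E) (I : Set ℝ) (c : ℝ → E) : Prop where
  isOpen : IsOpen I
  ordConnected : I.OrdConnected
  zero_mem : (0 : ℝ) ∈ I
  initial : c 0 = c₀
  hasDerivAt : ∀ t ∈ I, HasDerivAt c (f (c t)) t

lemma exists_lt_lt_mem_of_isOpen {s : Set ℝ} (hs : IsOpen s) {x : ℝ} (hx : x ∈ s) :
    (∃ a ∈ s, a < x) ∧ ∃ b ∈ s, x < b := by
  obtain ⟨ε, hε, h⟩ := Metric.isOpen_iff.1 hs x hx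
  refine ⟨⟨x - ε / 2, h ?_, by linarith⟩, ⟨x + ε / 2, h ?_, by linarith⟩⟩ <;>
    rw [Metric.mem_ball, Real.dist_eq, abs_lt] <;> constructor <;> linarith

variable {f : E → E} {c₀ : E}

lemma IsODESolution.eqOn (hf : ContDiff ℝ 1 f) {I J : Set ℝ} {c c' : ℝ → E}
    (h : IsODESolution f c₀ I c) (h' : IsODESolution f c₀ J c') {t : ℝ} (hI : t ∈ I)
    (hJ : t ∈ J) : c t = c' t := by
  have ho := h.isOpen.inter h'.isOpen
  have hc := h.ordConnected.inter h'.ordConnected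
  have h0 : (0 : ℝ) ∈ I ∩ J := ⟨h.zero_mem, h'.zero_mem⟩
  have ht : t ∈ I ∩ J := ⟨hI, hJ⟩
  have hmin : min 0 t ∈ I ∩ J := by rcases min_choice 0 t with e | e <;> rw [e] <;> assumption
  have hmax : max 0 t ∈ I ∩ J := by rcases max_choice 0 t with e | e <;> rw [e] <;> assumption
  obtain ⟨a, ha, ha'⟩ := (exists_lt_lt_mem_of_isOpen ho hmin).1
  obtain ⟨b, hb, hb'⟩ := (exists_lt_lt_mem_of_isOpen ho hmax).2
  rw [lt_min_iff] at ha'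
  rw [max_lt_iff] at hb'
  have hsub : Icc a b ⊆ I ∩ J := hc.out ha hb
  have hcc : ContinuousOn c (Icc a b) := fun τ hτ =>
    (h.hasDerivAt τ (hsub hτ).1).continuousAt.continuousWithinAt
  have hcc' : ContinuousOn c' (Icc a b) := fun τ hτ =>
    (h'.hasDerivAt τ (hsub hτ).2).continuousAt.continuousWithinAt
  obtain ⟨K, hK⟩ := (hf.locallyLipschitz.locallyLipschitzOn
    (s := c '' Icc a b ∪ c' '' Icc a b)).exists_lipschitzOnWith_of_compact
      ((isCompact_Icc.image_of_continuousOn hcc).union (isCompact_Icc.image_of_continuousOn hcc'))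
  exact ODE_solution_unique_of_mem_Ioo (v := fun _ => f) (fun _ _ => hK)
    (t₀ := 0) ⟨ha'.1, hb'.1⟩
    (fun τ hτ => ⟨h.hasDerivAt τ (hsub (Ioo_subset_Icc_self hτ)).1,
      Or.inl (mem_image_of_mem _ (Ioo_subset_Icc_self hτ))⟩)
    (fun τ hτ => ⟨h'.hasDerivAt τ (hsub (Ioo_subset_Icc_self hτ)).2,
      Or.inr (mem_image_of_mem _ (Ioo_subset_Icc_self hτ))⟩)
    (by rw [h.initial, h'.initial]) ⟨ha'.2, hb'.2⟩

/-- The union of the intervals of existence carries a solution as soon as there is one. -/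
lemma exists_maximal_isODESolution (hf : ContDiff ℝ 1 f)
    (hloc : ∃ J c, IsODESolution f c₀ J c) :
    ∃ I c, IsODESolution f c₀ I c ∧
      ∀ J c', IsODESolution f c₀ J c' → J ⊆ I ∧ ∀ t ∈ J, c' t = c t := by
  classical
  set I : Set ℝ := ⋃₀ {J | ∃ c, IsODESolution f c₀ J c} with hI
  have hmem : ∀ t : ℝ, t ∈ I → ∃ Jc : Set ℝ × (ℝ → E), t ∈ Jc.1 ∧ IsODESolution f c₀ Jc.1 Jc.2 := by
    rintro t ⟨J, ⟨c, h⟩, ht⟩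
    exact ⟨(J, c), ht, h⟩
  choose! q hq hq' using hmem
  have hagree : ∀ J c', IsODESolution f c₀ J c' → ∀ t ∈ J, c' t = (q t).2 t := fun J c' h t ht =>
    have htI : t ∈ I := ⟨J, ⟨c', h⟩, ht⟩
    h.eqOn hf (hq' t htI) ht (hq t htI)
  obtain ⟨J₀, cc, h₀⟩ := hloc
  refine ⟨I, fun t => (q t).2 t, ⟨?_, ?_, ?_, ?_, ?_⟩, fun J c' h => ⟨?_, hagree J c' h⟩⟩
  · refine isOpen_sUnion ?_
    rintro J ⟨c, h⟩
    exact h.isOpen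
  · refine (isPreconnected_sUnion 0 _ ?_ ?_).ordConnected
    · rintro J ⟨c, h⟩
      exact h.zero_mem
    · rintro J ⟨c, h⟩
      exact h.ordConnected.isPreconnected
  · exact ⟨J₀, ⟨cc, h₀⟩, h₀.zero_mem⟩
  · rw [← hagree J₀ cc h₀ 0 h₀.zero_mem, h₀.initial]
  · intro t ht
    refine ((hq' t ht).hasDerivAt t (hq t ht)).congr_of_eventuallyEq ?_
    filter_upwards [(hq' t ht).isOpen.mem_nhds (hq t ht)] with τ hτ
    exact (hagree _ _ (hq' t ht) τ hτ).symm
  · exact fun t ht => ⟨J, ⟨c', h⟩, ht⟩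

variable [FiniteDimensional ℝ E]

/-- Compactly supported `C¹` vector fields, being bounded and globally Lipschitz, have solutions on
every bounded interval. -/
lemma exists_hasDerivAt_of_hasCompactSupport (hf : ContDiff ℝ 1 f) (hs : HasCompactSupport f)
    (c₀ : E) (T : ℝ) : ∃ c : ℝ → E, c 0 = c₀ ∧ ∀ t, |t| < T → HasDerivAt c (f (c t)) t := by
  by_cases hT : T ≤ 0
  · exact ⟨fun _ => c₀, rfl, fun t ht => absurd (ht.trans_le hT) (not_lt.2 (abs_nonneg t))⟩
  push Not at hT
  have : CompleteSpace E := FiniteDimensional.complete ℝ E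
  obtain ⟨K, hK⟩ := ContDiff.lipschitzWith_of_hasCompactSupport hs hf one_ne_zero
  obtain ⟨L, hL⟩ := hs.exists_bound_of_continuous hf.continuous
  have hL' : ∀ x, ‖f x‖ ≤ (L.toNNReal : ℝ) := fun x => (hL x).trans (Real.le_coe_toNNReal L)
  have h0 : (0 : ℝ) ∈ Icc (-T) T := ⟨by linarith, hT.le⟩
  have hp : IsPicardLindelof (fun _ => f) (⟨0, h0⟩ : Icc (-T) T) c₀ (L.toNNReal * T.toNNReal) 0
      L.toNNReal K :=
    .of_time_independent (fun x _ => hL' x) hK.lipschitzOnWith (by simp [hT.le])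
  obtain ⟨c, hc, hd⟩ := hp.exists_eq_forall_mem_Icc_hasDerivWithinAt₀
  refine ⟨c, hc, fun t ht => ?_⟩
  rw [abs_lt] at ht
  exact (hd t ⟨ht.1.le, ht.2.le⟩).hasDerivAt (Icc_mem_nhds ht.1 ht.2)

/-- The continuity method: if a solution that has stayed in the bounded closed set `Z` is in fact in
the open set `O ⊆ Z`, then the solution exists and stays in `O` up to time `T`. -/
lemma exists_isODESolution_of_bootstrap (hf : ContDiff ℝ 1 f) {Z O : Set E}
    (hZ : Bornology.IsBounded Z) (hZc : IsClosed Z) (hO : IsOpen O) (hOZ : O ⊆ Z) (hc₀ : c₀ ∈ O)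
    {T : ℝ} (hT : 0 ≤ T)
    (hboot : ∀ (c : ℝ → E) (t : ℝ), 0 ≤ t → t ≤ T → c 0 = c₀ →
      (∀ τ ∈ Icc 0 t, HasDerivAt c (f (c τ)) τ) → (∀ τ ∈ Icc 0 t, c τ ∈ Z) → c t ∈ O) :
    ∃ I c, IsODESolution f c₀ I c ∧ Icc 0 T ⊆ I ∧ ∀ t ∈ Icc 0 T, c t ∈ O := by
  obtain ⟨R, hR, hZR⟩ := hZ.subset_ball_lt 0 (0 : E)
  set χ : ContDiffBump (0 : E) := ⟨R, R + 1, hR, by linarith⟩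
  have hχ : ∀ x ∈ Metric.ball (0 : E) R, (χ x) • f x = f x := fun x hx => by
    rw [χ.one_of_mem_closedBall (Metric.ball_subset_closedBall hx), one_smul]
  obtain ⟨c, hc, hd⟩ := exists_hasDerivAt_of_hasCompactSupport (f := fun x => χ x • f x)
    (χ.contDiff.smul hf) (χ.hasCompactSupport.smul_right) c₀ (T + 1)
  have hcont : ∀ t, |t| < T + 1 → ContinuousAt c t := fun t ht => (hd t ht).continuousAt
  have habs : ∀ t ∈ Icc 0 T, |t| < T + 1 := fun t ht => by
    rw [abs_of_nonneg ht.1]; linarith [ht.2]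
  have hsol : ∀ t, |t| < T + 1 → c t ∈ Metric.ball (0 : E) R → HasDerivAt c (f (c t)) t :=
    fun t ht hb => by simpa only [hχ _ hb] using hd t ht
  have hstep : ∀ t ∈ Icc 0 T, (∀ τ ∈ Icc 0 t, c τ ∈ Z) → c t ∈ O := fun t ht hz =>
    hboot c t ht.1 ht.2 hc (fun τ hτ => hsol τ (habs τ ⟨hτ.1, hτ.2.trans ht.2⟩) (hZR (hz τ hτ))) hz
  have hcO : ContinuousOn c (Icc 0 T) := fun t ht => (hcont t (habs t ht)).continuousWithinAt
  have hall : Icc 0 T ⊆ {t | ∀ τ ∈ Icc 0 t, c τ ∈ Z} := by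
    refine IsClosed.Icc_subset_of_forall_exists_gt ?_ ?_ ?_
    · have e : {t | ∀ τ ∈ Icc 0 t, c τ ∈ Z} ∩ Icc 0 T =
          ⋂ τ ∈ Icc 0 T, {t ∈ Icc 0 T | c (min τ t) ∈ Z} ∩ Icc 0 T := by
        ext t
        simp only [mem_inter_iff, mem_ofPred_eq, mem_iInter]
        constructor
        · rintro ⟨h, ht⟩ τ hτ
          exact ⟨⟨ht, h _ ⟨le_min hτ.1 ht.1, min_le_right _ _⟩⟩, ht⟩
        · intro h
          have ht : t ∈ Icc 0 T := (h 0 ⟨le_rfl, hT⟩).2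
          refine ⟨fun τ hτ => ?_, ht⟩
          have := (h τ ⟨hτ.1, hτ.2.trans ht.2⟩).1.2
          rwa [min_eq_left hτ.2] at this
      rw [e]
      refine isClosed_biInter fun τ hτ => ?_
      have hm : ContinuousOn (fun t => c (min τ t)) (Icc 0 T) :=
        hcO.comp (by fun_prop) fun t ht => ⟨le_min hτ.1 ht.1, (min_le_right _ _).trans ht.2⟩
      have := hm.preimage_isClosed_of_isClosed isClosed_Icc hZc
      refine (this.inter isClosed_Icc)
    · intro τ hτ
      have : τ = 0 := le_antisymm hτ.2 hτ.1
      rw [this, hc]; exact hOZ hc₀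
    · rintro t ⟨hz, ht⟩ y hy
      have htO := hstep t ⟨ht.1, ht.2.le⟩ hz
      have hn := (hcont t (habs t ⟨ht.1, ht.2.le⟩)).preimage_mem_nhds (hO.mem_nhds htO)
      obtain ⟨ε, hε, hb⟩ := Metric.mem_nhds_iff.1 hn
      have hy' : t < y := hy
      refine ⟨min y (t + ε / 2), fun τ hτ => ?_, lt_min hy' (by linarith), min_le_left _ _⟩
      by_cases h : τ ≤ t
      · exact hz τ ⟨hτ.1, h⟩
      · refine hOZ (hb ?_)
        have := hτ.2.trans (min_le_right _ _)
        rw [Metric.mem_ball, Real.dist_eq, abs_lt]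
        constructor <;> linarith
  have hin : ∀ t ∈ Icc 0 T, c t ∈ O := fun t ht => hstep t ht (hall ht)
  set W : Set ℝ := Ioo (-(T + 1)) (T + 1) ∩ c ⁻¹' Metric.ball (0 : E) R
  have hW : IsOpen W := by
    refine ContinuousOn.isOpen_inter_preimage (fun t ht => ?_) isOpen_Ioo Metric.isOpen_ball
    exact (hcont t (abs_lt.2 ht)).continuousWithinAt
  have hWs : Icc 0 T ⊆ W := fun t ht => ⟨abs_lt.1 (habs t ht), hZR (hOZ (hin t ht))⟩
  have h0 : (0 : ℝ) ∈ W := hWs ⟨le_rfl, hT⟩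
  refine ⟨connectedComponentIn W 0, c, ⟨hW.connectedComponentIn,
    isPreconnected_connectedComponentIn.ordConnected, mem_connectedComponentIn h0, hc,
    fun t ht => ?_⟩, isPreconnected_Icc.subset_connectedComponentIn ⟨le_rfl, hT⟩ hWs, hin⟩
  have := connectedComponentIn_subset W 0 ht
  exact hsol t (abs_lt.2 this.1) this.2

lemma exists_isODESolution (hf : ContDiff ℝ 1 f) (c₀ : E) : ∃ I c, IsODESolution f c₀ I c := by
  obtain ⟨I, c, h, -⟩ := exists_isODESolution_of_bootstrap hf (Z := Metric.closedBall c₀ 1)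
    (O := Metric.ball c₀ 1) Metric.isBounded_closedBall Metric.isClosed_closedBall
    Metric.isOpen_ball Metric.ball_subset_closedBall (Metric.mem_ball_self one_pos) le_rfl
    (fun c t ht ht' h0 _ _ => by
      rw [le_antisymm ht' ht, h0]; exact Metric.mem_ball_self one_pos)
  exact ⟨I, c, h⟩

end ODE

end SpectralScheme
end

noncomputable section

namespace SpectralScheme

open MeasureTheory

variable {d n : ℕ}

/-! ### Completeness of the characters in `L²` of the period cell -/

section Torus

-- the measure of total mass one, for which Mathlib's Fourier series on the torus is set up
attribute [local instance] instMeasureSpaceUnitAddCircle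

open UnitAddTorus in
/-- The parametrization of the period cell by the unit torus. -/
def toCell (y : UnitAddTorus (Fin d)) : Fin d → ℝ :=
  (2 * Real.pi) • (measurableEquivPiIoc (fun _ => (0 : ℝ)) y).1

lemma measurable_toCell : Measurable (toCell (d := d)) :=
  (measurable_subtype_coe.comp (MeasurableEquiv.measurable _)).const_smul (2 * Real.pi)

lemma map_toCell : Measure.map (toCell (d := d)) volume =
    ENNReal.ofReal (|((2 * Real.pi) ^ d)⁻¹|) • volume.restrict (cell d) := by
  have hpi : (2 * Real.pi) ≠ 0 := by positivity
  have h1 := (UnitAddTorus.measurePreserving_equivPiIoc (fun _ : Fin d => (0 : ℝ))).map_eq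
  have hb : MeasurableSet {x : Fin d → ℝ | ∀ i, x i ∈ Set.Ioc (0 : ℝ) (0 + 1)} :=
    MeasurableSet.univ_pi' fun _ => measurableSet_Ioc
  have h2 := map_comap_subtype_coe hb volume
  have e : toCell (d := d) = (fun x => (2 * Real.pi) • x) ∘ Subtype.val ∘
      UnitAddTorus.measurableEquivPiIoc (fun _ => (0 : ℝ)) := rfl
  rw [e, ← Measure.map_map (measurable_const_smul _)
    (measurable_subtype_coe.comp (MeasurableEquiv.measurable _)),
    ← Measure.map_map measurable_subtype_coe (MeasurableEquiv.measurable _), h1]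
  refine (congrArg (Measure.map _) h2).trans ?_
  have hc : {x : Fin d → ℝ | ∀ i, x i ∈ Set.Ioc (0 : ℝ) (0 + 1)} =
      (fun x => (2 * Real.pi) • x) ⁻¹' (cell d) := by
    ext x
    simp only [Set.mem_ofPred_eq, Set.mem_preimage, cell, Set.mem_univ_pi, Pi.smul_apply,
      smul_eq_mul, Set.mem_Ioc, zero_add]
    refine forall_congr' fun i => and_congr ?_ ?_
    · rw [mul_pos_iff_of_pos_left (by positivity)]
    · rw [mul_le_iff_le_one_right (by positivity)]
  have hcell : MeasurableSet (cell d) := MeasurableSet.univ_pi fun _ => measurableSet_Ioc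
  rw [hc, ← Measure.restrict_map (measurable_const_smul _) hcell, Measure.map_addHaar_smul _ hpi,
    Measure.restrict_smul]
  simp

lemma mFourier_eq_wave (k : Fin d → ℤ) (y : UnitAddTorus (Fin d)) :
    UnitAddTorus.mFourier k y = wave k (toCell y) := by
  obtain ⟨x, rfl⟩ := (UnitAddTorus.measurableEquivPiIoc (fun _ : Fin d => (0 : ℝ))).symm.surjective y
  rw [toCell, MeasurableEquiv.apply_symm_apply]
  simp only [UnitAddTorus.mFourier, ContinuousMap.coe_mk,
    UnitAddTorus.coe_symm_measurableEquivPiIoc_apply, fourier_coe_apply, wave, phase]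
  rw [← Complex.exp_sum]
  congr 1
  push_cast
  rw [Finset.mul_sum]
  refine Finset.sum_congr rfl fun i _ => ?_
  simp; ring

lemma ae_eq_zero_of_integral_wave_eq_zero {g : (Fin d → ℝ) → ℂ}
    (hg : MemLp g 2 (volume.restrict (cell d)))
    (h : ∀ k : Fin d → ℤ, ∫ x in cell d, wave (-k) x * g x = 0) :
    ∀ᵐ x ∂volume.restrict (cell d), g x = 0 := by
  have hpi : 0 < |((2 * Real.pi) ^ d)⁻¹| := by positivity
  have hmem : MemLp (g ∘ toCell) 2 (volume : Measure (UnitAddTorus (Fin d))) := by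
    have := hg.smul_measure (c := ENNReal.ofReal (|((2 * Real.pi) ^ d)⁻¹|)) ENNReal.ofReal_ne_top
    rw [← map_toCell] at this
    exact this.comp_of_map measurable_toCell.aemeasurable
  have hcoef : ∀ k, UnitAddTorus.mFourierCoeff (hmem.toLp _) k = 0 := by
    intro k
    have e1 : UnitAddTorus.mFourierCoeff (hmem.toLp _) k =
        ∫ y : UnitAddTorus (Fin d), wave (-k) (toCell y) * g (toCell y) := by
      refine integral_congr_ae ?_
      filter_upwards [hmem.coeFn_toLp] with y hy
      rw [hy, mFourier_eq_wave]; rfl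
    have hmeas : AEStronglyMeasurable (fun x => wave (-k) x * g x)
        (Measure.map (toCell (d := d)) volume) := by
      rw [map_toCell]
      exact ((continuous_wave (-k)).aestronglyMeasurable.mul hg.1).smul_measure _
    rw [e1, ← integral_map (f := fun x => wave (-k) x * g x) measurable_toCell.aemeasurable hmeas,
      map_toCell, integral_smul_measure, h, smul_zero]
  have hz : hmem.toLp _ = 0 := by
    have := UnitAddTorus.hasSum_mFourier_series_L2 (hmem.toLp _)
    simp only [hcoef, zero_smul] at this
    exact this.unique hasSum_zero
  have hae : ∀ᵐ y : UnitAddTorus (Fin d), g (toCell y) = 0 := by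
    have h1 := hmem.coeFn_toLp
    rw [hz] at h1
    filter_upwards [h1, Lp.coeFn_zero ℂ 2 (volume : Measure (UnitAddTorus (Fin d)))] with y h1 h2
    rw [h2] at h1; exact h1.symm
  have h3 : ∀ᵐ x ∂(Measure.map (toCell (d := d)) volume), g x = 0 := by
    have hs : AEStronglyMeasurable g (Measure.map (toCell (d := d)) volume) := by
      rw [map_toCell]; exact hg.1.smul_measure _
    have e := hs.ae_eq_mk
    have h4 : ∀ᵐ y : UnitAddTorus (Fin d), hs.mk g (toCell y) = 0 := by
      filter_upwards [hae, ae_of_ae_map measurable_toCell.aemeasurable e] with y h1 h2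
      rw [← h2, h1]
    have h5 : ∀ᵐ x ∂(Measure.map (toCell (d := d)) volume), hs.mk g x = 0 :=
      (ae_map_iff measurable_toCell.aemeasurable
        (hs.stronglyMeasurable_mk.measurable (measurableSet_singleton 0))).2 h4
    filter_upwards [e, h5] with x h1 h2
    rw [h1, h2]
  rw [map_toCell] at h3
  exact (Measure.ae_ennreal_smul_measure_iff (by simp)).1 h3

end Torus

end SpectralScheme
end

noncomputable section

namespace SpectralScheme

open MeasureTheory

variable {d n : ℕ} {σ : EuclideanSpace ℝ (Fin d) → ℝ}

/-! ### Periodic fields and their Fourier coefficients -/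

lemma apply_add_of_periodic {α : Type*} {u : (Fin d → ℝ) → α}
    (hu : ∀ j x, u (x + Pi.single j (2 * Real.pi)) = u x) (m : Fin d → ℤ) (x : Fin d → ℝ) :
    u (x + fun j => (m j : ℝ) * (2 * Real.pi)) = u x := by
  have key : ∀ s : Finset (Fin d), Function.Periodic u
      (∑ j ∈ s, m j • (Pi.single j (2 * Real.pi) : Fin d → ℝ)) := by
    intro s
    induction s using Finset.induction_on with
    | empty => simp [Function.Periodic]
    | insert j s hj ih =>
      rw [Finset.sum_insert hj]
      exact Function.Periodic.add_period (Function.Periodic.zsmul (hu j) (m j)) ih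
  have e : (fun j => (m j : ℝ) * (2 * Real.pi)) =
      ∑ j, m j • (Pi.single j (2 * Real.pi) : Fin d → ℝ) := by
    ext i
    simp [Finset.sum_apply, Pi.single_apply]
  rw [e]
  exact key Finset.univ x

/-- Every point is congruent to a point of the period cell. -/
lemma exists_add_mem_cell (x : Fin d → ℝ) :
    ∃ m : Fin d → ℤ, (x + fun j => (m j : ℝ) * (2 * Real.pi)) ∈ cell d := by
  have h : ∀ j, ∃ m : ℤ, x j + m • (2 * Real.pi) ∈ Set.Ioc 0 (0 + 2 * Real.pi) := fun j =>
    (existsUnique_add_zsmul_mem_Ioc (by positivity) _ _).exists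
  choose m hm using h
  refine ⟨m, fun j _ => ?_⟩
  simpa using hm j

lemma ae_of_ae_cell {p : (Fin d → ℝ) → Prop}
    (hp : ∀ x (m : Fin d → ℤ), p (x + fun j => (m j : ℝ) * (2 * Real.pi)) → p x)
    (h : ∀ᵐ x ∂volume.restrict (cell d), p x) : ∀ᵐ x, p x := by
  have hc : MeasurableSet (cell d) := MeasurableSet.univ_pi fun _ => measurableSet_Ioc
  rw [ae_restrict_iff' hc, ae_iff] at h
  rw [ae_iff]
  refine measure_mono_null (t := ⋃ m : Fin d → ℤ, (fun x => x + fun j => (m j : ℝ) * (2 * Real.pi)) ⁻¹'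
    {x | ¬(x ∈ cell d → p x)}) ?_ (measure_iUnion_null fun m => ?_)
  · intro x hx
    obtain ⟨m, hm⟩ := exists_add_mem_cell x
    refine Set.mem_iUnion.2 ⟨m, ?_⟩
    intro h'
    exact hx (hp x m (h' hm))
  · rw [measure_preimage_add_right]; exact h

lemma measure_cell_lt_top : volume (cell d) < ⊤ := by
  have hsub : cell d ⊆ Set.Icc 0 (fun _ => 2 * Real.pi) := fun x hx =>
    ⟨fun j => (hx j trivial).1.le, fun j => (hx j trivial).2⟩
  exact (measure_mono hsub).trans_lt isCompact_Icc.measure_lt_top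

lemma memLp_cell_of_continuous {E : Type*} [NormedAddCommGroup E] [SecondCountableTopology E]
    {f : (Fin d → ℝ) → E} (hf : Continuous f) : MemLp f 2 (volume.restrict (cell d)) := by
  have : IsFiniteMeasure (volume.restrict (cell d)) :=
    ⟨by rw [Measure.restrict_apply_univ]; exact measure_cell_lt_top⟩
  have hsub : cell d ⊆ Set.Icc 0 (fun _ => 2 * Real.pi) := fun x hx =>
    ⟨fun j => (hx j trivial).1.le, fun j => (hx j trivial).2⟩
  obtain ⟨C, hC⟩ := (isCompact_Icc (a := (0 : Fin d → ℝ))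
    (b := fun _ => 2 * Real.pi)).exists_bound_of_continuousOn hf.continuousOn
  refine MemLp.of_bound hf.aestronglyMeasurable C ?_
  exact (ae_restrict_iff' (MeasurableSet.univ_pi fun _ => measurableSet_Ioc)).2
    (.of_forall fun x hx => hC x (hsub hx))

lemma fourierCoef_eq (u : Field d n) (k : Fin d → ℤ) (i : Fin n) :
    fourierCoef u k i = (((2 * Real.pi) ^ d : ℝ) : ℂ)⁻¹ * ∫ x in cell d, wave (-k) x * (u x i : ℂ) := by
  rw [fourierCoef]
  congr 2
  ext x
  rw [wave, phase_neg]
  simp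

lemma fourierCoef_neg (u : Field d n) (k : Fin d → ℤ) (i : Fin n) :
    fourierCoef u (-k) i = (starRingEnd ℂ) (fourierCoef u k i) := by
  rw [fourierCoef_eq, fourierCoef_eq, map_mul, ← integral_conj, map_inv₀, Complex.conj_ofReal]
  congr 2
  ext x
  rw [map_mul, ← wave_neg, Complex.conj_ofReal]

lemma integral_wave_mul_ev (k : Fin d → ℤ) (a : TrigPoly d) :
    ∫ x in cell d, wave (-k) x * ev x a = (((2 * Real.pi) ^ d : ℝ) : ℂ) * a.coeff k := by
  have h := mean_eq_integral (AddMonoidAlgebra.single (-k) 1 * a)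
  have h0 : (((2 * Real.pi) ^ d : ℝ) : ℂ) ≠ 0 := by exact_mod_cast (volume_cell_pos (d := d)).ne'
  rw [mean_apply, coeff_single_mul] at h
  simp only [map_mul, ev_single, one_mul, sub_neg_eq_add, zero_add] at h
  rw [h, ← mul_assoc, mul_inv_cancel₀ h0, one_mul]

lemma fourierCoef_synth {U : Fin n → TrigPoly d} (hU : ∀ i, IsRealPoly (U i)) (k : Fin d → ℤ)
    (i : Fin n) : fourierCoef (synth U) k i = (U i).coeff k := by
  have h0 : (((2 * Real.pi) ^ d : ℝ) : ℂ) ≠ 0 := by exact_mod_cast (volume_cell_pos (d := d)).ne'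
  rw [fourierCoef_eq]
  have e : ∀ x, ((synth U x i : ℝ) : ℂ) = ev x (U i) := fun x => ((hU i).ev_eq x).symm
  simp_rw [e]
  rw [integral_wave_mul_ev, ← mul_assoc, inv_mul_cancel₀ h0, one_mul]

lemma wave_periodic (k : Fin d → ℤ) (j : Fin d) (x : Fin d → ℝ) :
    wave k (x + Pi.single j (2 * Real.pi)) = wave k x := by
  have e : phase k (x + Pi.single j (2 * Real.pi)) = phase k x + k j * (2 * Real.pi) := by
    simp [phase, mul_add, Finset.sum_add_distrib, Pi.single_apply]
  rw [wave, e, wave, Complex.exp_eq_exp_iff_exists_int]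
  exact ⟨k j, by push_cast; ring⟩

lemma isPeriodic_synth (U : Fin n → TrigPoly d) : IsPeriodic (synth U) := by
  intro j x
  ext i
  simp only [synth, fun x => ev_eq_sum x (a := U i) subset_rfl, wave_periodic]

lemma continuous_synth (U : Fin n → TrigPoly d) : Continuous (synth U) :=
  continuous_pi fun i => Complex.continuous_re.comp (continuous_ev (U i))

lemma synth_sub (U V : Fin n → TrigPoly d) : synth (U - V) = synth U - synth V := by
  ext x i; simp [synth]

lemma synth_smul (r : ℝ) (U : Fin n → TrigPoly d) : synth (r • U) = r • synth U := by
  ext x i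
  have e : r • U i = (r : ℂ) • U i := by ext k; simp
  simp only [synth, Pi.smul_apply, e, map_smul, smul_eq_mul, Complex.re_ofReal_mul]

/-- Continuous periodic fields are determined by their Fourier coefficients. -/
lemma eq_of_fourierCoef_eq {u v : Field d n} (hu : Continuous u) (hv : Continuous v)
    (hup : IsPeriodic u) (hvp : IsPeriodic v) (h : ∀ k i, fourierCoef u k i = fourierCoef v k i) :
    u = v := by
  have h0 : (((2 * Real.pi) ^ d : ℝ) : ℂ)⁻¹ ≠ 0 :=
    inv_ne_zero (by exact_mod_cast (volume_cell_pos (d := d)).ne')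
  have hi : ∀ i, ∀ᵐ x ∂volume.restrict (cell d), u x i = v x i := by
    intro i
    have hui : Continuous fun x => (u x i : ℂ) :=
      Complex.continuous_ofReal.comp ((continuous_apply i).comp hu)
    have hvi : Continuous fun x => (v x i : ℂ) :=
      Complex.continuous_ofReal.comp ((continuous_apply i).comp hv)
    have := ae_eq_zero_of_integral_wave_eq_zero (g := fun x => (u x i : ℂ) - v x i)
      (memLp_cell_of_continuous (hui.sub hvi)) fun k => by
        have hk := h k i
        rw [fourierCoef_eq, fourierCoef_eq] at hk
        simp_rw [mul_sub]
        refine (integral_sub ((continuous_wave _).mul hui).integrableOn_cell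
          ((continuous_wave _).mul hvi).integrableOn_cell).trans ?_
        exact sub_eq_zero.2 (mul_left_cancel₀ h0 hk)
    filter_upwards [this] with x hx
    exact_mod_cast sub_eq_zero.1 hx
  have hae : ∀ᵐ x, u x = v x := by
    refine ae_of_ae_cell (fun x m hx => by rwa [apply_add_of_periodic hup, apply_add_of_periodic hvp] at hx) ?_
    filter_upwards [ae_all_iff.2 hi] with x hx
    exact funext hx
  exact Continuous.ext_on (Measure.dense_of_ae hae) hu hv fun x hx => hx

/-! ### Sobolev norms and truncations -/

lemma one_add_sum_sq_rpow (k : Fin d → ℤ) (r : ℝ) :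
    (1 + ∑ j, (k j : ℝ) ^ 2) ^ r = (jap k ^ r) ^ 2 := by
  rw [← nrm_sq, ← jap_sq, ← Real.rpow_natCast, ← Real.rpow_natCast, ← Real.rpow_mul (jap_pos k).le,
    ← Real.rpow_mul (jap_pos k).le, mul_comm]

lemma hsTerm_nonneg (r : ℝ) (u : Field d n) (k : Fin d → ℤ) : 0 ≤ hsTerm r u k :=
  mul_nonneg (Real.rpow_nonneg (by positivity) _) (Finset.sum_nonneg fun _ _ => by positivity)

lemma hsTerm_synth {U : Fin n → TrigPoly d} (hU : ∀ i, IsRealPoly (U i)) (r : ℝ) (k : Fin d → ℤ) :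
    hsTerm r (synth U) k = ∑ i, ‖(wmul (fun k => jap k ^ r) (U i)).coeff k‖ ^ 2 := by
  rw [hsTerm, one_add_sum_sq_rpow, Finset.mul_sum]
  refine Finset.sum_congr rfl fun i _ => ?_
  rw [norm_coeff_wmul (fun k => Real.rpow_nonneg (jap_pos k).le r), fourierCoef_synth hU, mul_pow]

lemma summable_hsTerm_synth {U : Fin n → TrigPoly d} (hU : ∀ i, IsRealPoly (U i)) (r : ℝ) :
    Summable (hsTerm r (synth U)) := by
  simp_rw [funext (hsTerm_synth hU r)]
  exact summable_sum fun i _ => summable_norm_coeff_sq _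

lemma memHs_synth {U : Fin n → TrigPoly d} (hU : ∀ i, IsRealPoly (U i)) (r : ℝ) :
    MemHs r (synth U) :=
  ⟨isPeriodic_synth U, memLp_cell_of_continuous (continuous_synth U), summable_hsTerm_synth hU r⟩

lemma hsNorm_synth {U : Fin n → TrigPoly d} (hU : ∀ i, IsRealPoly (U i)) (r : ℝ) :
    hsNorm r (synth U) = hsN r U := by
  rw [hsNorm, hsN]
  congr 1
  simp_rw [funext (hsTerm_synth hU r), n2_sq]
  exact Summable.tsum_finsetSum fun i _ => summable_norm_coeff_sq _

/-- The frequencies `{-N, …, N}^d`. -/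
def box (d N : ℕ) : Finset (Fin d → ℤ) := Fintype.piFinset fun _ => Finset.Icc (-(N : ℤ)) N

lemma mem_box {N : ℕ} {k : Fin d → ℤ} : k ∈ box d N ↔ ∀ j, |k j| ≤ (N : ℤ) := by
  simp [box, abs_le]

lemma neg_mem_box {N : ℕ} {k : Fin d → ℤ} : -k ∈ box d N ↔ k ∈ box d N := by
  simp [mem_box]

/-- The trigonometric polynomial with coefficients `c k`, `k ∈ s`. -/
def trunc (s : Finset (Fin d → ℤ)) (c : (Fin d → ℤ) → ℂ) : TrigPoly d :=
  ∑ k ∈ s, AddMonoidAlgebra.single k (c k)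

open Classical in
lemma coeff_trunc (s : Finset (Fin d → ℤ)) (c : (Fin d → ℤ) → ℂ) (k : Fin d → ℤ) :
    (trunc s c).coeff k = if k ∈ s then c k else 0 := by
  have : ∀ t : Finset (Fin d → ℤ), (trunc t c).coeff k = ∑ l ∈ t, if l = k then c l else 0 := by
    intro t
    induction t using Finset.induction_on with
    | empty => simp [trunc]
    | insert l t hl ih =>
      rw [trunc, Finset.sum_insert hl, Finset.sum_insert hl, ← ih]
      by_cases h : l = k
      · subst h; simp [trunc]
      · simp [trunc, h]
  rw [this]
  simp

lemma coeff_trunc_of_mem {s : Finset (Fin d → ℤ)} {c : (Fin d → ℤ) → ℂ} {k : Fin d → ℤ}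
    (h : k ∈ s) : (trunc s c).coeff k = c k := by
  classical rw [coeff_trunc, if_pos h]

lemma coeff_trunc_of_notMem {s : Finset (Fin d → ℤ)} {c : (Fin d → ℤ) → ℂ} {k : Fin d → ℤ}
    (h : k ∉ s) : (trunc s c).coeff k = 0 := by
  classical rw [coeff_trunc, if_neg h]

lemma support_trunc_subset (s : Finset (Fin d → ℤ)) (c : (Fin d → ℤ) → ℂ) :
    (trunc s c).coeff.support ⊆ s := fun k hk => by
  by_contra h
  exact (Finsupp.mem_support_iff.1 hk) (coeff_trunc_of_notMem h)

lemma ev_trunc (s : Finset (Fin d → ℤ)) (c : (Fin d → ℤ) → ℂ) (x : Fin d → ℝ) :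
    ev x (trunc s c) = ∑ k ∈ s, c k * wave k x := by
  simp [trunc, ev_single]

/-- The Fourier truncation of a field to the frequencies `{-N, …, N}^d`. -/
def proj (N : ℕ) (u : Field d n) : Fin n → TrigPoly d := fun i =>
  trunc (box d N) fun k => fourierCoef u k i

lemma isRealPoly_proj (N : ℕ) (u : Field d n) (i : Fin n) : IsRealPoly (proj N u i) := by
  rw [isRealPoly_iff]
  intro k
  by_cases h : k ∈ box d N
  · rw [proj, coeff_trunc_of_mem h, coeff_trunc_of_mem (neg_mem_box.2 h), fourierCoef_neg]
  · rw [proj, coeff_trunc_of_notMem h, coeff_trunc_of_notMem (fun h' => h (neg_mem_box.1 h')),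
      map_zero]

lemma sharpFilter_eq (N : ℕ) (u : Field d n) : sharpFilter N u = synth (proj N u) := by
  classical
  ext x i
  rw [sharpFilter, multiplier, synth, proj, ev_trunc]
  congr 1
  rw [tsum_eq_sum (s := box d N)]
  · refine Finset.sum_congr rfl fun k hk => ?_
    rw [if_pos (mem_box.1 hk), wave]; simp
  · intro k hk
    rw [if_neg (fun h => hk (mem_box.2 h))]; simp

lemma hsN_proj_le {r : ℝ} {u : Field d n} (hu : MemHs r u) (N : ℕ) :
    hsN r (proj N u) ≤ hsNorm r u := by
  rw [hsN, hsNorm]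
  refine Real.sqrt_le_sqrt ?_
  have e : ∀ i, n2 (wmul (fun k => jap k ^ r) (proj N u i)) ^ 2 =
      ∑ k ∈ box d N, ‖(wmul (fun k => jap k ^ r) (proj N u i)).coeff k‖ ^ 2 := fun i =>
    n2_sq_eq_sum ((support_mult_subset _ _).trans (support_trunc_subset _ _))
  simp_rw [e]
  rw [Finset.sum_comm]
  refine le_trans (le_of_eq ?_) (hu.2.2.sum_le_tsum (box d N) fun k _ => hsTerm_nonneg r u k)
  refine Finset.sum_congr rfl fun k hk => ?_
  rw [hsTerm, one_add_sum_sq_rpow, Finset.mul_sum]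
  refine Finset.sum_congr rfl fun i _ => ?_
  rw [norm_coeff_wmul (fun k => Real.rpow_nonneg (jap_pos k).le r), proj, coeff_trunc_of_mem hk,
    mul_pow]

end SpectralScheme
end

noncomputable section

namespace SpectralScheme

open MeasureTheory

variable {d n : ℕ} {σ : EuclideanSpace ℝ (Fin d) → ℝ}

/-! ### Uniform convergence of the Fourier truncations -/

lemma natCast_le_jap_of_notMem_box {N : ℕ} {k : Fin d → ℤ} (hk : k ∉ box d N) : (N : ℝ) ≤ jap k := by
  rw [mem_box] at hk
  push Not at hk
  obtain ⟨j, hj⟩ := hk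
  have h1 : (N : ℝ) ≤ |(k j : ℝ)| := by
    rw [← Int.cast_abs]; exact_mod_cast hj.le
  exact h1.trans ((abs_apply_le_nrm k j).trans (nrm_le_jap k))

/-- A field of `H^s`, `s > d/2 + 1`, is almost everywhere the limit of its Fourier truncations, and
the error is controlled by the `H^s` norm. -/
lemma exists_proj_sub_le (n : ℕ) {s : ℝ} (hs : (d : ℝ) / 2 + 1 < s) :
    ∃ C, 0 ≤ C ∧ ∀ N : ℕ, 1 ≤ N → ∀ u : Field d n, MemHs s u → ∀ᵐ x, ∀ i,
      |synth (proj N u) x i - u x i| ≤ C * hsNorm s u / N := by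
  obtain ⟨C, hC, hSob⟩ := exists_norm_wmul_jap_le hs
  refine ⟨C, hC, fun N hN u hu => ae_all_iff.2 fun i => ?_⟩
  have hN0 : (0 : ℝ) < N := by exact_mod_cast hN
  set c : (Fin d → ℤ) → ℂ := fun k => fourierCoef u k i with hc
  have hfin : ∀ F : Finset (Fin d → ℤ), ∑ k ∈ F, jap k * ‖c k‖ ≤ C * hsNorm s u := by
    intro F
    have h1 := hSob (trunc F c)
    have e1 : ‖wmul jap (trunc F c)‖ = ∑ k ∈ F, jap k * ‖c k‖ := by
      rw [norm_eq_sum ((support_mult_subset _ _).trans (support_trunc_subset F c))]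
      refine Finset.sum_congr rfl fun k hk => ?_
      rw [norm_coeff_wmul fun k => (jap_pos k).le, coeff_trunc_of_mem hk]
    rw [← e1]
    refine h1.trans (mul_le_mul_of_nonneg_left ?_ hC)
    rw [hsNorm]
    refine Real.le_sqrt_of_sq_le ?_
    rw [n2_sq_eq_sum ((support_mult_subset _ _).trans (support_trunc_subset F c))]
    refine le_trans (Finset.sum_le_sum fun k hk => ?_) (hu.2.2.sum_le_tsum F fun k _ => hsTerm_nonneg s u k)
    rw [norm_coeff_wmul (fun k => Real.rpow_nonneg (jap_pos k).le s), coeff_trunc_of_mem hk, hsTerm,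
      mul_pow, one_add_sum_sq_rpow]
    exact mul_le_mul_of_nonneg_left (Finset.single_le_sum
      (f := fun i => ‖fourierCoef u k i‖ ^ 2) (fun _ _ => by positivity) (Finset.mem_univ i))
      (by positivity)
  have hsumj : Summable fun k => jap k * ‖c k‖ :=
    summable_of_sum_le (fun k => mul_nonneg (jap_pos k).le (norm_nonneg _)) hfin
  have hle : ∀ k, ‖c k‖ ≤ jap k * ‖c k‖ := fun k =>
    le_mul_of_one_le_left (norm_nonneg _) (one_le_jap k)
  have hsum : Summable fun k => ‖c k‖ := hsumj.of_nonneg_of_le (fun _ => norm_nonneg _) hle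
  have htsum : ∑' k, jap k * ‖c k‖ ≤ C * hsNorm s u :=
    hsumj.tsum_le_of_sum_le hfin
  have hnw : ∀ k (x : Fin d → ℝ), ‖c k * wave k x‖ = ‖c k‖ := fun k x => by
    rw [norm_mul, norm_wave, mul_one]
  have hsw : ∀ x : Fin d → ℝ, Summable fun k => c k * wave k x := fun x =>
    .of_norm (by simpa only [hnw] using hsum)
  set g : (Fin d → ℝ) → ℂ := fun x => ∑' k, c k * wave k x with hg
  have hgc : Continuous g := continuous_tsum (fun k => continuous_const.mul (continuous_wave k)) hsum
    fun k x => (hnw k x).le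
  have h0 : (((2 * Real.pi) ^ d : ℝ) : ℂ) ≠ 0 := by exact_mod_cast (volume_cell_pos (d := d)).ne'
  have hgi : ∀ l : Fin d → ℤ, ∫ x in cell d, wave (-l) x * g x =
      (((2 * Real.pi) ^ d : ℝ) : ℂ) * c l := by
    intro l
    have hF : ∀ k, Integrable (fun x => c k * wave (k - l) x) (volume.restrict (cell d)) := fun k =>
      (continuous_const.mul (continuous_wave _)).integrableOn_cell
    have := hasSum_integral_of_summable_integral_norm hF (by
      simp only [norm_mul, norm_wave, mul_one, integral_const, smul_eq_mul]
      exact hsum.mul_left _)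
    have e : ∀ x, ∑' k, c k * wave (k - l) x = wave (-l) x * g x := fun x => by
      rw [hg, ← tsum_mul_left]
      refine tsum_congr fun k => ?_
      rw [sub_eq_add_neg, wave_add]; ring
    simp_rw [e, integral_const_mul, integral_wave] at this
    refine this.unique ?_
    have h1 := hasSum_single (f := fun k => c k * if k - l = 0 then (((2 * Real.pi) ^ d : ℝ) : ℂ)
      else 0) l (fun k hk => by rw [if_neg (sub_ne_zero.2 hk), mul_zero])
    simpa [mul_comm] using h1
  have hui : MemLp (fun x => (u x i : ℂ)) 2 (volume.restrict (cell d)) := (hu.2.1.eval i).ofReal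
  have hfin' : IsFiniteMeasure (volume.restrict (cell d)) :=
    ⟨by rw [Measure.restrict_apply_univ]; exact measure_cell_lt_top⟩
  have hcell : ∀ᵐ x ∂volume.restrict (cell d), (u x i : ℂ) - g x = 0 := by
    refine ae_eq_zero_of_integral_wave_eq_zero (hui.sub (memLp_cell_of_continuous hgc)) fun k => ?_
    have hint : Integrable (fun x => wave (-k) x * (u x i : ℂ)) (volume.restrict (cell d)) :=
      (hui.integrable one_le_two).bdd_mul (c := 1) (continuous_wave _).aestronglyMeasurable
        (.of_forall fun x => (norm_wave _ x).le)
    have e : ∫ x in cell d, wave (-k) x * (u x i : ℂ) = (((2 * Real.pi) ^ d : ℝ) : ℂ) * c k := by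
      rw [hc]; simp only
      rw [fourierCoef_eq, ← mul_assoc, mul_inv_cancel₀ h0, one_mul]
    simp_rw [mul_sub]
    refine (integral_sub hint ((continuous_wave _).mul hgc).integrableOn_cell).trans ?_
    rw [e]
    exact sub_eq_zero.2 (hgi k).symm
  have hae : ∀ᵐ x, (u x i : ℂ) - g x = 0 := by
    refine ae_of_ae_cell (fun x m hx => ?_) hcell
    simpa only [apply_add_of_periodic hu.1, hg,
      fun k => apply_add_of_periodic (wave_periodic k)] using hx
  classical
  filter_upwards [hae] with x hx
  have hx' : (u x i : ℂ) = g x := sub_eq_zero.1 hx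
  have e1 : ev x (proj N u i) - g x = -∑' k, if k ∈ box d N then 0 else c k * wave k x := by
    have hd : HasSum (fun k => if k ∈ box d N then c k * wave k x else 0)
        (∑ k ∈ box d N, c k * wave k x) := by
      have := hasSum_sum_of_ne_finset_zero (L := .unconditional _) (f := fun k => if k ∈ box d N then c k * wave k x else 0)
        (s := box d N) (fun k hk => if_neg hk)
      rwa [Finset.sum_congr rfl fun k hk => if_pos hk] at this
    have h2 := ((hsw x).hasSum.sub hd).tsum_eq
    have e2 : ∀ k, (c k * wave k x - if k ∈ box d N then c k * wave k x else 0) =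
        if k ∈ box d N then 0 else c k * wave k x := fun k => by split_ifs <;> simp
    simp_rw [e2] at h2
    rw [h2, proj, ev_trunc]; ring
  have e3 : synth (proj N u) x i - u x i = (ev x (proj N u i) - g x).re := by
    rw [← hx', Complex.sub_re, Complex.ofReal_re]; rfl
  rw [e3]
  refine (Complex.abs_re_le_norm _).trans ?_
  rw [e1, norm_neg]
  refine (tsum_of_norm_bounded (hsumj.hasSum.mul_left (1 / (N : ℝ))) fun k => ?_).trans ?_
  · split_ifs with h
    · rw [norm_zero]; have := (jap_pos k).le; positivity
    · rw [hnw, ← mul_assoc]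
      refine le_mul_of_one_le_left (norm_nonneg _) ?_
      rw [one_div, ← div_eq_inv_mul, le_div_iff₀ hN0, one_mul]
      exact natCast_le_jap_of_notMem_box h
  · rw [one_div, ← div_eq_inv_mul]
    exact div_le_div_of_nonneg_right htsum hN0.le

/-- If a field takes its values in `K`, its Fourier truncations take their values near `K`. -/
lemma exists_synth_proj_mem_cthickening (n : ℕ) {s : ℝ} (hs : (d : ℝ) / 2 + 1 < s) :
    ∃ C, 0 ≤ C ∧ ∀ N : ℕ, 1 ≤ N → ∀ u : Field d n, MemHs s u → ∀ K : Set (Fin n → ℝ),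
      (∀ᵐ x, u x ∈ K) → ∀ x, synth (proj N u) x ∈ Metric.cthickening (C * hsNorm s u / N) K := by
  obtain ⟨C, hC, h⟩ := exists_proj_sub_le (d := d) n hs
  refine ⟨C, hC, fun N hN u hu K hK => ?_⟩
  have hr : 0 ≤ C * hsNorm s u / N := by
    have := Real.sqrt_nonneg (∑' k, hsTerm s u k)
    rw [hsNorm]; positivity
  have hae : ∀ᵐ x, synth (proj N u) x ∈ Metric.cthickening (C * hsNorm s u / N) K := by
    filter_upwards [h N hN u hu, hK] with x hx hxK
    exact Metric.mem_cthickening_of_dist_le _ _ _ _ hxK ((dist_pi_le_iff hr).2 hx)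
  have hcl : IsClosed {x | synth (proj N u) x ∈ Metric.cthickening (C * hsNorm s u / N) K} :=
    Metric.isClosed_cthickening.preimage (continuous_synth _)
  have hd := Measure.dense_of_ae hae
  intro x
  have : x ∈ closure {x | synth (proj N u) x ∈ Metric.cthickening (C * hsNorm s u / N) K} := hd x
  rwa [hcl.closure_eq] at this

end SpectralScheme
end

noncomputable section

namespace SpectralScheme

open MeasureTheory

variable {d n : ℕ} {σ : EuclideanSpace ℝ (Fin d) → ℝ}

/-! ### The two schemes on trigonometric polynomials -/

lemma multiplier_synth (m : (Fin d → ℤ) → ℝ) {W : Fin n → TrigPoly d} (hW : ∀ i, IsRealPoly (W i)) :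
    multiplier m (synth W) = synth fun i => wmul m (W i) := by
  ext x i
  rw [multiplier, synth, ev_eq_sum x (support_mult_subset _ (W i))]
  congr 1
  rw [tsum_eq_sum (s := (W i).coeff.support)]
  · refine Finset.sum_congr rfl fun k _ => ?_
    rw [fourierCoef_synth hW, coeff_mult, wave]
  · intro k hk
    rw [fourierCoef_synth hW, Finsupp.notMem_support_iff.1 hk]; simp

lemma smoothFilter_synth (hσ : IsLowPassProfile σ) (N : ℕ) {W : Fin n → TrigPoly d}
    (hW : ∀ i, IsRealPoly (W i)) :
    smoothFilter σ N (synth W) = synth fun i => filt σ N 2 (W i) := by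
  rw [smoothFilter, multiplier_synth _ hW]
  simp_rw [← lam_sq hσ]

lemma contDiff_wave (k : Fin d → ℤ) : ContDiff ℝ 1 (wave k) := by
  have h : ContDiff ℝ 1 fun x : Fin d → ℝ => ((phase k x : ℝ) : ℂ) := by
    have h0 : ContDiff ℝ 1 fun x : Fin d → ℝ => ∑ j, (k j : ℝ) * x j :=
      ContDiff.sum fun j _ => contDiff_const.mul (contDiff_apply ℝ ℝ j)
    exact Complex.ofRealCLM.contDiff.comp h0
  unfold wave
  exact (contDiff_const.mul h).cexp

lemma hasFDerivAt_phase (k : Fin d → ℤ) (x : Fin d → ℝ) :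
    HasFDerivAt (phase k) (∑ j, (k j : ℝ) • ContinuousLinearMap.proj (R := ℝ) (φ := fun _ => ℝ) j) x := by
  unfold phase
  exact HasFDerivAt.fun_sum fun j _ => (hasFDerivAt_apply j x).const_mul _

lemma fderiv_wave (k : Fin d → ℤ) (x : Fin d → ℝ) (j : Fin d) :
    fderiv ℝ (wave k) x (Pi.single j 1) = Complex.I * (k j : ℂ) * wave k x := by
  have h := ((Complex.ofRealCLM.hasFDerivAt.comp x (hasFDerivAt_phase k x)).const_mul Complex.I).cexp
  have e : wave k = fun x => Complex.exp (Complex.I * (Complex.ofRealCLM ∘ phase k) x) := rfl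
  rw [e, h.fderiv]
  simp [Pi.single_apply]
  ring

lemma contDiff_ev (a : TrigPoly d) : ContDiff ℝ 1 fun x => ev x a := by
  simp_rw [fun x => ev_eq_sum x (a := a) subset_rfl]
  exact ContDiff.sum fun k _ => contDiff_const.mul (contDiff_wave k)

lemma fderiv_ev (a : TrigPoly d) (x : Fin d → ℝ) (j : Fin d) :
    fderiv ℝ (fun x => ev x a) x (Pi.single j 1) = ev x (dX j a) := by
  simp_rw [fun x => ev_eq_sum x (a := a) subset_rfl]
  have hd : ∀ k, DifferentiableAt ℝ (wave k) x := fun k =>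
    (contDiff_wave k).differentiable one_ne_zero x
  rw [fderiv_fun_sum fun k _ => (hd k).const_mul _, dX, ev_eq_sum x (support_mult_subset _ a)]
  simp only [_root_.sum_apply]
  refine Finset.sum_congr rfl fun k _ => ?_
  rw [fderiv_const_mul (hd k), coeff_mult]
  simp only [_root_.smul_apply, fderiv_wave, smul_eq_mul]
  ring

lemma differentiable_synth (U : Fin n → TrigPoly d) : Differentiable ℝ (synth U) := fun x =>
  differentiableAt_pi.2 fun i => Complex.reCLM.differentiableAt.comp x
    ((contDiff_ev (U i)).differentiable one_ne_zero x)

lemma fderiv_apply_apply {u : Field d n} {x : Fin d → ℝ} (hu : DifferentiableAt ℝ u x)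
    (v : Fin d → ℝ) (i : Fin n) : fderiv ℝ u x v i = fderiv ℝ (fun x => u x i) x v := by
  rw [fderiv_pi (fun i => differentiableAt_pi.1 hu i)]
  rfl

lemma partialDeriv_synth (j : Fin d) (U : Fin n → TrigPoly d) :
    partialDeriv j (synth U) = synth fun i => dX j (U i) := by
  ext x i
  rw [partialDeriv, fderiv_apply_apply (differentiable_synth U x), synth, ← fderiv_ev]
  have h := Complex.reCLM.hasFDerivAt.comp x
    ((contDiff_ev (U i)).differentiable one_ne_zero x).hasFDerivAt
  have e : (fun x => synth U x i) = Complex.reCLM ∘ fun x => ev x (U i) := rfl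
  rw [e, h.fderiv]; rfl

/-- `∑_j B_j(U) ∂_j U` on trigonometric polynomials. -/
def transport (B : Fin d → Fin n → Fin n → MvPolynomial (Fin n) ℝ) (U : Fin n → TrigPoly d) :
    Fin n → TrigPoly d := fun i => ∑ j, ∑ l, comp (B j i l) U * dX j (U l)

lemma isRealPoly_transport (B : Fin d → Fin n → Fin n → MvPolynomial (Fin n) ℝ)
    {U : Fin n → TrigPoly d} (hU : ∀ i, IsRealPoly (U i)) (i : Fin n) :
    IsRealPoly (transport B U i) :=
  .sum fun j _ => .sum fun l _ => (IsRealPoly.comp _ hU).mul ((hU l).dX j)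

lemma synth_transport (B : Fin d → Fin n → Fin n → MvPolynomial (Fin n) ℝ)
    {U : Fin n → TrigPoly d} (hU : ∀ i, IsRealPoly (U i)) (x : Fin d → ℝ) (i : Fin n) :
    synth (transport B U) x i =
      ∑ j, ∑ l, MvPolynomial.eval (synth U x) (B j i l) * partialDeriv j (synth U) x l := by
  simp only [synth, transport, map_sum, map_mul, Complex.re_sum]
  refine Finset.sum_congr rfl fun j _ => Finset.sum_congr rfl fun l _ => ?_
  rw [ev_comp _ hU, Complex.re_ofReal_mul, partialDeriv_synth]
  rfl

lemma polyOp_eq (N : ℕ) (A : Fin 2 → Fin d → Fin n → Fin n → MvPolynomial (Fin n) ℝ)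
    (U : Fin n → TrigPoly d) (i : Fin n) :
    polyOp σ N A U i = transport (A 0) U i + filt σ N 2 (transport (A 1) U i) := by
  have e : ∀ a : TrigPoly d, filt σ N (2 * ((0 : Fin 2) : ℕ)) a = a := fun a => by ext k; simp
  simp only [polyOp, opF, Fin.sum_univ_two, transport, e, map_sum]
  rfl

/-- On real trigonometric polynomials, the spatial operator `F` of a scheme acts as `polyOp`. -/
def Represents (F : Field d n → Field d n) (σ : EuclideanSpace ℝ (Fin d) → ℝ) (N : ℕ)
    (A : Fin 2 → Fin d → Fin n → Fin n → MvPolynomial (Fin n) ℝ) : Prop :=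
  ∀ U : Fin n → TrigPoly d, (∀ i, IsRealPoly (U i)) → F (synth U) = synth (polyOp σ N A U)

lemma represents_filteredOp (hσ : IsLowPassProfile σ) (A : Fin d → PolyMatrix n) (N : ℕ) :
    Represents (filteredOp A σ N) σ N (coefA A) := by
  intro U hU
  have e : (fun x => ∑ j, ((A j).evalAt (synth U x)).mulVec (partialDeriv j (synth U) x)) =
      synth (transport (fun j i l => A j i l) U) := by
    ext x i
    rw [synth_transport _ hU, Finset.sum_apply]
    rfl
  rw [filteredOp, e, smoothFilter_synth hσ N (isRealPoly_transport _ hU)]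
  congr 1
  ext1 i
  rw [polyOp_eq]
  have e0 : transport (coefA A 0) U i = 0 := by
    simp [transport, coefA, comp]
  rw [e0, zero_add]
  rfl

lemma represents_linearUnfilteredOp (hσ : IsLowPassProfile σ) (A : Fin d → PolyMatrix n) (N : ℕ) :
    Represents (linearUnfilteredOp A σ N) σ N (coefA' A) := by
  intro U hU
  classical
  have e : ∀ j, (fun y => ((A j).evalAt (synth U y) - (A j).evalAt 0).mulVec
      (partialDeriv j (synth U) y)) =
      synth (transport (fun j' i l => if j' = j then coefA' A 1 j i l else 0) U) := by
    intro j
    ext x i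
    rw [synth_transport _ hU, Finset.sum_eq_single j]
    · simp [coefA', Matrix.mulVec, dotProduct, PolyMatrix.evalAt]
    · intro j' _ h; simp [h]
    · simp
  ext x i
  rw [linearUnfilteredOp, Finset.sum_apply]
  simp_rw [e, fun j => smoothFilter_synth hσ N (isRealPoly_transport
    (fun j' i l => if j' = j then coefA' A 1 j i l else 0) hU)]
  have key : ∀ i, transport (coefA' A 1) U i = ∑ j, transport
      (fun j' i l => if j' = j then coefA' A 1 j i l else 0) U i := by
    intro i
    simp only [transport]
    refine Finset.sum_congr rfl fun j _ => ?_
    rw [Finset.sum_eq_single j]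
    · simp
    · intro j' _ h; simp [h, comp]
    · simp
  have e1 : synth (polyOp σ N (coefA' A) U) x i = synth (transport (coefA' A 0) U) x i +
      ∑ j, synth (fun i => filt σ N 2 (transport
        (fun j' i l => if j' = j then coefA' A 1 j i l else 0) U i)) x i := by
    simp only [synth, polyOp_eq, map_add, Complex.add_re]
    congr 1
    rw [key i, map_sum, map_sum, Complex.re_sum]
  rw [e1, synth_transport _ hU, ← Finset.sum_add_distrib]
  refine Finset.sum_congr rfl fun j _ => ?_
  rw [Pi.add_apply]
  congr 1
  simp [coefA', Matrix.mulVec, dotProduct, PolyMatrix.evalAt]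

end SpectralScheme
end

noncomputable section

namespace SpectralScheme

open MeasureTheory

variable {d n : ℕ} {σ : EuclideanSpace ℝ (Fin d) → ℝ}

/-! ### The schemes as ordinary differential equations -/

lemma norm_conjT (a : TrigPoly d) : ‖conjT a‖ = ‖a‖ := by
  rw [norm_eq_tsum, norm_eq_tsum, ← (Equiv.neg (Fin d → ℤ)).tsum_eq]
  refine tsum_congr fun k => ?_
  rw [coeff_conjT, RCLike.norm_conj]
  simp

lemma conjT_smul (r : ℝ) (a : TrigPoly d) : conjT (r • a) = r • conjT a := by
  ext k
  rw [coeff_conjT, AddMonoidAlgebra.coeff_smul, AddMonoidAlgebra.coeff_smul, Finsupp.smul_apply,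
    Finsupp.smul_apply, coeff_conjT]
  simp

/-- The vectors of real trigonometric polynomials with frequencies in `{-N, …, N}^d`. -/
def boxSpace (d n N : ℕ) : Submodule ℝ (Fin n → TrigPoly d) where
  carrier := {U | ∀ i, IsRealPoly (U i) ∧ ∀ k ∉ box d N, (U i).coeff k = 0}
  add_mem' {U V} hU hV i := ⟨(hU i).1.add (hV i).1, fun k hk => by
    simp [(hU i).2 k hk, (hV i).2 k hk]⟩
  zero_mem' i := ⟨by simp [IsRealPoly], fun k _ => by simp⟩
  smul_mem' r U hU i := ⟨by
    have := (hU i).1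
    rw [IsRealPoly] at this ⊢
    rw [Pi.smul_apply, conjT_smul, this], fun k hk => by simp [(hU i).2 k hk]⟩

lemma isRealPoly_coe {N : ℕ} (U : boxSpace d n N) (i : Fin n) : IsRealPoly (U.1 i) := (U.2 i).1

lemma coeff_coe_eq_zero {N : ℕ} (U : boxSpace d n N) (i : Fin n) {k : Fin d → ℤ}
    (hk : k ∉ box d N) : (U.1 i).coeff k = 0 := (U.2 i).2 k hk

lemma support_coe_subset {N : ℕ} (U : boxSpace d n N) (i : Fin n) :
    (U.1 i).coeff.support ⊆ box d N := fun k hk => by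
  by_contra h
  exact (Finsupp.mem_support_iff.1 hk) (coeff_coe_eq_zero U i h)

lemma proj_mem_boxSpace (N : ℕ) (u : Field d n) : proj N u ∈ boxSpace d n N := fun i =>
  ⟨isRealPoly_proj N u i, fun _ hk => coeff_trunc_of_notMem hk⟩

instance (N : ℕ) : FiniteDimensional ℝ (boxSpace d n N) := by
  let φ : boxSpace d n N →ₗ[ℝ] (Fin n → box d N → ℂ) :=
    { toFun := fun U i k => (U.1 i).coeff k
      map_add' := fun U V => by ext i k; simp
      map_smul' := fun r U => by ext i k; simp }
  refine FiniteDimensional.of_injective φ fun U V h => Subtype.ext (funext fun i => ?_)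
  ext k
  by_cases hk : k ∈ box d N
  · exact congrFun (congrFun h i) ⟨k, hk⟩
  · rw [coeff_coe_eq_zero U i hk, coeff_coe_eq_zero V i hk]

open Classical in
/-- The indicator function of the box of frequencies. -/
def boxInd (N : ℕ) (k : Fin d → ℤ) : ℂ := if k ∈ box d N then 1 else 0

/-- A continuous retraction of the trigonometric polynomials onto `boxSpace`. -/
def boxRetract (d n N : ℕ) : (Fin n → TrigPoly d) →L[ℝ] boxSpace d n N :=
  LinearMap.mkContinuous
    { toFun := fun U => ⟨fun i => (1 / 2 : ℝ) • (mult (boxInd N) (U i) + conjT (mult (boxInd N) (U i))),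
        fun i => ⟨by
          have h : ∀ a : TrigPoly d, conjT (conjT a) = a := fun a => by
            ext k; rw [coeff_conjT, coeff_conjT, neg_neg, Complex.conj_conj]
          rw [IsRealPoly, conjT_smul, map_add, h, add_comm], fun k hk => by
          have hk' : -k ∉ box d N := fun h => hk (neg_mem_box.1 h)
          rw [AddMonoidAlgebra.coeff_smul, Finsupp.smul_apply, AddMonoidAlgebra.coeff_add,
            Finsupp.add_apply, coeff_conjT, coeff_mult, coeff_mult, boxInd, boxInd, if_neg hk,
            if_neg hk']
          simp⟩⟩
      map_add' := fun U V => Subtype.ext (funext fun i => by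
        change (1 / 2 : ℝ) • (mult (boxInd N) (U i + V i) + conjT (mult (boxInd N) (U i + V i))) =
          (1 / 2 : ℝ) • (mult (boxInd N) (U i) + conjT (mult (boxInd N) (U i))) +
          (1 / 2 : ℝ) • (mult (boxInd N) (V i) + conjT (mult (boxInd N) (V i)))
        rw [map_add, map_add, ← smul_add]; congr 1; abel)
      map_smul' := fun r U => Subtype.ext (funext fun i => by
        have e : mult (boxInd N) (r • U i) = r • mult (boxInd N) (U i) := by
          ext k; simp
        change (1 / 2 : ℝ) • (mult (boxInd N) (r • U i) + conjT (mult (boxInd N) (r • U i))) =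
          r • ((1 / 2 : ℝ) • (mult (boxInd N) (U i) + conjT (mult (boxInd N) (U i))))
        rw [e, conjT_smul, ← smul_add, smul_comm]) } 1 fun U => by
    rw [one_mul]
    refine (pi_norm_le_iff_of_nonneg (norm_nonneg U)).2 fun i => ?_
    change ‖(1 / 2 : ℝ) • (mult (boxInd N) (U i) + conjT (mult (boxInd N) (U i)))‖ ≤ ‖U‖
    have h1 : ‖mult (boxInd N) (U i)‖ ≤ ‖U i‖ := norm_le_norm_of_coeff fun k => by
      rw [coeff_mult, boxInd]; split_ifs <;> simp
    have h2 := norm_add_le (mult (boxInd N) (U i)) (conjT (mult (boxInd N) (U i)))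
    rw [norm_conjT] at h2
    have h3 := norm_le_pi_norm U i
    rw [norm_smul]
    norm_num
    linarith

lemma boxRetract_of_mem {N : ℕ} {U : Fin n → TrigPoly d} (hU : U ∈ boxSpace d n N) :
    (boxRetract d n N U : Fin n → TrigPoly d) = U := by
  funext i
  change (1 / 2 : ℝ) • (mult (boxInd N) (U i) + conjT (mult (boxInd N) (U i))) = U i
  have e : mult (boxInd N) (U i) = U i := by
    ext k
    rw [coeff_mult, boxInd]
    split_ifs with h
    · simp
    · rw [(hU i).2 k h]; simp
  rw [e, (hU i).1, ← two_smul ℝ, smul_smul]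
  norm_num

/-- The unfiltered part of the operator has constant coefficients. -/
def HasConstantLinearPart (A : Fin 2 → Fin d → Fin n → Fin n → MvPolynomial (Fin n) ℝ) : Prop :=
  ∀ j i l, ∃ z, A 0 j i l = MvPolynomial.C z

lemma coeff_transport_of_const {B : Fin d → Fin n → Fin n → MvPolynomial (Fin n) ℝ}
    {z : Fin d → Fin n → Fin n → ℝ} (hB : ∀ j i l, B j i l = MvPolynomial.C (z j i l))
    (U : Fin n → TrigPoly d) (i : Fin n) (k : Fin d → ℤ) :
    (transport B U i).coeff k = ∑ j, ∑ l, (z j i l : ℂ) * (Complex.I * (k j : ℂ) * (U l).coeff k) := by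
  have e : ∀ j l, comp (B j i l) U * dX j (U l) = (z j i l : ℂ) • dX j (U l) := fun j l => by
    rw [hB, comp, MvPolynomial.aeval_C, Algebra.algebraMap_eq_smul_one, smul_mul_assoc, one_mul]
    ext k; simp
  have h : ∀ {m : ℕ} (f : Fin m → TrigPoly d), (∑ j, f j).coeff k = ∑ j, (f j).coeff k := by
    intro m f
    rw [AddMonoidAlgebra.coeff_sum, Finsupp.finsetSum_apply]
  simp only [transport, e, h]
  rfl

lemma polyOp_mem_boxSpace (hσ : IsLowPassProfile σ) {N : ℕ} (hN : 1 ≤ N)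
    {A : Fin 2 → Fin d → Fin n → Fin n → MvPolynomial (Fin n) ℝ} (hA : HasConstantLinearPart A)
    {U : Fin n → TrigPoly d} (hU : U ∈ boxSpace d n N) : polyOp σ N A U ∈ boxSpace d n N := by
  intro i
  refine ⟨IsRealPoly.polyOp hσ N (fun i => (hU i).1) i, fun k hk => ?_⟩
  choose z hz using hA
  rw [polyOp_eq, AddMonoidAlgebra.coeff_add, Finsupp.add_apply, coeff_transport_of_const hz,
    coeff_mult]
  have hl : lam σ N k = 0 := by
    rw [mem_box] at hk
    push Not at hk
    obtain ⟨j, hj⟩ := hk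
    exact lam_eq_zero hσ hN hj.le
  simp only [hl]
  simp [fun l => (hU l).2 k hk]

/-- The vector field `U ↦ -polyOp U` on `boxSpace`. -/
def polyField (σ : EuclideanSpace ℝ (Fin d) → ℝ) (N : ℕ)
    (A : Fin 2 → Fin d → Fin n → Fin n → MvPolynomial (Fin n) ℝ) (U : boxSpace d n N) :
    boxSpace d n N := boxRetract d n N (-polyOp σ N A U)

lemma coe_polyField (hσ : IsLowPassProfile σ) {N : ℕ} (hN : 1 ≤ N)
    {A : Fin 2 → Fin d → Fin n → Fin n → MvPolynomial (Fin n) ℝ} (hA : HasConstantLinearPart A)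
    (U : boxSpace d n N) : (polyField σ N A U : Fin n → TrigPoly d) = -polyOp σ N A U :=
  boxRetract_of_mem (neg_mem (polyOp_mem_boxSpace hσ hN hA U.2))

/-- A coordinate functional on `boxSpace`, composed with a linear map. -/
def boxCLM {E : Type*} [NormedAddCommGroup E] [NormedSpace ℝ E] (N : ℕ)
    (ℓ : TrigPoly d →ₗ[ℝ] E) (i : Fin n) : boxSpace d n N →L[ℝ] E :=
  LinearMap.toContinuousLinearMap ((ℓ.comp (LinearMap.proj i)).comp (boxSpace d n N).subtype)

lemma boxCLM_apply {E : Type*} [NormedAddCommGroup E] [NormedSpace ℝ E] (N : ℕ)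
    (ℓ : TrigPoly d →ₗ[ℝ] E) (i : Fin n) (U : boxSpace d n N) : boxCLM N ℓ i U = ℓ (U.1 i) := rfl

lemma contDiff_polyField (hσ : IsLowPassProfile σ) (N : ℕ)
    (A : Fin 2 → Fin d → Fin n → Fin n → MvPolynomial (Fin n) ℝ) :
    ContDiff ℝ 1 (polyField (n := n) σ N A) := by
  have hcomp : ∀ P : MvPolynomial (Fin n) ℝ,
      ContDiff ℝ 1 fun U : boxSpace d n N => comp P (U : Fin n → TrigPoly d) := by
    intro P
    induction P using MvPolynomial.induction_on with
    | C r => simpa [comp] using contDiff_const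
    | add P Q hP hQ => simpa only [comp, map_add] using hP.add hQ
    | mul_X P i hP =>
      simp only [comp, map_mul, MvPolynomial.aeval_X]
      exact hP.mul (boxCLM N LinearMap.id i).contDiff
  refine (boxRetract d n N).contDiff.comp (contDiff_pi.2 fun i => ?_)
  change ContDiff ℝ 1 fun U : boxSpace d n N => -polyOp σ N A U i
  unfold polyOp opF
  refine ContDiff.neg (ContDiff.sum fun b _ => ContDiff.sum fun j _ => ContDiff.sum fun l _ => ?_)
  let φ : TrigPoly d →L[ℝ] TrigPoly d := LinearMap.mkContinuous
    ((filt σ N (2 * (b : ℕ))).restrictScalars ℝ) 1 fun a => by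
      rw [one_mul]; exact norm_filt_le hσ N _ a
  exact φ.contDiff.comp ((hcomp _).mul (boxCLM N ((dX j).restrictScalars ℝ) l).contDiff)

lemma IsODESolution.hasDerivAt_coe (hσ : IsLowPassProfile σ) {N : ℕ} (hN : 1 ≤ N)
    {A : Fin 2 → Fin d → Fin n → Fin n → MvPolynomial (Fin n) ℝ} (hA : HasConstantLinearPart A)
    {c : ℝ → boxSpace d n N} {t : ℝ} (hc : HasDerivAt c (polyField σ N A (c t)) t)
    (ℓ : TrigPoly d →ₗ[ℂ] TrigPoly d) (i : Fin n) :
    HasDerivAt (fun τ => ℓ ((c τ).1 i)) (ℓ (-polyOp σ N A (c t) i)) t := by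
  have h := (boxCLM N (ℓ.restrictScalars ℝ) i).hasFDerivAt.comp_hasDerivAt t hc
  refine h.congr_deriv ?_
  rw [boxCLM_apply, coe_polyField hσ hN hA]
  rfl

end SpectralScheme
end

noncomputable section

namespace SpectralScheme

open MeasureTheory

variable {d n : ℕ} {σ : EuclideanSpace ℝ (Fin d) → ℝ}

/-! ### Solutions of the differential equations solve the schemes -/

lemma n2_le_norm (a : TrigPoly d) : n2 a ≤ ‖a‖ := by
  have h := n2_mul_le a 1
  have e : n2 (1 : TrigPoly d) = 1 := by
    rw [n2, tsum_eq_single 0 (fun k hk => by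
      rw [AddMonoidAlgebra.one_def]; simp [hk.symm]), AddMonoidAlgebra.one_def]
    simp
  rwa [mul_one, e, mul_one] at h

lemma exists_hsN_le_norm (N : ℕ) (r : ℝ) :
    ∃ C, 0 ≤ C ∧ ∀ U ∈ boxSpace d n N, hsN r U ≤ C * ‖U‖ := by
  have hJ : ∀ k : Fin d → ℤ, 0 ≤ jap k ^ r := fun k => Real.rpow_nonneg (jap_pos k).le r
  set B := ∑ k ∈ box d N, jap k ^ r
  have hB : 0 ≤ B := Finset.sum_nonneg fun k _ => hJ k
  refine ⟨Real.sqrt n * B, by positivity, fun U hU => ?_⟩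
  have h1 : ∀ i, n2 (wmul (fun k => jap k ^ r) (U i)) ≤ B * ‖U‖ := by
    intro i
    refine (n2_le_mul_of_coeff (b := U i) hB fun k => ?_).trans
      (mul_le_mul_of_nonneg_left ((n2_le_norm _).trans (norm_le_pi_norm U i)) hB)
    rw [norm_coeff_wmul hJ]
    by_cases hk : k ∈ box d N
    · exact mul_le_mul_of_nonneg_right (Finset.single_le_sum (f := fun k => jap k ^ r)
        (fun k _ => hJ k) hk) (norm_nonneg _)
    · rw [(hU i).2 k hk]; simp
  have hBU : 0 ≤ B * ‖U‖ := by positivity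
  rw [hsN, mul_assoc]
  refine Real.sqrt_le_iff.2 ⟨by positivity, ?_⟩
  rw [mul_pow, Real.sq_sqrt (by positivity)]
  refine (Finset.sum_le_sum fun i _ => pow_le_pow_left₀ (n2_nonneg _) (h1 i) 2).trans ?_
  simp

lemma hsNorm_synth_coe {N : ℕ} (U : boxSpace d n N) (r : ℝ) : hsNorm r (synth U.1) = hsN r U.1 :=
  hsNorm_synth (isRealPoly_coe U) r

lemma continuousIntoHs_synth {N : ℕ} {c : ℝ → boxSpace d n N} {I : Set ℝ} (hc : ContinuousOn c I)
    (r : ℝ) : ContinuousIntoHs r I fun t => synth (c t).1 := by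
  obtain ⟨C, hC, h⟩ := exists_hsN_le_norm (d := d) (n := n) N r
  refine ⟨fun t _ => memHs_synth (isRealPoly_coe _) r, fun t ht => ?_⟩
  have h1 : Filter.Tendsto (fun τ => C * ‖c τ - c t‖) (nhdsWithin t I) (nhds 0) := by
    have := ((hc t ht).tendsto.sub (tendsto_const_nhds (x := c t))).norm.const_mul C
    simpa only [sub_self, norm_zero, mul_zero] using this
  refine squeeze_zero (fun τ => Real.sqrt_nonneg _) (fun τ => ?_) h1
  rw [← synth_sub, ← Submodule.coe_sub, hsNorm_synth_coe]
  exact h _ (c τ - c t).2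

lemma IsODESolution.continuousOn {E : Type*} [NormedAddCommGroup E] [NormedSpace ℝ E] {f : E → E}
    {c₀ : E} {I : Set ℝ} {c : ℝ → E} (h : IsODESolution f c₀ I c) : ContinuousOn c I :=
  fun t ht => (h.hasDerivAt t ht).continuousAt.continuousWithinAt

lemma IsODESolution.contDiffOn {E : Type*} [NormedAddCommGroup E] [NormedSpace ℝ E] {f : E → E}
    {c₀ : E} {I : Set ℝ} {c : ℝ → E} (hf : Continuous f) (h : IsODESolution f c₀ I c) :
    ContDiffOn ℝ 1 c I := by
  refine (contDiffOn_succ_iff_deriv_of_isOpen (n := 0) h.isOpen).2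
    ⟨fun t ht => (h.hasDerivAt t ht).differentiableAt.differentiableWithinAt, by simp, ?_⟩
  rw [contDiffOn_zero]
  exact (hf.comp_continuousOn h.continuousOn).congr fun t ht => (h.hasDerivAt t ht).deriv

lemma IsODESolution.contDiffOneIntoHs {N : ℕ} {f : boxSpace d n N → boxSpace d n N}
    (hf : Continuous f) {c₀ : boxSpace d n N} {I : Set ℝ} {c : ℝ → boxSpace d n N}
    (h : IsODESolution f c₀ I c) (r : ℝ) : ContDiffOneIntoHs r I fun t => synth (c t).1 := by
  refine ⟨continuousIntoHs_synth h.continuousOn r, fun t => synth (f (c t)).1,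
    continuousIntoHs_synth (hf.comp_continuousOn h.continuousOn) r, fun t ht => ?_⟩
  obtain ⟨C, hC, hle⟩ := exists_hsN_le_norm (d := d) (n := n) N r
  have h1 := hasDerivAt_iff_tendsto_slope.1 (h.hasDerivAt t ht)
  have h2 : Filter.Tendsto (fun τ => C * ‖slope c t τ - f (c t)‖) (nhdsWithin t (I \ {t}))
      (nhds 0) := by
    have := ((h1.mono_left (nhdsWithin_mono t fun x (hx : x ∈ I \ {t}) => hx.2)).sub
      (tendsto_const_nhds (x := f (c t)))).norm.const_mul C
    simpa using this
  refine squeeze_zero (fun τ => Real.sqrt_nonneg _) (fun τ => ?_) h2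
  have e : (τ - t)⁻¹ • (synth (c τ).1 - synth (c t).1) - synth (f (c t)).1 =
      synth (slope c t τ - f (c t)).1 := by
    rw [slope_def_module, Submodule.coe_sub, Submodule.coe_smul, Submodule.coe_sub, synth_sub,
      synth_smul, synth_sub]
  rw [e, hsNorm_synth_coe]
  exact hle _ (slope c t τ - f (c t)).2

/-- The coefficient of index `k`, as a real linear map. -/
def coeffR (k : Fin d → ℤ) : TrigPoly d →ₗ[ℝ] ℂ where
  toFun a := a.coeff k
  map_add' a b := by simp
  map_smul' r a := by simp

lemma IsODESolution.isSolution (hσ : IsLowPassProfile σ) {N : ℕ} (hN : 1 ≤ N)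
    {A : Fin 2 → Fin d → Fin n → Fin n → MvPolynomial (Fin n) ℝ} (hA : HasConstantLinearPart A)
    {F : Field d n → Field d n} (hF : Represents F σ N A) {c₀ : boxSpace d n N} {I : Set ℝ}
    {c : ℝ → boxSpace d n N} (h : IsODESolution (polyField σ N A) c₀ I c) (s : ℝ) :
    IsSolution s F (synth c₀.1) I fun t => synth (c t).1 where
  isOpen := h.isOpen
  ordConnected := h.ordConnected
  zero_mem := h.zero_mem
  continuousIntoHs := continuousIntoHs_synth h.continuousOn s
  initial := by simp only [h.initial]
  contDiffOn := by
    refine contDiffOn_pi.2 fun i => ?_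
    have e : ∀ p : ℝ × (Fin d → ℝ), synth (c p.1).1 p.2 i =
        Complex.reCLM (∑ k ∈ box d N, boxCLM N (coeffR k) i (c p.1) * wave k p.2) := by
      intro p
      rw [synth, ev_eq_sum p.2 (support_coe_subset (c p.1) i)]
      rfl
    simp_rw [e]
    refine Complex.reCLM.contDiff.comp_contDiffOn (ContDiffOn.sum fun k _ => ?_)
    have hc := h.contDiffOn (contDiff_polyField hσ N A).continuous
    refine ContDiffOn.mul ((boxCLM N (coeffR k) i).contDiff.comp_contDiffOn
      (hc.comp contDiffOn_fst fun p hp => hp.1)) ?_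
    exact ((contDiff_wave k).comp contDiff_snd).contDiffOn
  equation := fun t ht x => by
    refine hasDerivAt_pi.2 fun i => ?_
    let ℓ : TrigPoly d →ₗ[ℝ] ℝ := Complex.reLm.comp ((ev x).toLinearMap.restrictScalars ℝ)
    have hd := (boxCLM N ℓ i).hasFDerivAt.comp_hasDerivAt t (h.hasDerivAt t ht)
    refine hd.congr_deriv ?_
    rw [hF _ (isRealPoly_coe (c t)), boxCLM_apply, coe_polyField hσ hN hA]
    change (ev x (-polyOp σ N A (c t).1 i)).re = -(ev x (polyOp σ N A (c t).1 i)).re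
    rw [map_neg, Complex.neg_re]

/-! ### Solutions of the schemes are trigonometric polynomials -/

lemma integral_cell_fderiv_eq_zero {g : (Fin d → ℝ) → ℂ} (hg : ContDiff ℝ 1 g) (j : Fin d)
    (hp : ∀ x, g (x + Pi.single j (2 * Real.pi)) = g x) :
    ∫ x in cell d, fderiv ℝ g x (Pi.single j 1) = 0 := by
  obtain _ | d := d
  · exact j.elim0
  classical
  have hcell : ∫ x in cell (d + 1), fderiv ℝ g x (Pi.single j 1) =
      ∫ x in Set.Icc (0 : Fin (d + 1) → ℝ) (fun _ => 2 * Real.pi), fderiv ℝ g x (Pi.single j 1) :=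
    setIntegral_congr_set Measure.univ_pi_Ioc_ae_eq_Icc
  have hcont : Continuous fun x => fderiv ℝ g x (Pi.single j 1) :=
    (hg.continuous_fderiv one_ne_zero).clm_apply continuous_const
  have e : ∀ x, ∑ i, (if i = j then fderiv ℝ g x else 0) (Pi.single i 1) =
      fderiv ℝ g x (Pi.single j 1) := fun x => by
    rw [Finset.sum_eq_single j (fun i _ hi => by rw [if_neg hi]; rfl) (by simp), if_pos rfl]
  have h := integral_divergence_of_hasFDerivAt_off_countable' (0 : Fin (d + 1) → ℝ)
    (fun _ => 2 * Real.pi) (fun _ => by positivity) (fun i => if i = j then g else 0)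
    (fun i x => if i = j then fderiv ℝ g x else 0) ∅ Set.countable_empty
    (fun i => by split_ifs; exacts [hg.continuous.continuousOn, continuousOn_const])
    (fun x _ i => by
      split_ifs
      exacts [(hg.differentiable one_ne_zero x).hasFDerivAt, hasFDerivAt_const _ _])
    (by simp_rw [e]; exact hcont.continuousOn.integrableOn_compact isCompact_Icc)
  simp_rw [e] at h
  rw [hcell, h]
  refine Finset.sum_eq_zero fun i _ => ?_
  by_cases hi : i = j
  · subst hi
    simp only [if_true]
    rw [sub_eq_zero]
    refine integral_congr_ae (.of_forall fun x => ?_)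
    have : i.insertNth (2 * Real.pi) x =
        i.insertNth (0 : ℝ) x + (Pi.single i (2 * Real.pi) : Fin (d + 1) → ℝ) := by
      ext l
      rcases Fin.eq_self_or_eq_succAbove i l with rfl | ⟨l, rfl⟩ <;> simp
    simp only [this]
    exact hp _
  · simp [hi]

lemma fourierCoef_partialDeriv {u : Field d n} (hu : ContDiff ℝ 1 u) (hp : IsPeriodic u) (j : Fin d)
    (k : Fin d → ℤ) (i : Fin n) :
    fourierCoef (partialDeriv j u) k i = Complex.I * (k j : ℂ) * fourierCoef u k i := by
  have hui : ContDiff ℝ 1 fun x => (u x i : ℂ) :=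
    Complex.ofRealCLM.contDiff.comp (contDiff_pi.1 hu i)
  have hd : ∀ x, fderiv ℝ (fun x => (u x i : ℂ)) x (Pi.single j 1) = (partialDeriv j u x i : ℂ) := by
    intro x
    have hx := hu.differentiable one_ne_zero x
    rw [partialDeriv, fderiv_apply_apply hx]
    have h := Complex.ofRealCLM.hasFDerivAt.comp x (differentiableAt_pi.1 hx i).hasFDerivAt
    have e : (fun x => (u x i : ℂ)) = Complex.ofRealCLM ∘ fun x => u x i := rfl
    rw [e, h.fderiv]; rfl
  have h := integral_cell_fderiv_eq_zero (g := fun x => wave (-k) x * (u x i : ℂ))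
    ((contDiff_wave _).mul hui) j fun x => by rw [wave_periodic, hp]
  have e : ∀ x, fderiv ℝ (fun x => wave (-k) x * (u x i : ℂ)) x (Pi.single j 1) =
      wave (-k) x * (partialDeriv j u x i : ℂ) -
        Complex.I * (k j : ℂ) * (wave (-k) x * (u x i : ℂ)) := by
    intro x
    rw [fderiv_fun_mul ((contDiff_wave _).differentiable one_ne_zero x)
      (hui.differentiable one_ne_zero x)]
    simp only [_root_.add_apply, _root_.smul_apply, hd, fderiv_wave, smul_eq_mul]
    simp only [Pi.neg_apply, Int.cast_neg]
    ring
  have hc1 : Continuous fun x => wave (-k) x * (partialDeriv j u x i : ℂ) := by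
    refine (continuous_wave _).mul ?_
    simp_rw [← hd]
    exact (hui.continuous_fderiv one_ne_zero).clm_apply continuous_const
  have hc2 : Continuous fun x => Complex.I * (k j : ℂ) * (wave (-k) x * (u x i : ℂ)) :=
    continuous_const.mul ((continuous_wave _).mul hui.continuous)
  simp_rw [e] at h
  rw [integral_sub hc1.integrableOn_cell hc2.integrableOn_cell, integral_const_mul,
    sub_eq_zero] at h
  rw [fourierCoef_eq, fourierCoef_eq, h]
  ring

end SpectralScheme
end

noncomputable section

namespace SpectralScheme

open MeasureTheory

variable {d n : ℕ} {σ : EuclideanSpace ℝ (Fin d) → ℝ}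

/-- Off the box of frequencies, the spatial operator `F` acts as a constant-coefficient operator. -/
def IsLinearOffBox (F : Field d n → Field d n) (N : ℕ) : Prop :=
  ∃ z : Fin d → Fin n → Fin n → ℝ, ∀ u, ContDiff ℝ 1 u → IsPeriodic u → ∀ k ∉ box d N, ∀ i,
    fourierCoef (F u) k i = ∑ j, ∑ l, (z j i l : ℂ) * (Complex.I * (k j : ℂ) * fourierCoef u k l)

lemma smoothFilter_eq_synth (hσ : IsLowPassProfile σ) {N : ℕ} (hN : 1 ≤ N) (g : Field d n) :
    ∃ W : Fin n → TrigPoly d, W ∈ boxSpace d n N ∧ smoothFilter σ N g = synth W := by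
  set m : (Fin d → ℤ) → ℝ := fun k => σ (WithLp.toLp 2 fun j => (k j : ℝ) / (N : ℝ)) with hm
  have hml : ∀ k, m k = lam σ N k ^ 2 := fun k => (lam_sq hσ N k).symm
  have hm0 : ∀ k ∉ box d N, m k = 0 := by
    intro k hk
    rw [mem_box] at hk
    push Not at hk
    obtain ⟨j, hj⟩ := hk
    rw [hml, lam_eq_zero hσ hN hj.le]; simp
  refine ⟨fun i => trunc (box d N) fun k => (m k : ℂ) * fourierCoef g k i, fun i => ⟨?_, fun k hk =>
    coeff_trunc_of_notMem hk⟩, ?_⟩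
  · rw [isRealPoly_iff]
    intro k
    by_cases h : k ∈ box d N
    · rw [coeff_trunc_of_mem h, coeff_trunc_of_mem (neg_mem_box.2 h), fourierCoef_neg, map_mul,
        Complex.conj_ofReal, hml, hml, lam_neg hσ]
    · rw [coeff_trunc_of_notMem h, coeff_trunc_of_notMem (fun h' => h (neg_mem_box.1 h')),
        map_zero]
  · ext x i
    rw [smoothFilter, multiplier, synth, ev_trunc]
    congr 1
    rw [tsum_eq_sum (s := box d N)]
    · rfl
    · intro k hk
      have := hm0 k hk
      simp only [hm] at this
      rw [this]; simp

lemma fourierCoef_smoothFilter (hσ : IsLowPassProfile σ) {N : ℕ} (hN : 1 ≤ N) (g : Field d n)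
    {k : Fin d → ℤ} (hk : k ∉ box d N) (i : Fin n) : fourierCoef (smoothFilter σ N g) k i = 0 := by
  obtain ⟨W, hW, e⟩ := smoothFilter_eq_synth hσ hN g
  rw [e, fourierCoef_synth fun i => (hW i).1]
  exact (hW i).2 k hk

lemma continuous_smoothFilter (hσ : IsLowPassProfile σ) {N : ℕ} (hN : 1 ≤ N) (g : Field d n) :
    Continuous (smoothFilter σ N g) := by
  obtain ⟨W, hW, e⟩ := smoothFilter_eq_synth hσ hN g
  rw [e]
  exact continuous_synth W

lemma isLinearOffBox_filteredOp (hσ : IsLowPassProfile σ) {N : ℕ} (hN : 1 ≤ N)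
    (A : Fin d → PolyMatrix n) : IsLinearOffBox (filteredOp A σ N) N :=
  ⟨0, fun u _ _ k hk i => by
    rw [filteredOp, fourierCoef_smoothFilter hσ hN _ hk]; simp⟩

lemma fourierCoef_add {u v : Field d n} (hu : Continuous u) (hv : Continuous v) (k : Fin d → ℤ)
    (i : Fin n) : fourierCoef (fun x => u x + v x) k i = fourierCoef u k i + fourierCoef v k i := by
  have h : ∀ {w : Field d n}, Continuous w → IntegrableOn (fun x => wave (-k) x * (w x i : ℂ))
      (cell d) := fun {w} hw => ((continuous_wave _).mul
    (Complex.continuous_ofReal.comp ((continuous_apply i).comp hw))).integrableOn_cell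
  simp only [fourierCoef_eq, Pi.add_apply, Complex.ofReal_add, mul_add]
  rw [integral_add (h hu) (h hv), mul_add]

lemma fourierCoef_sum {m : ℕ} {u : Fin m → Field d n} (hu : ∀ j, Continuous (u j)) (k : Fin d → ℤ)
    (i : Fin n) : fourierCoef (fun x => ∑ j, u j x) k i = ∑ j, fourierCoef (u j) k i := by
  have h : ∀ {w : Field d n}, Continuous w → Integrable (fun x => wave (-k) x * (w x i : ℂ))
      (volume.restrict (cell d)) := fun {w} hw => ((continuous_wave _).mul
    (Complex.continuous_ofReal.comp ((continuous_apply i).comp hw))).integrableOn_cell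
  simp only [fourierCoef_eq, Finset.sum_apply, Complex.ofReal_sum, Finset.mul_sum]
  rw [integral_finsetSum _ fun j _ => h (hu j), Finset.mul_sum]

lemma fourierCoef_neg_field (u : Field d n) (k : Fin d → ℤ) (i : Fin n) :
    fourierCoef (fun x => -u x) k i = -fourierCoef u k i := by
  simp only [fourierCoef_eq, Pi.neg_apply, Complex.ofReal_neg, mul_neg]
  rw [integral_neg, mul_neg]

lemma fourierCoef_mulVec (B : Matrix (Fin n) (Fin n) ℝ) {u : Field d n} (hu : Continuous u)
    (k : Fin d → ℤ) (i : Fin n) :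
    fourierCoef (fun x => B.mulVec (u x)) k i = ∑ l, (B i l : ℂ) * fourierCoef u k l := by
  have h : ∀ l, Integrable (fun x => wave (-k) x * ((B i l : ℂ) * (u x l : ℂ)))
      (volume.restrict (cell d)) := fun l => ((continuous_wave _).mul (continuous_const.mul
    (Complex.continuous_ofReal.comp ((continuous_apply l).comp hu)))).integrableOn_cell
  simp only [fourierCoef_eq, Matrix.mulVec, dotProduct, Complex.ofReal_sum, Finset.mul_sum,
    Complex.ofReal_mul]
  rw [integral_finsetSum _ fun l _ => h l, Finset.mul_sum]
  refine Finset.sum_congr rfl fun l _ => ?_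
  have e : ∀ x, wave (-k) x * ((B i l : ℂ) * (u x l : ℂ)) =
      (B i l : ℂ) * (wave (-k) x * (u x l : ℂ)) := fun x => mul_left_comm _ _ _
  simp_rw [e]
  rw [integral_const_mul]
  ring

lemma continuous_partialDeriv {u : Field d n} (hu : ContDiff ℝ 1 u) (j : Fin d) :
    Continuous (partialDeriv j u) :=
  (hu.continuous_fderiv one_ne_zero).clm_apply continuous_const

lemma isLinearOffBox_linearUnfilteredOp (hσ : IsLowPassProfile σ) {N : ℕ} (hN : 1 ≤ N)
    (A : Fin d → PolyMatrix n) : IsLinearOffBox (linearUnfilteredOp A σ N) N := by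
  refine ⟨fun j => (A j).evalAt 0, fun u hu hp k hk i => ?_⟩
  have h1 : ∀ j, Continuous fun x => ((A j).evalAt 0).mulVec (partialDeriv j u x) := fun j =>
    Continuous.matrix_mulVec continuous_const (continuous_partialDeriv hu j)
  have h2 : ∀ j, Continuous fun x => smoothFilter σ N
      (fun y => ((A j).evalAt (u y) - (A j).evalAt 0).mulVec (partialDeriv j u y)) x := fun j =>
    continuous_smoothFilter hσ hN _
  refine (fourierCoef_sum (fun j => (h1 j).add (h2 j)) k i).trans ?_
  refine Finset.sum_congr rfl fun j _ => ?_
  refine (fourierCoef_add (h1 j) (h2 j) k i).trans ?_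
  rw [fourierCoef_mulVec _ (continuous_partialDeriv hu j), fourierCoef_smoothFilter hσ hN _ hk,
    add_zero]
  exact Finset.sum_congr rfl fun l _ => by rw [fourierCoef_partialDeriv hu hp]

lemma hasDerivAt_fourierCoef {J : Set ℝ} (hJ : IsOpen J) {V W : ℝ → Field d n}
    (hV : ContDiffOn ℝ 1 (fun p : ℝ × (Fin d → ℝ) => V p.1 p.2) (J ×ˢ Set.univ))
    (hW : ∀ t ∈ J, ∀ x, HasDerivAt (fun τ => V τ x) (W t x) t) {t : ℝ} (ht : t ∈ J)
    (k : Fin d → ℤ) (i : Fin n) :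
    HasDerivAt (fun τ => fourierCoef (V τ) k i) (fourierCoef (W t) k i) t := by
  have hopen : IsOpen (J ×ˢ (Set.univ : Set (Fin d → ℝ))) := hJ.prod isOpen_univ
  have hVc : ∀ τ ∈ J, Continuous (V τ) := fun τ hτ => by
    have h := hV.continuousOn.comp_continuous (f := fun x : Fin d → ℝ => (τ, x)) (by fun_prop)
      fun x => ⟨hτ, trivial⟩
    exact h
  have hWe : ∀ τ ∈ J, ∀ x, W τ x =
      fderiv ℝ (fun p : ℝ × (Fin d → ℝ) => V p.1 p.2) (τ, x) (1, 0) := by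
    intro τ hτ x
    have hd : DifferentiableAt ℝ (fun p : ℝ × (Fin d → ℝ) => V p.1 p.2) (τ, x) :=
      (hV.differentiableOn one_ne_zero).differentiableAt (hopen.mem_nhds ⟨hτ, trivial⟩)
    have h2 := hd.hasFDerivAt.comp_hasDerivAt τ ((hasDerivAt_id τ).prodMk (hasDerivAt_const τ x))
    exact (hW τ hτ x).unique h2
  have hWc : ContinuousOn (fun p : ℝ × (Fin d → ℝ) => W p.1 p.2) (J ×ˢ Set.univ) := by
    refine ((hV.continuousOn_fderiv_of_isOpen hopen le_rfl).clm_apply continuousOn_const).congr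
      fun p hp => hWe p.1 hp.1 p.2
  obtain ⟨ε, hε, hball⟩ := Metric.nhds_basis_closedBall.mem_iff.1 (hJ.mem_nhds ht)
  have hcomp : IsCompact (Metric.closedBall t ε ×ˢ
      Set.Icc (0 : Fin d → ℝ) (fun _ => 2 * Real.pi)) :=
    (isCompact_closedBall t ε).prod isCompact_Icc
  obtain ⟨B, hB⟩ := hcomp.exists_bound_of_continuousOn (hWc.mono fun p hp => ⟨hball hp.1, trivial⟩)
  have hsub : cell d ⊆ Set.Icc 0 (fun _ => 2 * Real.pi) := fun x hx =>
    ⟨fun j => (hx j trivial).1.le, fun j => (hx j trivial).2⟩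
  have hfin : IsFiniteMeasure (volume.restrict (cell d)) :=
    ⟨by rw [Measure.restrict_apply_univ]; exact measure_cell_lt_top⟩
  have hcoord : ∀ {u : Field d n}, Continuous u → Continuous fun x => wave (-k) x * (u x i : ℂ) :=
    fun {u} hu => (continuous_wave _).mul
      (Complex.continuous_ofReal.comp ((continuous_apply i).comp hu))
  have hWtc : Continuous (W t) := by
    have h := hWc.comp_continuous (f := fun x : Fin d → ℝ => (t, x)) (by fun_prop)
      fun x => ⟨ht, trivial⟩
    exact h
  have key := hasDerivAt_integral_of_dominated_loc_of_deriv_le (μ := volume.restrict (cell d))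
    (F := fun τ x => wave (-k) x * (V τ x i : ℂ)) (F' := fun τ x => wave (-k) x * (W τ x i : ℂ))
    (bound := fun _ => B) (x₀ := t) (Metric.closedBall_mem_nhds t hε)
    (by
      filter_upwards [hJ.mem_nhds ht] with τ hτ
      exact (hcoord (hVc τ hτ)).aestronglyMeasurable)
    (hcoord (hVc t ht)).integrableOn_cell
    (hcoord hWtc).aestronglyMeasurable
    ((ae_restrict_iff' (MeasurableSet.univ_pi fun _ => measurableSet_Ioc)).2
      (.of_forall fun x hx τ hτ => by
        rw [norm_mul, norm_wave, one_mul, Complex.norm_real]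
        exact (norm_le_pi_norm (W τ x) i).trans (hB (τ, x) ⟨hτ, hsub hx⟩)))
    (integrable_const B)
    (.of_forall fun x τ hτ => by
      have h := hasDerivAt_pi.1 (hW τ (hball hτ) x) i
      exact (h.ofReal_comp).const_mul _)
  simp_rw [fourierCoef_eq]
  exact key.2.const_mul _

/-- Every classical solution is a trigonometric polynomial with frequencies in the box, and solves
the differential equation. -/
lemma IsSolution.exists_isODESolution (hσ : IsLowPassProfile σ) {N : ℕ} (hN : 1 ≤ N)
    {A : Fin 2 → Fin d → Fin n → Fin n → MvPolynomial (Fin n) ℝ} (hA : HasConstantLinearPart A)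
    {F : Field d n → Field d n} (hF : Represents F σ N A) (hlin : IsLinearOffBox F N) {s : ℝ}
    {c₀ : boxSpace d n N} {J : Set ℝ} {V : ℝ → Field d n} (h : IsSolution s F (synth c₀.1) J V) :
    ∃ c : ℝ → boxSpace d n N, IsODESolution (polyField σ N A) c₀ J c ∧
      ∀ t ∈ J, V t = synth (c t).1 := by
  have hper : ∀ t ∈ J, IsPeriodic (V t) := fun t ht => (h.continuousIntoHs.1 t ht).1
  have hcd : ∀ t ∈ J, ContDiff ℝ 1 (V t) := fun t ht => by
    have := h.contDiffOn.comp_contDiff (f := fun x : Fin d → ℝ => (t, x)) (by fun_prop)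
      fun x => ⟨ht, trivial⟩
    exact this
  have hder : ∀ t ∈ J, ∀ k i, HasDerivAt (fun τ => fourierCoef (V τ) k i)
      (-fourierCoef (F (V t)) k i) t := by
    intro t ht k i
    rw [← fourierCoef_neg_field]
    exact hasDerivAt_fourierCoef h.isOpen (W := fun t x => -F (V t) x) h.contDiffOn h.equation ht k i
  -- off the box the filter vanishes: the coefficients solve a linear equation with zero data
  have hout : ∀ t ∈ J, ∀ k ∉ box d N, ∀ i, fourierCoef (V t) k i = 0 := by
    intro t ht k hk i
    obtain ⟨z, hz⟩ := hlin
    let f : (Fin n → ℂ) → (Fin n → ℂ) := fun a i =>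
      -∑ j, ∑ l, (z j i l : ℂ) * (Complex.I * (k j : ℂ) * a l)
    have hf : ContDiff ℝ 1 f := contDiff_pi.2 fun i => ContDiff.neg (ContDiff.sum fun j _ =>
      ContDiff.sum fun l _ => contDiff_const.mul (contDiff_const.mul (contDiff_apply ℝ ℂ l)))
    have h1 : IsODESolution f 0 J fun t i => fourierCoef (V t) k i :=
      ⟨h.isOpen, h.ordConnected, h.zero_mem, by
        ext i
        rw [h.initial, fourierCoef_synth (isRealPoly_coe c₀), coeff_coe_eq_zero c₀ i hk]; rfl,
        fun t ht => hasDerivAt_pi.2 fun i => by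
          have := hder t ht k i
          rwa [hz _ (hcd t ht) (hper t ht) k hk] at this⟩
    have h2 : IsODESolution f 0 J fun _ => 0 :=
      ⟨h.isOpen, h.ordConnected, h.zero_mem, rfl, fun t _ => by
        have e : f 0 = 0 := by ext i; simp [f]
        rw [e]; exact hasDerivAt_const t 0⟩
    exact congrFun (h1.eqOn hf h2 ht ht) i
  let c : ℝ → boxSpace d n N := fun t => boxRetract d n N (proj N (V t))
  have hcoe : ∀ t, (c t).1 = proj N (V t) := fun t => boxRetract_of_mem (proj_mem_boxSpace N (V t))
  have hrep : ∀ t ∈ J, V t = synth (c t).1 := by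
    intro t ht
    refine eq_of_fourierCoef_eq (hcd t ht).continuous (continuous_synth _) (hper t ht)
      (isPeriodic_synth _) fun k i => ?_
    rw [fourierCoef_synth (isRealPoly_coe (c t)), hcoe]
    by_cases hk : k ∈ box d N
    · rw [proj, coeff_trunc_of_mem hk]
    · rw [hout t ht k hk, proj, coeff_trunc_of_notMem hk]
  refine ⟨c, ⟨h.isOpen, h.ordConnected, h.zero_mem, ?_, fun t ht => ?_⟩, hrep⟩
  · refine Subtype.ext (funext fun i => ?_)
    rw [hcoe, h.initial]
    ext k
    by_cases hk : k ∈ box d N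
    · rw [proj, coeff_trunc_of_mem hk, fourierCoef_synth (isRealPoly_coe c₀)]
    · rw [proj, coeff_trunc_of_notMem hk, coeff_coe_eq_zero c₀ i hk]
  · refine (boxRetract d n N).hasFDerivAt.comp_hasDerivAt t (hasDerivAt_pi.2 fun i => ?_)
    have hFc : ∀ k, fourierCoef (F (V t)) k i = (polyOp σ N A (c t).1 i).coeff k := fun k => by
      rw [hrep t ht, hF _ (isRealPoly_coe _), fourierCoef_synth fun i =>
        IsRealPoly.polyOp hσ N (isRealPoly_coe _) i]
    have e1 : ∀ τ, proj N (V τ) i = ∑ k ∈ box d N, fourierCoef (V τ) k i •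
        (AddMonoidAlgebra.single k 1 : TrigPoly d) := by
      intro τ
      rw [proj, trunc]
      refine Finset.sum_congr rfl fun k _ => ?_
      ext l; simp
    have e2 : (-polyOp σ N A (c t).1) i = ∑ k ∈ box d N, (-fourierCoef (F (V t)) k i) •
        (AddMonoidAlgebra.single k 1 : TrigPoly d) := by
      have hm := neg_mem (polyOp_mem_boxSpace hσ hN hA (c t).2)
      have : (-polyOp σ N A (c t).1) i = trunc (box d N) fun k => -fourierCoef (F (V t)) k i := by
        ext k
        by_cases hk : k ∈ box d N
        · rw [coeff_trunc_of_mem hk, hFc]; simp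
        · rw [coeff_trunc_of_notMem hk]; exact (hm i).2 k hk
      rw [this, trunc]
      refine Finset.sum_congr rfl fun k _ => ?_
      ext l; simp
    simp_rw [e1]
    rw [e2]
    exact HasDerivAt.fun_sum fun k _ => (hder t ht k i).smul_const _

end SpectralScheme
end

noncomputable section

namespace SpectralScheme

open MeasureTheory

variable {d n : ℕ} {σ : EuclideanSpace ℝ (Fin d) → ℝ}

/-! ### Symmetrizable schemes and their maximal solutions -/

/-- A family of spatial operators `F N` which, on trigonometric polynomials, have the form
`∑_b ∑_j L^{2b} (A_{b,j}(U) ∂_j U)`, with a symmetrizer `∑_a L^a G_a(U) L^a` that is definite for `U`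
with values in a compact part of `𝒰`. -/
structure IsSymmetrizableScheme (σ : EuclideanSpace ℝ (Fin d) → ℝ) (𝒰 : Set (Fin n → ℝ))
    (F : ℕ → Field d n → Field d n)
    (A : Fin 2 → Fin d → Fin n → Fin n → MvPolynomial (Fin n) ℝ)
    (G : Fin 2 → Fin n → Fin n → MvPolynomial (Fin n) ℝ) : Prop where
  constantLinearPart : HasConstantLinearPart A
  represents : ∀ N, 1 ≤ N → Represents (F N) σ N A
  linearOffBox : ∀ N, 1 ≤ N → IsLinearOffBox (F N) N
  symmetrizedBy : IsSymmetrizedBy A G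
  coercive : ∀ K : Set (Fin n → ℝ), IsCompact K → K ⊆ 𝒰 →
    ∃ c C : ℝ, 0 < c ∧ 0 < C ∧ IsCoerciveOn σ G K c C

variable {𝒰 : Set (Fin n → ℝ)} {F : ℕ → Field d n → Field d n}
  {A : Fin 2 → Fin d → Fin n → Fin n → MvPolynomial (Fin n) ℝ}
  {G : Fin 2 → Fin n → Fin n → MvPolynomial (Fin n) ℝ}

lemma IsSymmetrizableScheme.exists_maximal (h : IsSymmetrizableScheme σ 𝒰 F A G)
    (hσ : IsLowPassProfile σ) {N : ℕ} (hN : 1 ≤ N) (c₀ : boxSpace d n N) (s : ℝ) :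
    ∃ (I : Set ℝ) (c : ℝ → boxSpace d n N),
      IsUniqueMaximalSolution s (F N) (synth c₀.1) I (fun t => synth (c t).1) ∧
      (∀ r, ContDiffOneIntoHs r I fun t => synth (c t).1) ∧
      ∀ J c', IsODESolution (polyField σ N A) c₀ J c' → J ⊆ I ∧ ∀ t ∈ J, c' t = c t := by
  have hf := contDiff_polyField (n := n) hσ N A
  obtain ⟨I, c, hc, hmax⟩ := exists_maximal_isODESolution hf (exists_isODESolution hf c₀)
  refine ⟨I, c, ⟨hc.isSolution hσ hN h.constantLinearPart (h.represents N hN) s,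
    fun J V hV => ?_⟩, hc.contDiffOneIntoHs hf.continuous, hmax⟩
  obtain ⟨c', hc', e⟩ := hV.exists_isODESolution hσ hN h.constantLinearPart (h.represents N hN)
    (h.linearOffBox N hN)
  obtain ⟨hJ, hcc⟩ := hmax J c' hc'
  exact ⟨hJ, fun t ht => by rw [e t ht, hcc t ht]⟩

/-! ### Propagation of higher norms -/

lemma IsSymmetrizableScheme.exists_hsNorm_le (h : IsSymmetrizableScheme σ 𝒰 F A G)
    (hσ : IsLowPassProfile σ) {s s' : ℝ} (hs : (d : ℝ) / 2 + 1 < s) (hs' : s ≤ s') (M : ℝ)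
    (hM : 0 < M) {K : Set (Fin n → ℝ)} (hK : IsCompact K) (hKU : K ⊆ 𝒰) :
    ∃ C : ℝ, 0 < C ∧ ∀ N : ℕ, 1 ≤ N → ∀ U₀ : Field d n, MemHs s' U₀ →
      ∀ (I : Set ℝ) (U : ℝ → Field d n), IsUniqueMaximalSolution s (F N) (sharpFilter N U₀) I U →
      ∀ T ∈ I, 0 < T → (∀ t ∈ Set.Icc 0 T, hsNorm s (U t) ≤ M) →
        (∀ t ∈ Set.Icc 0 T, ∀ x, U t x ∈ K) →
        ∀ t ∈ Set.Icc 0 T, hsNorm s' (U t) ≤ C * hsNorm s' U₀ * Real.exp (C * M * t) := by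
  have hr : 1 ≤ s' := by have : (0 : ℝ) ≤ d := d.cast_nonneg; linarith
  obtain ⟨c, C, hc, hC, hG⟩ := h.coercive K hK hKU
  obtain ⟨κ, hκ, hest⟩ := hσ.exists_hsN_le hs hr h.symmetrizedBy hc hC hG M
  refine ⟨Real.sqrt (C / c) + κ, by positivity, fun N hN U₀ hU₀ I U hU T hT _ hUM hUK t ht => ?_⟩
  have hsol := hU.1
  rw [sharpFilter_eq] at hsol
  obtain ⟨q, hq, e⟩ := IsSolution.exists_isODESolution (c₀ := ⟨_, proj_mem_boxSpace N U₀⟩) hσ hN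
    h.constantLinearPart (h.represents N hN) (h.linearOffBox N hN) hsol
  have hsub : Set.Icc 0 T ⊆ I := hsol.ordConnected.out hsol.zero_mem hT
  have key := hest N hN (fun τ => (q τ).1) T M le_rfl
    (fun τ hτ ℓ i => IsODESolution.hasDerivAt_coe hσ hN h.constantLinearPart
      (hq.hasDerivAt τ (hsub hτ)) ℓ i)
    (fun τ _ => isRealPoly_coe (q τ)) (fun τ hτ x => by rw [← e τ (hsub hτ)]; exact hUK τ hτ x)
    (fun τ hτ => by rw [← hsNorm_synth_coe, ← e τ (hsub hτ)]; exact hUM τ hτ) t ht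
  rw [e t (hsub ht), hsNorm_synth_coe]
  have h0 : hsN s' (q 0).1 ≤ hsNorm s' U₀ := by
    rw [hq.initial]; exact hsN_proj_le hU₀ N
  have h1 := hsN_nonneg s' (q 0).1
  have h2 : 0 ≤ hsNorm s' U₀ := h1.trans h0
  refine key.trans ?_
  have hsq : 0 ≤ Real.sqrt (C / c) := Real.sqrt_nonneg _
  have ht0 := ht.1
  gcongr
  · linarith
  · linarith

/-! ### Uniform time of existence -/

lemma continuous_hsN (N : ℕ) (r : ℝ) : Continuous fun U : boxSpace d n N => hsN r U.1 := by
  have e : ∀ U : boxSpace d n N, hsN r U.1 = Real.sqrt (∑ i, ∑ k ∈ box d N,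
      (jap k ^ r * ‖boxCLM N (coeffR k) i U‖) ^ 2) := by
    intro U
    rw [hsN]
    congr 1
    refine Finset.sum_congr rfl fun i _ => ?_
    rw [n2_sq_eq_sum ((support_mult_subset _ _).trans (support_coe_subset U i))]
    refine Finset.sum_congr rfl fun k _ => ?_
    rw [norm_coeff_wmul fun k => Real.rpow_nonneg (jap_pos k).le r]
    rfl
  simp_rw [e]
  refine Real.continuous_sqrt.comp (continuous_finsetSum _ fun i _ => continuous_finsetSum _
    fun k _ => ?_)
  exact (continuous_const.mul (boxCLM N (coeffR k) i).continuous.norm).pow 2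

lemma dist_synth_le (U V : Fin n → TrigPoly d) (x : Fin d → ℝ) :
    dist (synth U x) (synth V x) ≤ ‖U - V‖ := by
  refine (dist_pi_le_iff (norm_nonneg _)).2 fun i => ?_
  have e : synth U x i - synth V x i = (ev x ((U - V) i)).re := by simp [synth]
  rw [Real.dist_eq, e]
  exact (Complex.abs_re_le_norm _).trans ((norm_ev_le _ _).trans (norm_le_pi_norm (U - V) i))

lemma norm_sub_le_of_hasDerivAt {E : Type*} [NormedAddCommGroup E] [NormedSpace ℝ E] {c : ℝ → E}
    {f : E → E} {t B : ℝ} (ht : 0 ≤ t) (hc : ∀ τ ∈ Set.Icc 0 t, HasDerivAt c (f (c τ)) τ)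
    (hB : ∀ τ ∈ Set.Icc 0 t, ‖f (c τ)‖ ≤ B) : ‖c t - c 0‖ ≤ B * t := by
  have := norm_image_sub_le_of_norm_deriv_le_segment' (f := c) (f' := fun τ => f (c τ)) (C := B)
    (fun τ hτ => (hc τ hτ).hasDerivWithinAt) (fun τ hτ => hB τ (Set.Ico_subset_Icc_self hτ)) t
    ⟨ht, le_rfl⟩
  simpa using this

lemma exists_norm_le_hsN (n : ℕ) {s : ℝ} (hs : (d : ℝ) / 2 + 1 < s) :
    ∃ C, 0 ≤ C ∧ ∀ U : Fin n → TrigPoly d, ‖U‖ ≤ C * hsN s U := by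
  obtain ⟨C, hC, h⟩ := exists_norm_wmul_jap_le hs
  refine ⟨C, hC, fun U => (pi_norm_le_iff_of_nonneg
    (mul_nonneg hC (hsN_nonneg s U))).2 fun i => ?_⟩
  exact (norm_le_norm_wmul_jap _).trans ((h _).trans
    (mul_le_mul_of_nonneg_left (n2_le_hsN s U i) hC))

lemma norm_polyField_le (hσ : IsLowPassProfile σ) {N : ℕ} (hN : 1 ≤ N)
    (hA : HasConstantLinearPart A) {U : boxSpace d n N} {B : ℝ} (hB : 0 ≤ B)
    (h : ∀ i, ‖polyOp σ N A U.1 i‖ ≤ B) : ‖polyField σ N A U‖ ≤ B := by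
  change ‖(polyField σ N A U).1‖ ≤ B
  rw [coe_polyField hσ hN hA, norm_neg]
  exact (pi_norm_le_iff_of_nonneg hB).2 h

/-- The time of existence and the bounds, for data whose truncation has values in a fixed compact
part of `𝒰`: the energy estimate and the bound on the displacement `U(t) - U(0)` are bootstrapped. -/
lemma IsSymmetrizableScheme.exists_time_of_mem (h : IsSymmetrizableScheme σ 𝒰 F A G)
    (hσ : IsLowPassProfile σ) {s : ℝ} (hs : (d : ℝ) / 2 + 1 < s) (M : ℝ)
    {K : Set (Fin n → ℝ)} {ρ : ℝ} (hρ : 0 < ρ) (hK : IsCompact (Metric.cthickening ρ K))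
    (hKU : Metric.cthickening ρ K ⊆ 𝒰) :
    ∃ C : ℝ, 0 < C ∧ ∃ T : ℝ, 0 < T ∧ ∀ N : ℕ, 1 ≤ N → ∀ (c₀ : boxSpace d n N) (m : ℝ),
      0 < m → m ≤ M → hsN s c₀.1 ≤ m →
      (∀ x, synth c₀.1 x ∈ Metric.cthickening (ρ / 2) K) → ∀ t, 0 ≤ t → t * m ≤ T →
      ∃ J c, IsODESolution (polyField σ N A) c₀ J c ∧ t ∈ J ∧
        hsN s (c t).1 ≤ C * m * Real.exp (C * m * t) := by
  have hr : 1 ≤ s := by have : (0 : ℝ) ≤ d := d.cast_nonneg; linarith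
  obtain ⟨a, b, ha, hb, hG⟩ := h.coercive _ hK hKU
  set C₁ := max 1 (Real.sqrt (b / a)) with hC₁
  have h1 : 1 ≤ C₁ := le_max_left _ _
  have h2 : Real.sqrt (b / a) ≤ C₁ := le_max_right _ _
  obtain ⟨κ, hκ, hest⟩ := hσ.exists_hsN_le hs hr h.symmetrizedBy ha hb hG (2 * C₁ * M)
  obtain ⟨D, hD, hop⟩ := hσ.exists_norm_polyOp_le hs A (2 * C₁ * M)
  set α := 2 * κ * C₁ with hα
  set β := 2 * C₁ * D with hβ
  have hα0 : 0 ≤ α := by positivity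
  have hβ0 : 0 ≤ β := by positivity
  have hlog : 0 < Real.log 2 := Real.log_pos (by norm_num)
  set T := min (Real.log 2 / 2 / (α + 1)) (ρ / 4 / (β + 1)) with hT
  have hT0 : 0 < T := lt_min (by positivity) (by positivity)
  have hTα : α * T < Real.log 2 := by
    have h2 : T ≤ Real.log 2 / 2 / (α + 1) := min_le_left _ _
    rw [le_div_iff₀ (by positivity)] at h2
    nlinarith
  have hTβ : β * T < ρ / 2 := by
    have h2 : T ≤ ρ / 4 / (β + 1) := min_le_right _ _
    rw [le_div_iff₀ (by positivity)] at h2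
    nlinarith
  refine ⟨C₁ + α, by positivity, T, hT0, fun N hN c₀ m hm hmM hc₀ hK₀ t ht htm => ?_⟩
  have hf := contDiff_polyField (n := n) hσ N A
  set Z : Set (boxSpace d n N) := {U | hsN s U.1 ≤ 2 * C₁ * m ∧ ‖U - c₀‖ ≤ ρ / 2} with hZ
  set O : Set (boxSpace d n N) := {U | hsN s U.1 < 2 * C₁ * m ∧ ‖U - c₀‖ < ρ / 2} with hO
  have hcn : Continuous fun U : boxSpace d n N => ‖U - c₀‖ := by fun_prop
  -- what a solution that stays in `Z` satisfies
  have hZest : ∀ (c : ℝ → boxSpace d n N) (t' : ℝ), 0 ≤ t' → t' ≤ t → c 0 = c₀ →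
      (∀ τ ∈ Set.Icc 0 t', HasDerivAt c (polyField σ N A (c τ)) τ) →
      (∀ τ ∈ Set.Icc 0 t', c τ ∈ Z) →
      hsN s (c t').1 ≤ C₁ * m * Real.exp (α * m * t') := by
    intro c t' ht' htt' h0 hd hz
    have key := hest N hN (fun τ => (c τ).1) t' (2 * C₁ * m) (by gcongr)
      (fun τ hτ ℓ i => IsODESolution.hasDerivAt_coe hσ hN h.constantLinearPart (hd τ hτ) ℓ i)
      (fun τ _ => isRealPoly_coe (c τ))
      (fun τ hτ x => by
        have h2 : synth (c τ).1 x ∈ Metric.cthickening (ρ / 2) (Metric.cthickening (ρ / 2) K) :=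
          Metric.mem_cthickening_of_dist_le _ _ _ _ (hK₀ x)
            ((dist_synth_le _ _ x).trans (hz τ hτ).2)
        have h3 := Metric.cthickening_cthickening_subset (by positivity) (by positivity) K h2
        rwa [add_halves] at h3)
      (fun τ hτ => (hz τ hτ).1) t' ⟨ht', le_rfl⟩
    simp only [h0] at key
    have e : κ * (2 * C₁ * m) * t' = α * m * t' := by rw [hα]; ring
    rw [e] at key
    refine key.trans ?_
    gcongr
    exact hsN_nonneg s _
  obtain ⟨J, c, hc, hJ, hcO⟩ := exists_isODESolution_of_bootstrap hf (Z := Z) (O := O) (c₀ := c₀)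
    (by
      refine (Metric.isBounded_closedBall (x := c₀) (r := ρ / 2)).subset fun U hU => ?_
      rw [Metric.mem_closedBall, dist_eq_norm]; exact hU.2)
    ((isClosed_le (continuous_hsN N s) continuous_const).inter
      (isClosed_le hcn continuous_const))
    ((isOpen_lt (continuous_hsN N s) continuous_const).inter (isOpen_lt hcn continuous_const))
    (fun U hU => ⟨hU.1.le, hU.2.le⟩)
    ⟨hc₀.trans_lt (by nlinarith), by simpa using hρ⟩ ht
    (fun c t' ht' htt' h0 hd hz => by
      have htm' : m * t' ≤ T := by nlinarith
      have e1 := hZest c t' ht' htt' h0 hd hz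
      refine ⟨e1.trans_lt ?_, ?_⟩
      · have : Real.exp (α * m * t') < 2 := by
          rw [← Real.lt_log_iff_exp_lt (by norm_num), mul_assoc]
          exact (mul_le_mul_of_nonneg_left htm' hα0).trans_lt hTα
        have hp : 0 < C₁ * m := by positivity
        nlinarith
      · rw [← h0]
        refine (norm_sub_le_of_hasDerivAt ht' hd (B := D * (2 * C₁ * m)) fun τ hτ =>
          norm_polyField_le hσ hN h.constantLinearPart (by positivity) fun i => ?_).trans_lt ?_
        · refine (hop N _ ((hz τ hτ).1.trans (by gcongr)) i).trans ?_
          exact mul_le_mul_of_nonneg_left (hz τ hτ).1 hD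
        · have e : D * (2 * C₁ * m) * t' = β * (m * t') := by rw [hβ]; ring
          rw [e]
          exact (mul_le_mul_of_nonneg_left htm' hβ0).trans_lt hTβ)
  refine ⟨J, c, hc, hJ ⟨ht, le_rfl⟩, ?_⟩
  have e1 := hZest c t ht le_rfl hc.initial (fun τ hτ => hc.hasDerivAt τ (hJ hτ))
    (fun τ hτ => ⟨(hcO τ hτ).1.le, (hcO τ hτ).2.le⟩)
  refine e1.trans ?_
  gcongr
  · linarith
  · linarith

/-- For a fixed `N` the time of existence is bounded below on bounded sets of data. -/
lemma exists_time_of_fixed (hσ : IsLowPassProfile σ)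
    (A : Fin 2 → Fin d → Fin n → Fin n → MvPolynomial (Fin n) ℝ) {s : ℝ}
    (hs : (d : ℝ) / 2 + 1 < s) (M : ℝ) (N : ℕ) :
    ∃ H : ℝ, 0 < H ∧ ∀ c₀ : boxSpace d n N, hsN s c₀.1 ≤ M → ∀ t, 0 ≤ t → t * H ≤ 1 →
      ∃ J c, IsODESolution (polyField σ N A) c₀ J c ∧ t ∈ J ∧ hsN s (c t).1 ≤ H := by
  have hf := contDiff_polyField (n := n) hσ N A
  obtain ⟨Cs, hCs, hSob⟩ := exists_norm_le_hsN (d := d) n hs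
  obtain ⟨CN, hCN, hle⟩ := exists_hsN_le_norm (d := d) (n := n) N s
  obtain ⟨B, hB⟩ := (isCompact_closedBall (0 : boxSpace d n N)
    (Cs * |M| + 1)).exists_bound_of_continuousOn hf.continuous.continuousOn
  set H := |B| + 1 + CN * (Cs * |M| + 1) with hH
  have hH0 : 0 < H := by positivity
  refine ⟨H, hH0, fun c₀ hc₀ t ht htH => ?_⟩
  have hball : ∀ U : boxSpace d n N, ‖U - c₀‖ ≤ 1 → ‖U‖ ≤ Cs * |M| + 1 := by
    intro U hU
    have h1 : ‖c₀‖ ≤ Cs * |M| := (hSob c₀.1).trans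
      (mul_le_mul_of_nonneg_left (hc₀.trans (le_abs_self M)) hCs)
    calc ‖U‖ = ‖c₀ + (U - c₀)‖ := by rw [add_sub_cancel]
      _ ≤ _ := (norm_add_le _ _).trans (add_le_add h1 hU)
  obtain ⟨J, c, hc, hJ, hcO⟩ := exists_isODESolution_of_bootstrap hf
    (Z := Metric.closedBall c₀ 1) (O := Metric.ball c₀ 1) Metric.isBounded_closedBall
    Metric.isClosed_closedBall Metric.isOpen_ball Metric.ball_subset_closedBall
    (Metric.mem_ball_self one_pos) ht
    (fun c t' ht' htt' h0 hd hz => by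
      rw [Metric.mem_ball, dist_eq_norm, ← h0]
      refine (norm_sub_le_of_hasDerivAt ht' hd (B := |B|) fun τ hτ => ?_).trans_lt ?_
      · refine (hB _ ?_).trans (le_abs_self B)
        rw [mem_closedBall_zero_iff]
        refine hball _ ?_
        rw [← dist_eq_norm]; exact hz τ hτ
      · by_cases h00 : t' = 0
        · rw [h00]; simp
        · have hp : 0 < t' := lt_of_le_of_ne ht' (Ne.symm h00)
          have h2 : |B| < H := by
            have : 0 ≤ CN * (Cs * |M| + 1) := by positivity
            linarith
          calc |B| * t' < H * t' := mul_lt_mul_of_pos_right h2 hp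
            _ ≤ H * t := mul_le_mul_of_nonneg_left htt' hH0.le
            _ ≤ 1 := by linarith)
  refine ⟨J, c, hc, hJ ⟨ht, le_rfl⟩, ?_⟩
  have h3 := hcO t ⟨ht, le_rfl⟩
  rw [Metric.mem_ball, dist_eq_norm] at h3
  refine (hle _ (c t).2).trans ((mul_le_mul_of_nonneg_left (hball _ h3.le) hCN).trans ?_)
  have := abs_nonneg B
  linarith

end SpectralScheme
end

noncomputable section

namespace SpectralScheme

open MeasureTheory

variable {d n : ℕ} {σ : EuclideanSpace ℝ (Fin d) → ℝ}
variable {𝒰 : Set (Fin n → ℝ)} {F : ℕ → Field d n → Field d n}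
  {A : Fin 2 → Fin d → Fin n → Fin n → MvPolynomial (Fin n) ℝ}
  {G : Fin 2 → Fin n → Fin n → MvPolynomial (Fin n) ℝ}

/-- Finitely many truncations at once: a common bound for all `N < N₀`. -/
lemma exists_time_of_lt (hσ : IsLowPassProfile σ)
    (A : Fin 2 → Fin d → Fin n → Fin n → MvPolynomial (Fin n) ℝ) {s : ℝ}
    (hs : (d : ℝ) / 2 + 1 < s) (M : ℝ) (N₀ : ℕ) :
    ∃ H : ℝ, 0 < H ∧ ∀ N < N₀, ∀ c₀ : boxSpace d n N, hsN s c₀.1 ≤ M →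
      ∀ t, 0 ≤ t → t * H ≤ 1 →
      ∃ J c, IsODESolution (polyField σ N A) c₀ J c ∧ t ∈ J ∧ hsN s (c t).1 ≤ H := by
  choose H hH hex using exists_time_of_fixed (n := n) hσ A hs M
  have hle : ∀ N < N₀, H N ≤ 1 + ∑ N ∈ Finset.range N₀, H N := fun N hN => by
    have := Finset.single_le_sum (f := H) (fun N _ => (hH N).le) (Finset.mem_range.2 hN)
    linarith
  have h0 : 0 ≤ ∑ N ∈ Finset.range N₀, H N := Finset.sum_nonneg fun N _ => (hH N).le
  refine ⟨1 + ∑ N ∈ Finset.range N₀, H N, by linarith, fun N hN c₀ hc₀ t ht htH => ?_⟩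
  obtain ⟨J, c, hc, hJ, hb⟩ := hex N c₀ hc₀ t ht
    ((mul_le_mul_of_nonneg_left (hle N hN) ht).trans htH)
  exact ⟨J, c, hc, hJ, hb.trans (hle N hN)⟩

lemma polyField_zero (N : ℕ) (A : Fin 2 → Fin d → Fin n → Fin n → MvPolynomial (Fin n) ℝ) :
    polyField (n := n) σ N A 0 = 0 := by
  have e : polyOp σ N A (((0 : boxSpace d n N) : Fin n → TrigPoly d)) = 0 := by
    funext i
    simp [polyOp, opF]
  rw [polyField, e, neg_zero, map_zero]

/-- The solution exists, with uniform bounds, on a time interval inversely proportional to the size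
of the data. Truncations with few frequencies of data that are not small need not have values in `𝒰`;
these are finitely many ordinary differential equations with data in a fixed compact set. -/
lemma IsSymmetrizableScheme.exists_time (h : IsSymmetrizableScheme σ 𝒰 F A G)
    (hσ : IsLowPassProfile σ) (hU : IsOpen 𝒰) (hU0 : 0 ∈ 𝒰) {s : ℝ} (hs : (d : ℝ) / 2 + 1 < s)
    {M : ℝ} {K : Set (Fin n → ℝ)} (hK : IsCompact K) (hKU : K ⊆ 𝒰) :
    ∃ C : ℝ, 0 < C ∧ ∃ T : ℝ, 0 < T ∧ ∀ N : ℕ, 1 ≤ N → ∀ U₀ : Field d n,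
      MemHs s U₀ → hsNorm s U₀ ≤ M → (∀ᵐ x, U₀ x ∈ K) →
      ∀ t, 0 ≤ t → t * hsNorm s U₀ ≤ T →
      ∃ J c, IsODESolution (polyField σ N A) ⟨_, proj_mem_boxSpace N U₀⟩ J c ∧ t ∈ J ∧
        hsN s (c t).1 ≤ C * hsNorm s U₀ * Real.exp (C * hsNorm s U₀ * t) := by
  set K₀ : Set (Fin n → ℝ) := insert 0 K with hK₀
  have hK₀c : IsCompact K₀ := hK.insert 0
  obtain ⟨ρ, hρ, hρU⟩ := hK₀c.exists_cthickening_subset_open hU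
    (Set.insert_subset hU0 hKU)
  obtain ⟨C₁, hC₁, T₁, hT₁, hgood⟩ := h.exists_time_of_mem hσ hs M hρ hK₀c.cthickening hρU
  obtain ⟨Cp, hCp, hproj⟩ := exists_synth_proj_mem_cthickening (d := d) n hs
  obtain ⟨Cs, hCs, hSob⟩ := exists_norm_le_hsN (d := d) n hs
  -- beyond `N₀` the truncations stay close to `K`; below `ε` they stay close to `0`
  obtain ⟨N₀, hN₀⟩ := exists_nat_ge (2 * Cp * M / ρ)
  set ε := ρ / 2 / (Cs + 1) with hε
  have hε0 : 0 < ε := by positivity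
  obtain ⟨H, hH, hbad⟩ := exists_time_of_lt (n := n) hσ A hs M N₀
  refine ⟨C₁ + H / ε, by positivity, min T₁ (ε / H), lt_min hT₁ (by positivity),
    fun N hN U₀ hU₀ hm hUK t ht htm => ?_⟩
  set m := hsNorm s U₀ with hmdef
  have hm0 : 0 ≤ m := Real.sqrt_nonneg _
  have hN' : (0 : ℝ) < N := by exact_mod_cast hN
  set c₀ : boxSpace d n N := ⟨_, proj_mem_boxSpace N U₀⟩ with hc₀
  have hc₀m : hsN s c₀.1 ≤ m := hsN_proj_le hU₀ N
  have hsmall : ‖c₀.1‖ ≤ Cs * m := (hSob _).trans (mul_le_mul_of_nonneg_left hc₀m hCs)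
  rcases hm0.eq_or_lt with hz | hpos
  -- vanishing data: the constraint `t * m ≤ T` is void, and the solution is identically zero
  · have e0 : c₀ = 0 := by
      rw [← hz, mul_zero] at hsmall
      exact Subtype.ext (norm_le_zero_iff.1 hsmall)
    refine ⟨Set.univ, fun _ => 0, ⟨isOpen_univ, Set.ordConnected_univ, trivial, e0.symm,
      fun t _ => ?_⟩, trivial, ?_⟩
    · rw [polyField_zero]; exact hasDerivAt_const t 0
    · rw [e0] at hc₀m
      refine hc₀m.trans ?_
      rw [← hz]; simp
  have hCle : ∀ C, 0 ≤ C → C ≤ C₁ + H / ε → C * m * Real.exp (C * m * t) ≤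
      (C₁ + H / ε) * m * Real.exp ((C₁ + H / ε) * m * t) := by
    intro C hC hle
    gcongr
  -- if `N < N₀` and `ε ≤ m`, the factor `H / ε` in `C` makes the asserted bound at least `H`
  by_cases hcase : N < N₀ ∧ ε ≤ m
  · obtain ⟨J, c, hc, hJ, hb⟩ := hbad N hcase.1 c₀ (hc₀m.trans hm) t ht (by
      have h1 : t * m ≤ ε / H := htm.trans (min_le_right _ _)
      rw [le_div_iff₀ hH] at h1
      have h2 : t * ε * H ≤ t * m * H := by gcongr; exact hcase.2
      have h3 : ε * (t * H) ≤ ε * 1 := by linarith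
      exact le_of_mul_le_mul_left h3 hε0)
    refine ⟨J, c, hc, hJ, hb.trans ?_⟩
    refine le_trans ?_ (hCle (H / ε) (by positivity) (by linarith))
    have h1 : H ≤ H / ε * m := by
      rw [div_mul_eq_mul_div, le_div_iff₀ hε0]
      exact mul_le_mul_of_nonneg_left hcase.2 hH.le
    have h2 : 1 ≤ Real.exp (H / ε * m * t) := Real.one_le_exp (by positivity)
    calc H ≤ H / ε * m := h1
      _ ≤ _ := le_mul_of_one_le_right (by positivity) h2
  · have hnear : ∀ x, synth c₀.1 x ∈ Metric.cthickening (ρ / 2) K₀ := by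
      intro x
      by_cases hNN : N < N₀
      · have hmε : m ≤ ε := le_of_lt (not_le.1 fun h => hcase ⟨hNN, h⟩)
        refine Metric.mem_cthickening_of_dist_le _ 0 _ _ (Set.mem_insert _ _) ?_
        have h1 := dist_synth_le c₀.1 0 x
        have e : synth (0 : Fin n → TrigPoly d) x = 0 := by ext i; simp [synth]
        rw [e, sub_zero] at h1
        refine h1.trans (hsmall.trans ((mul_le_mul_of_nonneg_left hmε hCs).trans ?_))
        rw [hε, mul_div_assoc', div_le_iff₀ (by positivity)]
        nlinarith
      · have h1 := hproj N hN U₀ hU₀ K hUK x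
        refine Metric.cthickening_mono ?_ _ (Metric.cthickening_subset_of_subset _
          (Set.subset_insert 0 K) h1)
        rw [div_le_iff₀ hN']
        rw [div_le_iff₀ hρ] at hN₀
        have h2 : (N₀ : ℝ) ≤ N := by exact_mod_cast not_lt.1 hNN
        have h3 : Cp * m ≤ Cp * M := mul_le_mul_of_nonneg_left hm hCp
        have h4 : (N₀ : ℝ) * ρ ≤ N * ρ := mul_le_mul_of_nonneg_right h2 hρ.le
        change Cp * m ≤ _
        linarith
    obtain ⟨J, c, hc, hJ, hb⟩ := hgood N hN c₀ m hpos hm hc₀m hnear t ht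
      (htm.trans (min_le_left _ _))
    exact ⟨J, c, hc, hJ, hb.trans (hCle C₁ hC₁.le (le_add_of_nonneg_right (by positivity)))⟩

/-- Existence on a uniform time interval, uniform bounds, and smoothness. -/
lemma IsSymmetrizableScheme.exists_uniform (h : IsSymmetrizableScheme σ 𝒰 F A G)
    (hσ : IsLowPassProfile σ) (hU : IsOpen 𝒰) (hU0 : 0 ∈ 𝒰) {s : ℝ} (hs : (d : ℝ) / 2 + 1 < s)
    {M : ℝ} {K : Set (Fin n → ℝ)} (hK : IsCompact K) (hKU : K ⊆ 𝒰) :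
    ∃ C : ℝ, 0 < C ∧ ∃ T : ℝ, 0 < T ∧ ∀ N : ℕ, 1 ≤ N → ∀ U₀ : Field d n,
      MemHs s U₀ → hsNorm s U₀ ≤ M → (∀ᵐ x, U₀ x ∈ K) →
      ∃ (I : Set ℝ) (U : ℝ → Field d n),
        IsUniqueMaximalSolution s (F N) (sharpFilter N U₀) I U ∧
        (∀ t : ℝ, 0 ≤ t → t * hsNorm s U₀ ≤ T → t ∈ I ∧
          hsNorm s (U t) ≤ C * hsNorm s U₀ * Real.exp (C * hsNorm s U₀ * t) ∧
          C * hsNorm s U₀ * Real.exp (C * hsNorm s U₀ * t) ≤ 2 * C * hsNorm s U₀) ∧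
        (∀ s' : ℝ, s ≤ s' → ContDiffOneIntoHs s' I U) := by
  obtain ⟨C, hC, T, hT, hex⟩ := h.exists_time hσ hU hU0 hs hK hKU
  have hlog : 0 < Real.log 2 := Real.log_pos (by norm_num)
  -- `T ≤ log 2 / C` makes the exponential at most `2`
  refine ⟨C, hC, min T (Real.log 2 / C), lt_min hT (by positivity), fun N hN U₀ hU₀ hm hUK => ?_⟩
  obtain ⟨I, c, hI, hsm, hmax⟩ := h.exists_maximal hσ hN ⟨_, proj_mem_boxSpace N U₀⟩ s
  rw [sharpFilter_eq]
  refine ⟨I, fun t => synth (c t).1, hI, fun t ht htm => ?_, fun s' _ => hsm s'⟩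
  obtain ⟨J, c', hc', hJ, hb⟩ := hex N hN U₀ hU₀ hm hUK t ht (htm.trans (min_le_left _ _))
  obtain ⟨hsub, hagree⟩ := hmax J c' hc'
  refine ⟨hsub hJ, ?_, ?_⟩
  · rw [hsNorm_synth_coe, ← hagree t hJ]
    exact hb
  · have hm0 : 0 ≤ hsNorm s U₀ := Real.sqrt_nonneg _
    have h1 : C * hsNorm s U₀ * t ≤ Real.log 2 := by
      have h2 := htm.trans (min_le_right _ _)
      rw [le_div_iff₀ hC] at h2
      linarith
    have h3 : Real.exp (C * hsNorm s U₀ * t) ≤ 2 :=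
      (Real.exp_le_exp.2 h1).trans (Real.exp_log (by norm_num)).le
    have h4 : 0 ≤ C * hsNorm s U₀ := by positivity
    nlinarith

lemma IsSymmetrizer.isSymmetrizableScheme {A : Fin d → PolyMatrix n} {S : PolyMatrix n}
    (hS : IsSymmetrizer A S 𝒰) (hσ : IsLowPassProfile σ) :
    IsSymmetrizableScheme σ 𝒰 (filteredOp A σ) (coefA A) (coefS S) where
  constantLinearPart := fun j i l => ⟨0, by simp [coefA]⟩
  represents := fun N _ => represents_filteredOp hσ A N
  linearOffBox := fun N hN => isLinearOffBox_filteredOp hσ hN A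
  symmetrizedBy := hS.isSymmetrizedBy
  coercive := fun K hK hKU => hS.exists_isCoerciveOn hσ hK hKU

lemma IsSymmetrizer.isSymmetrizableScheme' {A : Fin d → PolyMatrix n} {S : PolyMatrix n}
    (hS : IsSymmetrizer A S 𝒰) (hc : IsCompatible A S 𝒰) (hσ : IsLowPassProfile σ) :
    IsSymmetrizableScheme σ 𝒰 (linearUnfilteredOp A σ) (coefA' A) (coefS' S) where
  constantLinearPart := fun j i l => ⟨_, by simp [coefA']; rfl⟩
  represents := fun N _ => represents_linearUnfilteredOp hσ A N
  linearOffBox := fun N hN => isLinearOffBox_linearUnfilteredOp hσ hN A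
  symmetrizedBy := hS.isSymmetrizedBy' hc
  coercive := fun K hK hKU => hS.exists_isCoerciveOn' hσ hK hKU

end SpectralScheme
end

theorem proposition3p2 {d n : ℕ}
    (A : Fin d → SpectralScheme.PolyMatrix n) (S : SpectralScheme.PolyMatrix n)
    (𝒰 : Set (Fin n → ℝ)) (hS : SpectralScheme.IsSymmetrizer A S 𝒰)
    (σ : EuclideanSpace ℝ (Fin d) → ℝ) (hσ : SpectralScheme.IsLowPassProfile σ)
    -- the spatial operator, for each `N`, of one of the two schemes
    (F : ℕ → SpectralScheme.Field d n → SpectralScheme.Field d n)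
    (hF : F = SpectralScheme.filteredOp A σ ∨
      (SpectralScheme.IsCompatible A S 𝒰 ∧ F = SpectralScheme.linearUnfilteredOp A σ))
    (s : ℝ) (hs : (d : ℝ) / 2 + 1 < s) :
    -- existence on a time interval independent of `N`, uniform bound, smoothness
    (∀ M : ℝ, 0 < M → ∀ K : Set (Fin n → ℝ), IsCompact K → K ⊆ 𝒰 →
      ∃ C : ℝ, 0 < C ∧ ∃ T : ℝ, 0 < T ∧
        ∀ N : ℕ, 1 ≤ N → ∀ U₀ : SpectralScheme.Field d n,
          SpectralScheme.MemHs s U₀ → SpectralScheme.hsNorm s U₀ ≤ M → (∀ᵐ x, U₀ x ∈ K) →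
          ∃ (I : Set ℝ) (U : ℝ → SpectralScheme.Field d n),
            SpectralScheme.IsUniqueMaximalSolution s (F N) (SpectralScheme.sharpFilter N U₀) I U ∧
            -- `0 ≤ t ≤ T / |U₀|`, with no upper bound on `t` when `U₀ = 0`
            (∀ t : ℝ, 0 ≤ t → t * SpectralScheme.hsNorm s U₀ ≤ T →
              t ∈ I ∧
              SpectralScheme.hsNorm s (U t) ≤
                C * SpectralScheme.hsNorm s U₀ * Real.exp (C * SpectralScheme.hsNorm s U₀ * t) ∧
              C * SpectralScheme.hsNorm s U₀ * Real.exp (C * SpectralScheme.hsNorm s U₀ * t) ≤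
                2 * C * SpectralScheme.hsNorm s U₀) ∧
            (∀ s' : ℝ, s ≤ s' → SpectralScheme.ContDiffOneIntoHs s' I U)) ∧
    -- propagation of higher norms
    (∀ s' : ℝ, s ≤ s' → ∀ M' : ℝ, 0 < M' →
      ∀ K' : Set (Fin n → ℝ), IsCompact K' → K' ⊆ 𝒰 →
      ∃ C' : ℝ, 0 < C' ∧
        ∀ N : ℕ, 1 ≤ N → ∀ U₀ : SpectralScheme.Field d n,
          SpectralScheme.MemHs s' U₀ →
          ∀ (I : Set ℝ) (U : ℝ → SpectralScheme.Field d n),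
            SpectralScheme.IsUniqueMaximalSolution s (F N) (SpectralScheme.sharpFilter N U₀) I U →
            ∀ T' ∈ I, 0 < T' →
              (∀ t ∈ Set.Icc 0 T', SpectralScheme.hsNorm s (U t) ≤ M') →
              (∀ t ∈ Set.Icc 0 T', ∀ x, U t x ∈ K') →
              ∀ t ∈ Set.Icc 0 T',
                SpectralScheme.hsNorm s' (U t) ≤
                  C' * SpectralScheme.hsNorm s' U₀ * Real.exp (C' * M' * t)) := by
  have hscheme : ∃ B G, SpectralScheme.IsSymmetrizableScheme σ 𝒰 F B G := by
    rcases hF with rfl | ⟨hc, rfl⟩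
    · exact ⟨_, _, hS.isSymmetrizableScheme hσ⟩
    · exact ⟨_, _, hS.isSymmetrizableScheme' hc hσ⟩
  obtain ⟨B, G, h⟩ := hscheme
  refine ⟨fun M _ K hK hKU => h.exists_uniform hσ hS.isOpen hS.zero_mem hs hK hKU,
    fun s' hs' M' hM' K' hK' hKU' => ?_⟩
  exact h.exists_hsNorm_le hσ hs hs' M' hM' hK' hKU'
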